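/- **Setting.** Let $n\ge 2$, $m>0$, $\mu,\gamma\in\mathbb R^n$, let $\Sigma$ be a real symmetric positive definite $n\times n$ matrix and $\Sigma^{1/2}$ its positive definite square root. The density of $St_d(\mu,\Sigma,\nu)$ on $\mathbb R^d$ is $$\frac{\Gamma(\frac{\nu+d}2)}{\Gamma(\frac\nu2)(\nu\pi)^{d/2}\sqrt{|\Sigma|}}\Big(1+\tfrac{(x-\mu)^T\Sigma^{-1}(x-\mu)}{\nu}\Big)^{-(\nu+d)/2}.$$ A skewing function is a measurable $H:\mathbb R\to[0,1]$ with $H(-x)=1-H(x)$. Write $Y\sim GSSt_n(\mu,\Sigma,\gamma,m,H)$ if $Y$ has density $2\,f_{St_n(\mu,\Sigma,m)}(y)\,H(\gamma^T\Sigma^{-1/2}(y-\mu))$. For a generator $G$ on $[0,\infty)$ put $N_d(G)=\frac{\Gamma(d/2)}{(2\pi)^{d/2}}\big[\int_0^\infty s^{d/2-1}G(s)\,ds\big]^{-1}$ for $d\ge1$ and $N_0(G)=1/G(0)$. The elliptical density $E_d(\mu,\Sigma,G)$ is $\frac{N_d(G)}{\sqrt{|\Sigma|}}G(\frac12(x-\mu)^T\Sigma^{-1}(x-\mu))$,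 and $GSE_d(\mu,\Sigma,G,K)$ has density $2E_d(\mu,\Sigma,G)(y)\,K(\Sigma^{-1/2}(y-\mu))$. Put $g_n(u)=(1+2u/m)^{-(m+n)/2}$, $\overline G_n(u)=\int_u^\infty g_n$, $\overline{\mathcal G}_n(u)=\int_u^\infty\overline G_n$, $c_n=N_n(g_n)$, $c_n^*=N_n(\overline G_n)$, $c_n^{**}=N_n(\overline{\mathcal G}_n)$. For $\lambda\in\mathbb R^n$ put $c^*_{n-1,k}=N_{n-1}(\overline G_n(\cdot+\frac{\lambda_k^2}2))$, $c^{**}_{n-1,k}=N_{n-1}(\overline{\mathcal G}_n(\cdot+\frac{\lambda_k^2}2))$, $c^{**}_{n-2,ij}=N_{n-2}(\overline{\mathcal G}_n(\cdot+\frac{\lambda_i^2+\lambda_j^2}2))$, and let $W_{-k},V_{-k},U_{-ij}$ $(i\ne j)$ have the densities $$f_{W_{-k}}(w)=c^*_{n-1,k}\overline G_n\big(\tfrac{|w|^2+\lambda_k^2}2\big),\quad f_{V_{-k}}(v)=c^{**}_{n-1,k}\overline{\mathcal G}_n\big(\tfrac{|v|^2+\lambda_k^2}2\big),\quad f_{U_{-ij}}(u)=c^{**}_{n-2,ij}\overline{\mathcal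 G}_n\big(\tfrac{|u|^2+\lambda_i^2+\lambda_j^2}2\big)$$ on $\mathbb R^{n-1},\mathbb R^{n-1},\mathbb R^{n-2}$; coordinates are indexed by the indices other than $k$, resp. $i,j$. $\xi_k$ (resp. $\eta_k$) is $w$ (resp. $v$) with $\lambda_k$ inserted at place $k$, $\tau_{ij}$ is $u$ with $\lambda_i,\lambda_j$ inserted at places $i,j$; $\lambda_{-k},\lambda_{-ij}$ are $\lambda$ with these coordinates deleted. For a density $f_X$, $\overline E^t_X[h(X)]=\int_{\{x:\,x_i>t_i\ \forall i\}}h f_X$ and $\overline F_X(t)=\overline E_X^t[1]$. Inequalities between vectors are componentwise. **1. Generators and constants.** The density of $GSSt_n(\mu,\Sigma,\gamma,m,H)$ is that of $GSE_n(\mu,\Sigma,g_n,H(\gamma^T\cdot))$, with $c_n=\Gamma(\frac{m+n}2)/(\Gamma(\frac m2)(m\pi)^{n/2})$. For $t\ge0$, $\overline G_n(t)=\frac m{m+n-2}(1+\frac{2t}m)^{-(m+n-2)/2}$, and, if $m+n>4$, $\overline{\mathcal G}_n(t)=\frac m{m+n-2}\frac m{m+n-4}(1+\frac{2t}m)^{-(m+n-4)/2}$.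 If $m>2$, $$c_n^*=\tfrac{(m+n-2)\Gamma(n/2)}{(2\pi)^{n/2}m}\Big[\int_0^\infty t^{\frac n2-1}(1+\tfrac{2t}m)^{-\frac{m+n-2}2}dt\Big]^{-1}=\tfrac{(m+n-2)\Gamma(n/2)}{(m\pi)^{n/2}mB(\frac n2,\frac{m-2}2)},\qquad \tfrac{c_n}{c_n^*}=\tfrac m{m-2}.$$ If $m>4$, $$c_n^{**}=\tfrac{(m+n-2)(m+n-4)\Gamma(n/2)}{(2\pi)^{n/2}m^2}\Big[\int_0^\infty t^{\frac n2-1}(1+\tfrac{2t}m)^{-\frac{m+n-4}2}dt\Big]^{-1}=\tfrac{(m+n-2)(m+n-4)\Gamma(n/2)}{(m\pi)^{n/2}m^2B(\frac n2,\frac{m-4}2)},\qquad \tfrac{c_n}{c_n^{**}}=\tfrac{m^2}{(m-2)(m-4)}.$$ **2. The vectors $W,V,U$.** Let $\Delta_k=\frac{m+\lambda_k^2}{m-1}I_{n-1}$, $\Lambda_k=\frac{m+\lambda_k^2}{m-3}I_{n-1}$, $\Theta_{ij}=\frac{m+\lambda_i^2+\lambda_j^2}{m-2}I_{n-2}$.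 For every $\lambda\in\mathbb R^n$: If $m>1$: $f_{W_{-k}}(w)=c^*_{n-1,k}\frac m{m+n-2}(1+\frac{\lambda_k^2}m)^{-\frac{m+n-2}2}(1+\frac{w^T\Delta_k^{-1}w}{m-1})^{-\frac{m+n-2}2}$, $W_{-k}\sim St_{n-1}(0,\Delta_k,m-1)$, $$c^*_{n-1,k}=\tfrac{\Gamma(\frac{m+n-2}2)(m+n-2)}{\Gamma(\frac{m-1}2)\pi^{\frac{n-1}2}m^{\frac{m+n}2}}(m+\lambda_k^2)^{\frac{m-1}2},\qquad \tfrac{c_n}{c^*_{n-1,k}}=\tfrac{\Gamma(\frac{m-1}2)m^{m/2}}{2\Gamma(\frac m2)\sqrt\pi}(m+\lambda_k^2)^{-\frac{m-1}2}.$$ If $m>3$: $f_{V_{-k}}(v)=c^{**}_{n-1,k}\frac m{m+n-2}\frac m{m+n-4}(1+\frac{\lambda_k^2}m)^{-\frac{m+n-4}2}(1+\frac{v^T\Lambda_k^{-1}v}{m-3})^{-\frac{m+n-4}2}$, $V_{-k}\sim St_{n-1}(0,\Lambda_k,m-3)$, $$c^{**}_{n-1,k}=\tfrac{\Gamma(\frac{m+n-4}2)(m+n-2)(m+n-4)}{\Gamma(\frac{m-3}2)\pi^{\frac{n-1}2}m^{\frac{m+n}2}}(m+\lambda_k^2)^{\frac{m-3}2},\qquad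 \tfrac{c_n}{c^{**}_{n-1,k}}=\tfrac{\Gamma(\frac{m-3}2)m^{m/2}}{4\Gamma(\frac m2)\sqrt\pi}(m+\lambda_k^2)^{-\frac{m-3}2}.$$ If $m>2$ and $i\ne j$: $f_{U_{-ij}}(u)=c^{**}_{n-2,ij}\frac m{m+n-2}\frac m{m+n-4}(1+\frac{\lambda_i^2+\lambda_j^2}m)^{-\frac{m+n-4}2}(1+\frac{u^T\Theta_{ij}^{-1}u}{m-2})^{-\frac{m+n-4}2}$, $U_{-ij}\sim St_{n-2}(0,\Theta_{ij},m-2)$, $$c^{**}_{n-2,ij}=\tfrac{\Gamma(\frac{m+n-4}2)(m+n-2)(m+n-4)}{\Gamma(\frac{m-2}2)\pi^{\frac{n-2}2}m^{\frac{m+n}2}}(m+\lambda_i^2+\lambda_j^2)^{\frac{m-2}2},\qquad \tfrac{c_n}{c^{**}_{n-2,ij}}=\tfrac{m^{m/2}}{2(m-2)\pi}(m+\lambda_i^2+\lambda_j^2)^{-\frac{m-2}2}.$$ **3. Standardization.** Let $Y\sim GSSt_n(\mu,\Sigma,\gamma,m,H)$ with $H$ a skewing function, and $Z=\Sigma^{-1/2}(Y-\mu)$.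 Then $Z\sim GSSt_n(0,I_n,\gamma,m,H)$. Put $MTCE_Z(\lambda)=E[Z\mid Z>\lambda]$ and $\Omega(\lambda)=\operatorname{Cov}(Z\mid Z>\lambda)$. If $m>2$, $Y$ and $Z$ are square integrable. If moreover $q\in(0,1)^n$, $y_q=(VaR_{q_i}(Y_i))_i$ with $VaR_q(X)=\inf\{x:F_X(x)\ge q\}$, $\lambda_q=\Sigma^{-1/2}(y_q-\mu)$ and $\overline F_Z(\lambda_q)>0$, then $$E[Y\mid Z>\lambda_q]=\mu+\Sigma^{1/2}MTCE_Z(\lambda_q),\qquad \operatorname{Cov}(Y\mid Z>\lambda_q)=\Sigma^{1/2}\,\Omega(\lambda_q)\,\Sigma^{1/2};$$ if $\Sigma$ is diagonal, the same holds with the event $\{Y>y_q\}$ in place of $\{Z>\lambda_q\}$, i.e. $MTCov_Y(y_q)=\Sigma^{1/2}\Omega(\lambda_q)\Sigma^{1/2}$. **4. Entries of $\Omega$, general $H$.** Let $m>4$, $H$ a twice continuously differentiable skewing function, $Y$, $Z$ as in 3, and $\lambda\in\mathbb R^n$ with $\overline F_Z(\lambda)>0$ such that the tail expectations below that contain $H'$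 or $H''$ (those of $M$ and $X^{**}$, and those of $V_{-k}$ for all $k$) exist as absolutely convergent integrals. With $M\sim St_n(0,I_n,m)$, $X^{**}\sim E_n(0,I_n,\overline{\mathcal G}_n)$, $Z^*\sim GSE_n(0,I_n,\overline G_n,H(\gamma^T\cdot))$, $$MTCE_Z(\lambda)_k=\tfrac1{\overline F_Z(\lambda)}\Big\{\tfrac{2c_n}{c^*_{n-1,k}}\overline E^{\lambda_{-k}}_{W_{-k}}[H(\gamma^T\xi_k)]+\tfrac{2m\gamma_k}{m+n-2}\overline E^{\lambda}_M\big[(1+\tfrac{M^TM}m)H'(\gamma^TM)\big]\Big\},$$ for $i\neq j$ $$\Omega_{ij}=\tfrac2{\overline F_Z(\lambda)}\Big\{\tfrac{c_n}{c^{**}_{n-2,ij}}\overline E^{\lambda_{-ij}}_{U_{-ij}}[H(\gamma^T\tau_{ij})]+\tfrac{c_n}{c^{**}_{n-1,i}}\gamma_j\overline E^{\lambda_{-i}}_{V_{-i}}[H'(\gamma^T\eta_i)]+\tfrac{c_n}{c^{**}_{n-1,j}}\gamma_i\overline E^{\lambda_{-j}}_{V_{-j}}[H'(\gamma^T\eta_j)]+\tfrac{m^2\gamma_i\gamma_j}{(m-2)(m-4)}\overline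 E^\lambda_{X^{**}}[H''(\gamma^TX^{**})]\Big\}-MTCE_Z(\lambda)_iMTCE_Z(\lambda)_j,$$ $$\Omega_{ii}=\tfrac2{\overline F_Z(\lambda)}\Big\{\tfrac{c_n}{c^*_{n-1,i}}\lambda_i\overline E^{\lambda_{-i}}_{W_{-i}}[H(\gamma^T\xi_i)]+\tfrac{c_n}{c^{**}_{n-1,i}}\gamma_i\overline E^{\lambda_{-i}}_{V_{-i}}[H'(\gamma^T\eta_i)]+\tfrac{m^2\gamma_i^2}{(m-2)(m-4)}\overline E^\lambda_{X^{**}}[H''(\gamma^TX^{**})]\Big\}+\tfrac m{m-2}\tfrac{\overline F_{Z^*}(\lambda)}{\overline F_Z(\lambda)}-MTCE_Z(\lambda)_i^2 .$$ **5. Skew Student-$t$.** Let $m>4$, let $H=T$ be the distribution function and $\mathbf t$ the density of the one-dimensional standard Student-$t$ distribution with $m$ degrees of freedom. Then for every $\lambda\in\mathbb R^n$ the three formulas of 4 hold with $H$ replaced by $T$, $H'$ by $\mathbf t$, and $\frac{m^2}{(m-2)(m-4)}\overline E^\lambda_{X^{**}}[H''(\gamma^TX^{**})]$ by $-\frac{(m+1)m}{(m-2)(m-4)}\overline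 E^\lambda_{X^{**}}\big[(1+\frac{(\gamma^TX^{**})^2}m)^{-1}\gamma^TX^{**}\,\mathbf t(\gamma^TX^{**})\big]$. **6. Symmetric Student-$t$.** Let $m>2$ and $H\equiv\frac12$. Then $Z\sim St_n(0,I_n,m)$ and, with $Z^*\sim E_n(0,I_n,\overline G_n)$, for every $\lambda\in\mathbb R^n$ $$MTCE_Z(\lambda)_k=\tfrac{1}{\overline F_Z(\lambda)}\tfrac{c_n}{c^*_{n-1,k}}\overline F_{W_{-k}}(\lambda_{-k}),\qquad \Omega_{ij}=\tfrac1{\overline F_Z(\lambda)}\tfrac{c_n}{c^{**}_{n-2,ij}}\overline F_{U_{-ij}}(\lambda_{-ij})-MTCE_Z(\lambda)_iMTCE_Z(\lambda)_j\ (i\ne j),$$ $$\Omega_{ii}=\tfrac1{\overline F_Z(\lambda)}\tfrac{c_n}{c^*_{n-1,i}}\lambda_i\overline F_{W_{-i}}(\lambda_{-i})+\tfrac m{m-2}\tfrac{\overline F_{Z^*}(\lambda)}{\overline F_Z(\lambda)}-MTCE_Z(\lambda)_i^2 .$$ -/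

import Mathlib

open MeasureTheory ProbabilityTheory Matrix

noncomputable section

namespace SkewStudent

/-! ### Linear algebra and index bookkeeping -/

open scoped MatrixOrder in
/-- The positive semidefinite square root `A^{1/2}` of a positive semidefinite real matrix. -/
def msqrt {ι : Type*} [Fintype ι] [DecidableEq ι] (A : Matrix ι ι ℝ) : Matrix ι ι ℝ :=
  CFC.sqrt A

/-- The open upper orthant `{z : z_i > t_i for all i}`, i.e. the domain of `∫_t^∞`. -/
def orthant {ι : Type*} (t : ι → ℝ) : Set (ι → ℝ) := {z | ∀ i, t i < z i}

/-- Index set of the coordinates other than `k`. -/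
abbrev Drop1 {n : ℕ} (k : Fin n) : Type := {l : Fin n // l ≠ k}

/-- Index set of the coordinates other than `i` and `j`. -/
abbrev Drop2 {n : ℕ} (i j : Fin n) : Type := {l : Fin n // l ≠ i ∧ l ≠ j}

/-- The vector `lam_{-k}`, obtained from `lam` by deleting coordinate `k`. -/
def drop1 {n : ℕ} (k : Fin n) (lam : Fin n → ℝ) : Drop1 k → ℝ := fun l => lam l

/-- The vector `lam_{-ij}`, obtained from `lam` by deleting the coordinates `i` and `j`. -/
def drop2 {n : ℕ} (i j : Fin n) (lam : Fin n → ℝ) : Drop2 i j → ℝ := fun l => lam l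

/-- The vector `(w_1, …, w_{k-1}, lam_k, w_{k+1}, …, w_n)`. -/
def insert1 {n : ℕ} (k : Fin n) (lam : Fin n → ℝ) (w : Drop1 k → ℝ) : Fin n → ℝ :=
  fun l => if h : l ≠ k then w ⟨l, h⟩ else lam l

/-- The vector with coordinates `lam_i`, `lam_j` in the places `i`, `j` and `u_l` elsewhere. -/
def insert2 {n : ℕ} (i j : Fin n) (lam : Fin n → ℝ) (u : Drop2 i j → ℝ) : Fin n → ℝ :=
  fun l => if h : l ≠ i ∧ l ≠ j then u ⟨l, h⟩ else lam l

/-! ### Density generators and (skew-)elliptical densities -/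

/-- Cumulative generator `u ↦ ∫_u^∞ g(v) dv`. -/
def cumGen (g : ℝ → ℝ) : ℝ → ℝ := fun u => ∫ v in Set.Ioi u, g v

/-- Shifted generator `u ↦ G(u + a)`. -/
def shiftGen (G : ℝ → ℝ) (a : ℝ) : ℝ → ℝ := fun u => G (u + a)

/-- Normalizing constant of the `d`-variate elliptical density with generator `G`:
`Γ(d/2) / (2π)^{d/2} * [∫_0^∞ s^{d/2-1} G(s) ds]⁻¹`.  In dimension `0` (where `ℝ^0` is one point of
mass one and the formula has no meaning) it is `1 / G(0)`. -/
def normConst (d : ℕ) (G : ℝ → ℝ) : ℝ :=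
  if d = 0 then (G 0)⁻¹
  else Real.Gamma ((d : ℝ) / 2) / (2 * Real.pi) ^ ((d : ℝ) / 2) *
    (∫ s in Set.Ioi (0 : ℝ), s ^ ((d : ℝ) / 2 - 1) * G s)⁻¹

section densities

variable {ι : Type*} [Fintype ι] [DecidableEq ι]

/-- Density of the elliptical distribution `E(μ, Σ, G)`. -/
def ellPDF (μ : ι → ℝ) (Sig : Matrix ι ι ℝ) (G : ℝ → ℝ) (x : ι → ℝ) : ℝ :=
  normConst (Fintype.card ι) G / √Sig.det * G (1 / 2 * ((x - μ) ⬝ᵥ (Sig⁻¹ *ᵥ (x - μ))))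

/-- Density of the generalized skew-elliptical distribution `GSE(μ, Σ, G, K)`, for a skewing
function `K` on `ℝ^ι`. -/
def gsePDF (μ : ι → ℝ) (Sig : Matrix ι ι ℝ) (G : ℝ → ℝ) (K : (ι → ℝ) → ℝ) (y : ι → ℝ) : ℝ :=
  2 * ellPDF μ Sig G y * K ((msqrt Sig)⁻¹ *ᵥ (y - μ))

/-- Density of the multivariate Student-t distribution `St(μ, Σ, ν)`. -/
def stPDF (μ : ι → ℝ) (Sig : Matrix ι ι ℝ) (ν : ℝ) (x : ι → ℝ) : ℝ :=
  Real.Gamma ((ν + Fintype.card ι) / 2) /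
      (Real.Gamma (ν / 2) * (ν * Real.pi) ^ ((Fintype.card ι : ℝ) / 2) * √Sig.det) *
    (1 + (x - μ) ⬝ᵥ (Sig⁻¹ *ᵥ (x - μ)) / ν) ^ (-(ν + Fintype.card ι) / 2)

/-- Density of the generalized skew Student-t distribution `GSSt(μ, Σ, γ, m, H)`. -/
def gsstPDF (μ : ι → ℝ) (Sig : Matrix ι ι ℝ) (γ : ι → ℝ) (m : ℝ) (H : ℝ → ℝ) (y : ι → ℝ) : ℝ :=
  2 * stPDF μ Sig m y * H (γ ⬝ᵥ ((msqrt Sig)⁻¹ *ᵥ (y - μ)))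

/-- Tail expectation `∫_t^∞ h(z) f(z) dz` with respect to a density `f`. -/
def tailExp (f : (ι → ℝ) → ℝ) (t : ι → ℝ) (h : (ι → ℝ) → ℝ) : ℝ :=
  ∫ z in orthant t, h z * f z

/-- The tail expectation `∫_t^∞ h(z) f(z) dz` exists as a finite Lebesgue integral. -/
def HasTailExp (f : (ι → ℝ) → ℝ) (t : ι → ℝ) (h : (ι → ℝ) → ℝ) : Prop :=
  IntegrableOn (fun z => h z * f z) (orthant t)

/-- Tail function `∫_t^∞ f(z) dz` of a density `f`. -/
def tailFn (f : (ι → ℝ) → ℝ) (t : ι → ℝ) : ℝ := ∫ z in orthant t, f z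

end densities

/-- `H` is a skewing function on the line. -/
def IsSkewing (H : ℝ → ℝ) : Prop :=
  Measurable H ∧ (∀ x, H (-x) = 1 - H x) ∧ ∀ x, 0 ≤ H x ∧ H x ≤ 1

/-- Density of the standard one-dimensional Student-t distribution with `m` degrees of freedom. -/
def tPDF (m x : ℝ) : ℝ :=
  Real.Gamma ((m + 1) / 2) / (Real.Gamma (m / 2) * √(m * Real.pi)) *
    (1 + x ^ 2 / m) ^ (-(m + 1) / 2)

/-- Distribution function of the standard one-dimensional Student-t distribution. -/
def tCDF (m x : ℝ) : ℝ := ∫ s in Set.Iic x, tPDF m s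

/-! ### The Student-t generator and the associated constants -/

/-- Student-t generator `g_n(u) = (1 + 2u/m)^{-(m+n)/2}`. -/
def stGen (n : ℕ) (m u : ℝ) : ℝ := (1 + 2 * u / m) ^ (-(m + n) / 2)

/-- First cumulative generator of `g_n`. -/
def G1 (n : ℕ) (m : ℝ) : ℝ → ℝ := cumGen (stGen n m)

/-- Second cumulative generator of `g_n`. -/
def G2 (n : ℕ) (m : ℝ) : ℝ → ℝ := cumGen (G1 n m)

/-- `c_n`. -/
def c0 (n : ℕ) (m : ℝ) : ℝ := normConst n (stGen n m)

/-- `c*_n`. -/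
def c1 (n : ℕ) (m : ℝ) : ℝ := normConst n (G1 n m)

/-- `c**_n`. -/
def c2 (n : ℕ) (m : ℝ) : ℝ := normConst n (G2 n m)

/-- `c*_{n-1,k}`, as a function of `a = lam_k`. -/
def cW (n : ℕ) (m a : ℝ) : ℝ := normConst (n - 1) (shiftGen (G1 n m) (a ^ 2 / 2))

/-- `c**_{n-1,k}`, as a function of `a = lam_k`. -/
def cV (n : ℕ) (m a : ℝ) : ℝ := normConst (n - 1) (shiftGen (G2 n m) (a ^ 2 / 2))

/-- `c**_{n-2,ij}`, as a function of `a = lam_i` and `b = lam_j`. -/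
def cU (n : ℕ) (m a b : ℝ) : ℝ := normConst (n - 2) (shiftGen (G2 n m) (a ^ 2 / 2 + b ^ 2 / 2))

/-- The density of `W_{-k}`. -/
def fW {n : ℕ} (m : ℝ) (lam : Fin n → ℝ) (k : Fin n) (w : Drop1 k → ℝ) : ℝ :=
  cW n m (lam k) * G1 n m (1 / 2 * (w ⬝ᵥ w) + 1 / 2 * lam k ^ 2)

/-- The density of `V_{-k}`. -/
def fV {n : ℕ} (m : ℝ) (lam : Fin n → ℝ) (k : Fin n) (v : Drop1 k → ℝ) : ℝ :=
  cV n m (lam k) * G2 n m (1 / 2 * (v ⬝ᵥ v) + 1 / 2 * lam k ^ 2)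

/-- The density of `U_{-ij}`. -/
def fU {n : ℕ} (m : ℝ) (lam : Fin n → ℝ) (i j : Fin n) (u : Drop2 i j → ℝ) : ℝ :=
  cU n m (lam i) (lam j) * G2 n m (1 / 2 * (u ⬝ᵥ u) + 1 / 2 * lam i ^ 2 + 1 / 2 * lam j ^ 2)

/-- Scale matrix `Δ_k` of `W_{-k}`. -/
def scaleW {n : ℕ} (m : ℝ) (lam : Fin n → ℝ) (k : Fin n) : Matrix (Drop1 k) (Drop1 k) ℝ :=
  ((m + lam k ^ 2) / (m - 1)) • 1

/-- Scale matrix `Λ_k` of `V_{-k}`. -/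
def scaleV {n : ℕ} (m : ℝ) (lam : Fin n → ℝ) (k : Fin n) : Matrix (Drop1 k) (Drop1 k) ℝ :=
  ((m + lam k ^ 2) / (m - 3)) • 1

/-- Scale matrix `Θ_ij` of `U_{-ij}`. -/
def scaleU {n : ℕ} (m : ℝ) (lam : Fin n → ℝ) (i j : Fin n) : Matrix (Drop2 i j) (Drop2 i j) ℝ :=
  ((m + lam i ^ 2 + lam j ^ 2) / (m - 2)) • 1

/-- Density of `St_{n-1}(0, Δ_k, m-1)`. -/
def stW {n : ℕ} (m : ℝ) (lam : Fin n → ℝ) (k : Fin n) : (Drop1 k → ℝ) → ℝ :=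
  stPDF 0 (scaleW m lam k) (m - 1)

/-- Density of `St_{n-1}(0, Λ_k, m-3)`. -/
def stV {n : ℕ} (m : ℝ) (lam : Fin n → ℝ) (k : Fin n) : (Drop1 k → ℝ) → ℝ :=
  stPDF 0 (scaleV m lam k) (m - 3)

/-- Density of `St_{n-2}(0, Θ_ij, m-2)`. -/
def stU {n : ℕ} (m : ℝ) (lam : Fin n → ℝ) (i j : Fin n) : (Drop2 i j → ℝ) → ℝ :=
  stPDF 0 (scaleU m lam i j) (m - 2)

/-! ### Random vectors, value at risk, tail mean and tail covariance -/

section probability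

variable {S ι : Type*} [MeasurableSpace S] [Fintype ι]

/-- The random vector `Y` has the density `f` with respect to Lebesgue measure. -/
def HasDensity (P : Measure S) (Y : S → ι → ℝ) (f : (ι → ℝ) → ℝ) : Prop :=
  Measurable Y ∧ P.map Y = (volume : Measure (ι → ℝ)).withDensity fun y => ENNReal.ofReal (f y)

/-- Value at risk `inf {x : F_X(x) ≥ q}` of a random variable. -/
def VaR (P : Measure S) (X : S → ℝ) (q : ℝ) : ℝ := sInf {x | q ≤ P.real {s | X s ≤ x}}

/-- Componentwise value at risk of a random vector. -/
def VaRVec (P : Measure S) (Y : S → ι → ℝ) (q : ι → ℝ) : ι → ℝ :=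
  fun i => VaR P (fun s => Y s i) (q i)

/-- Conditional mean vector `E[X | A]`. -/
def condMean (P : Measure S) (X : S → ι → ℝ) (A : Set S) : ι → ℝ :=
  fun i => ∫ s, X s i ∂(P[|A])

/-- Conditional covariance matrix `E[(X - E[X|A]) (X - E[X|A])ᵀ | A]`. -/
def condCov (P : Measure S) (X : S → ι → ℝ) (A : Set S) : Matrix ι ι ℝ :=
  Matrix.of fun i j => ∫ s, (X s i - condMean P X A i) * (X s j - condMean P X A j) ∂(P[|A])

/-- Multivariate tail conditional expectation `E[X | X > t]`. -/
def MTCE (P : Measure S) (X : S → ι → ℝ) (t : ι → ℝ) : ι → ℝ :=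
  condMean P X {s | ∀ i, t i < X s i}

/-- Multivariate tail covariance `Cov(X | X > t)`. -/
def MTCov (P : Measure S) (X : S → ι → ℝ) (t : ι → ℝ) : Matrix ι ι ℝ :=
  condCov P X {s | ∀ i, t i < X s i}

variable [DecidableEq ι]

/-- The standardization `Σ^{-1/2} (y - μ)`. -/
def standardize (μ : ι → ℝ) (Sig : Matrix ι ι ℝ) (y : ι → ℝ) : ι → ℝ :=
  (msqrt Sig)⁻¹ *ᵥ (y - μ)

end probability

end SkewStudent

end

noncomputable section

namespace SkewStudent

/-! ### Beta integrals and normalizing constants -/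

/-! Everything rests on one family of functions, `C * (1 + 2u/m)^(-p)`. Taking the cumulative
generator lowers `p` by one, shifting the argument only changes the scale `m`, and the normalizing
integral is a Beta integral. The constants and the Student laws of `W`, `V`, `U` follow by algebra
with `Γ(x) = (x-1) Γ(x-1)` (`cumGen_const_mul_rpow`, `normConst_const_mul_rpow`,
`stPDF_eq_normConst_mul`).

Standardization is the change of variables by the inverse square root of the scale matrix
(`HasDensity.affine`), combined with the behaviour of conditional mean and covariance under affine
maps. A diagonal root with positive entries carries upper orthants to upper orthants.

For the tail moments let `tPow m b p z = (b + |z|²/m)^(-p)` and `ρ = (m+n)/2`. Its partial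
derivative in `z_k` is `-(2p/m) z_k` times the same function with `p + 1`, so each factor `z_k` in a
moment can be integrated by parts over the orthant. This leaves an integral over the face `z_k =
lam_k` and an interior integral containing `γ_k H'`. One integration gives the mean; two give the
mixed and square moments, with faces, edges and `H''` (`tailInt_coord`, `tailInt_coord_mul_coord`,
`tailInt_coord_sq`). A face is again an orthant problem in one dimension less, with larger `b`. The
constants then turn these integrals into tail expectations.

The analytic difficulty is that for general `H` the derivatives need not be bounded. Boundary terms
at infinity vanish because the relevant derivative is integrable, so the limit exists, and because
the mean value theorem supplies a sequence along which `H'` stays bounded (`tendsto_zero_of_subseq`,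
`SeqBounded.deriv`). Integrability of `z_k H'` against the weight is not assumed; it is derived from
a one-sided integration by parts for the smooth majorant `√(1 + H'²)`
(`integrableOn_coord_mul_tPow_mul`). -/

theorem integral_Ioo_rpow_mul_one_sub_rpow {a b : ℝ} (ha : 0 < a) (hb : 0 < b) :
    ∫ x in Set.Ioo (0 : ℝ) 1, x ^ (a - 1) * (1 - x) ^ (b - 1) = beta a b := by
  rw [beta_eq_betaIntegralReal a b ha hb, Complex.betaIntegral,
    intervalIntegral.integral_of_le (by norm_num), ← integral_Ioc_eq_integral_Ioo,
    ← RCLike.re_to_complex, ← integral_re]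
  · refine setIntegral_congr_fun measurableSet_Ioc fun x ⟨hx1, hx2⟩ ↦ ?_
    norm_cast
    rw [← Complex.ofReal_cpow, ← Complex.ofReal_cpow, RCLike.re_to_complex,
      Complex.re_mul_ofReal, Complex.ofReal_re]
    all_goals linarith
  · have := Complex.betaIntegral_convergent (u := a) (v := b) (by simpa) (by simpa)
    rwa [intervalIntegrable_iff_integrableOn_Ioc_of_le (by simp), IntegrableOn] at this

/-- The substitution `x = s/(c+s)` maps the half-line bijectively onto `(0,1)` and turns this into
the Beta integral. -/
theorem integral_Ioi_rpow_mul_one_add_div_rpow {a b c : ℝ} (ha : 0 < a) (hb : 0 < b)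
    (hc : 0 < c) :
    ∫ s in Set.Ioi (0 : ℝ), s ^ (a - 1) * (1 + s / c) ^ (-(a + b)) = c ^ a * beta a b := by
  have himg : (fun s : ℝ => s / (c + s)) '' Set.Ioi 0 = Set.Ioo 0 1 := by
    ext x
    constructor
    · rintro ⟨s, hs, rfl⟩
      have hs : 0 < s := hs
      refine ⟨by positivity, ?_⟩
      rw [div_lt_one (by positivity)]
      linarith
    · rintro ⟨h0, h1⟩
      have h1' : 0 < 1 - x := by linarith
      refine ⟨c * x / (1 - x), by simp only [Set.mem_Ioi]; positivity, ?_⟩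
      field_simp
      ring
  have hder : ∀ s ∈ Set.Ioi (0 : ℝ),
      HasDerivWithinAt (fun s : ℝ => s / (c + s)) (c / (c + s) ^ 2) (Set.Ioi 0) s := by
    intro s hs
    have hs : 0 < s := hs
    have := ((hasDerivAt_id s).div ((hasDerivAt_id s).const_add c)
      (by simp only [id]; positivity)).hasDerivWithinAt (s := Set.Ioi 0)
    refine this.congr_deriv ?_
    simp only [id]
    ring
  have hinj : Set.InjOn (fun s : ℝ => s / (c + s)) (Set.Ioi 0) := by
    intro s hs t ht h
    have hs : 0 < s := hs
    have ht : 0 < t := ht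
    simp only at h
    rw [div_eq_div_iff (by positivity) (by positivity)] at h
    have : c * (s - t) = 0 := by linarith
    rcases mul_eq_zero.1 this with h | h <;> linarith
  have key := integral_image_eq_integral_abs_deriv_smul measurableSet_Ioi hder hinj
    (fun x => x ^ (a - 1) * (1 - x) ^ (b - 1))
  rw [himg, integral_Ioo_rpow_mul_one_sub_rpow ha hb] at key
  rw [key, ← integral_const_mul]
  refine setIntegral_congr_fun measurableSet_Ioi fun s hs => ?_
  have hs : 0 < s := hs
  have hcs : 0 < c + s := by positivity
  have e1 : 1 - s / (c + s) = c / (c + s) := by field_simp; ring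
  have e2 : 1 + s / c = (c + s) / c := by field_simp
  simp only [smul_eq_mul]
  rw [e1, e2, abs_of_pos (by positivity), Real.div_rpow hs.le hcs.le,
    Real.div_rpow hc.le hcs.le, Real.div_rpow hcs.le hc.le, Real.rpow_neg hcs.le,
    Real.rpow_neg hc.le, Real.rpow_add hcs, Real.rpow_add hc, Real.rpow_sub hs, Real.rpow_sub hcs,
    Real.rpow_sub hc, Real.rpow_sub hcs]
  simp only [Real.rpow_one]
  have := Real.rpow_pos_of_pos hc a
  have := Real.rpow_pos_of_pos hc b
  have := Real.rpow_pos_of_pos hcs a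
  have := Real.rpow_pos_of_pos hcs b
  field_simp

/-- Only values on `[0,∞)` enter, and only there are the closed forms of the cumulative generators
available. -/
theorem normConst_congr {d : ℕ} {G G' : ℝ → ℝ} (h : ∀ u, 0 ≤ u → G u = G' u) :
    normConst d G = normConst d G' := by
  have : ∫ s in Set.Ioi (0 : ℝ), s ^ ((d : ℝ) / 2 - 1) * G s =
      ∫ s in Set.Ioi (0 : ℝ), s ^ ((d : ℝ) / 2 - 1) * G' s :=
    setIntegral_congr_fun measurableSet_Ioi fun s hs => by
      simp only [h s (le_of_lt hs)]
  simp only [normConst, this, h 0 le_rfl]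

/-- The Beta integral has parameters `d/2` and `p - d/2`; its factor `Γ(d/2)` cancels the one in the
definition. The convention `1/G(0)` in dimension zero fits the same formula, and for `C = 0` both
sides are zero. -/
theorem normConst_const_mul_rpow {d : ℕ} {C M p : ℝ} (hM : 0 < M)
    (hp : (d : ℝ) / 2 < p) {G : ℝ → ℝ} (hG : ∀ u, 0 ≤ u → G u = C * (1 + 2 * u / M) ^ (-p)) :
    normConst d G = Real.Gamma p /
      (Real.Gamma (p - d / 2) * (M * Real.pi) ^ ((d : ℝ) / 2) * C) := by
  rw [normConst_congr hG]
  have hp0 : 0 < p := lt_of_le_of_lt (by positivity) hp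
  have hGp := Real.Gamma_pos_of_pos hp0
  rcases Nat.eq_zero_or_pos d with rfl | hd
  · simp only [normConst, if_true, Nat.cast_zero, zero_div, sub_zero, Real.rpow_zero, mul_one,
      mul_zero, zero_div, add_zero, Real.one_rpow]
    rw [← div_div, div_self hGp.ne', one_div]
  · have hd' : (0 : ℝ) < (d : ℝ) / 2 := by positivity
    have hpd : 0 < p - (d : ℝ) / 2 := by linarith
    have hGd := Real.Gamma_pos_of_pos hd'
    have hGpd := Real.Gamma_pos_of_pos hpd
    have hI := integral_Ioi_rpow_mul_one_add_div_rpow hd' hpd (half_pos hM)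
    have : ∫ s in Set.Ioi (0 : ℝ), s ^ ((d : ℝ) / 2 - 1) * (C * (1 + 2 * s / M) ^ (-p)) =
        C * ((M / 2) ^ ((d : ℝ) / 2) * beta ((d : ℝ) / 2) (p - d / 2)) := by
      rw [← hI, ← integral_const_mul]
      refine setIntegral_congr_fun measurableSet_Ioi fun s hs => ?_
      have e : s / (M / 2) = 2 * s / M := by field_simp
      simp only [e, add_sub_cancel]
      ring
    rw [normConst, if_neg hd.ne', this, beta, add_sub_cancel, Real.mul_rpow (by norm_num)
      Real.pi_pos.le, Real.div_rpow hM.le (by norm_num), Real.mul_rpow hM.le Real.pi_pos.le]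
    have h2 : (0 : ℝ) < 2 ^ ((d : ℝ) / 2) := by positivity
    have h3 : 0 < Real.pi ^ ((d : ℝ) / 2) := Real.rpow_pos_of_pos Real.pi_pos _
    have h4 : 0 < M ^ ((d : ℝ) / 2) := by positivity
    by_cases hC : C = 0
    · simp [hC]
    · field_simp

theorem cumGen_const_mul_rpow {C M p : ℝ} (hM : 0 < M) (hp : 1 < p) {g : ℝ → ℝ}
    (hg : ∀ u, 0 ≤ u → g u = C * (1 + 2 * u / M) ^ (-p)) {t : ℝ} (ht : 0 ≤ t) :
    cumGen g t = C * (M / (2 * (p - 1))) * (1 + 2 * t / M) ^ (-(p - 1)) := by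
  have hp' : 0 < p - 1 := by linarith
  have hpos : ∀ x ∈ Set.Ici t, 0 < 1 + 2 * x / M := by
    intro x hx
    have : 0 ≤ x := ht.trans hx
    positivity
  have hder : ∀ x ∈ Set.Ici t, HasDerivAt
      (fun x : ℝ => -(M / (2 * (p - 1))) * (1 + 2 * x / M) ^ (-(p - 1)))
      ((1 + 2 * x / M) ^ (-p)) x := by
    intro x hx
    have h1 : HasDerivAt (fun x : ℝ => 1 + 2 * x / M) (2 / M) x := by
      simpa using (((hasDerivAt_id x).const_mul 2).div_const M).const_add 1
    have h2 := (h1.rpow_const (p := -(p - 1)) (Or.inl (hpos x hx).ne')).const_mul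
      (-(M / (2 * (p - 1))))
    refine h2.congr_deriv ?_
    have : -(p - 1) - 1 = -p := by ring
    rw [this]
    field_simp
  have hlim : Filter.Tendsto (fun x : ℝ => -(M / (2 * (p - 1))) * (1 + 2 * x / M) ^ (-(p - 1)))
      Filter.atTop (nhds 0) := by
    have h1 : Filter.Tendsto (fun x : ℝ => 1 + 2 * x / M) Filter.atTop Filter.atTop := by
      refine Filter.tendsto_atTop_add_const_left _ _ ?_
      exact (Filter.Tendsto.const_mul_atTop (by norm_num) Filter.tendsto_id).atTop_div_const hM
    simpa using ((tendsto_rpow_neg_atTop hp').comp h1).const_mul (-(M / (2 * (p - 1))))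
  have hI := integral_Ioi_of_hasDerivAt_of_nonneg' hder
    (fun x hx => (Real.rpow_pos_of_pos (hpos x (Set.Ioi_subset_Ici_self hx)) _).le) hlim
  rw [cumGen, setIntegral_congr_fun measurableSet_Ioi
    (g := fun x => C * (1 + 2 * x / M) ^ (-p)) (fun x hx => hg x (ht.trans (le_of_lt hx))),
    integral_const_mul, hI]
  ring

section constants

variable {n : ℕ} {m : ℝ}

theorem stGen_eq (u : ℝ) : stGen n m u = 1 * (1 + 2 * u / m) ^ (-((m + n) / 2)) := by
  rw [stGen, one_mul, neg_div]

theorem G1_eq (hm : 0 < m) (h : 2 < m + n) {t : ℝ} (ht : 0 ≤ t) :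
    G1 n m t = m / (m + n - 2) * (1 + 2 * t / m) ^ (-((m + n - 2) / 2)) := by
  rw [G1, cumGen_const_mul_rpow hm (by linarith : 1 < (m + n) / 2) (fun u _ => stGen_eq u) ht]
  have e : (m + n) / 2 - 1 = (m + n - 2) / 2 := by ring
  rw [e, one_mul]
  congr 2
  ring

theorem G2_eq (hm : 0 < m) (h : 4 < m + n) {t : ℝ} (ht : 0 ≤ t) :
    G2 n m t = m / (m + n - 2) * (m / (m + n - 4)) *
      (1 + 2 * t / m) ^ (-((m + n - 4) / 2)) := by
  rw [G2, cumGen_const_mul_rpow hm (by linarith : 1 < (m + n - 2) / 2)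
    (fun u hu => G1_eq hm (by linarith) hu) ht]
  have e : (m + n - 2) / 2 - 1 = (m + n - 4) / 2 := by ring
  rw [e]
  congr 3
  ring

theorem c0_eq (hm : 0 < m) : c0 n m = Real.Gamma ((m + n) / 2) /
    (Real.Gamma (m / 2) * (m * Real.pi) ^ ((n : ℝ) / 2)) := by
  rw [c0, normConst_const_mul_rpow hm (by linarith : (n : ℝ) / 2 < (m + n) / 2)
    (fun u _ => stGen_eq u), mul_one]
  congr 3
  ring_nf

theorem Gamma_eq_sub_one_mul {x : ℝ} (hx : 1 < x) :
    Real.Gamma x = (x - 1) * Real.Gamma (x - 1) := by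
  have := Real.Gamma_add_one (s := x - 1) (by linarith)
  rwa [sub_add_cancel] at this

theorem c1_eq (hm : 2 < m) : c1 n m = Real.Gamma ((m + n - 2) / 2) /
    (Real.Gamma ((m - 2) / 2) * (m * Real.pi) ^ ((n : ℝ) / 2) * (m / (m + n - 2))) := by
  have hn : (0 : ℝ) ≤ n := n.cast_nonneg
  rw [c1, normConst_const_mul_rpow (by linarith) (by linarith : (n : ℝ) / 2 < (m + n - 2) / 2)
    (fun u hu => G1_eq (by linarith) (by linarith) hu)]
  congr 4
  ring_nf

theorem c2_eq (hm : 4 < m) : c2 n m = Real.Gamma ((m + n - 4) / 2) /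
    (Real.Gamma ((m - 4) / 2) * (m * Real.pi) ^ ((n : ℝ) / 2) *
      (m / (m + n - 2) * (m / (m + n - 4)))) := by
  have hn : (0 : ℝ) ≤ n := n.cast_nonneg
  rw [c2, normConst_const_mul_rpow (by linarith) (by linarith : (n : ℝ) / 2 < (m + n - 4) / 2)
    (fun u hu => G2_eq (by linarith) (by linarith) hu)]
  congr 4
  ring_nf

/-- Lowering both Gamma arguments by one produces `(m+n-2)/(m-2)`; the prefactor `m/(m+n-2)` of the
cumulative generator removes the dependence on `n`. -/
theorem c0_div_c1 (hm : 2 < m) : c0 n m / c1 n m = m / (m - 2) := by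
  have hn : (0 : ℝ) ≤ n := n.cast_nonneg
  have h1 : 0 < m - 2 := by linarith
  have h2 : 0 < m + n - 2 := by linarith
  rw [c0_eq (by linarith), c1_eq hm, Gamma_eq_sub_one_mul (by linarith : 1 < (m + n) / 2),
    Gamma_eq_sub_one_mul (by linarith : 1 < m / 2)]
  have e1 : (m + n) / 2 - 1 = (m + n - 2) / 2 := by ring
  have e2 : m / 2 - 1 = (m - 2) / 2 := by ring
  rw [e1, e2]
  have := Real.Gamma_pos_of_pos (half_pos h1)
  have := Real.Gamma_pos_of_pos (half_pos h2)
  have : 0 < (m * Real.pi) ^ ((n : ℝ) / 2) := by have := Real.pi_pos; positivity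
  field_simp

theorem c1_div_c2 (hm : 4 < m) : c1 n m / c2 n m = m / (m - 4) := by
  have hn : (0 : ℝ) ≤ n := n.cast_nonneg
  have h1 : 0 < m - 4 := by linarith
  have h2 : 0 < m + n - 4 := by linarith
  have h3 : 0 < m + n - 2 := by linarith
  rw [c1_eq (by linarith), c2_eq hm,
    Gamma_eq_sub_one_mul (by linarith : 1 < (m + n - 2) / 2),
    Gamma_eq_sub_one_mul (by linarith : 1 < (m - 2) / 2)]
  have e1 : (m + n - 2) / 2 - 1 = (m + n - 4) / 2 := by ring
  have e2 : (m - 2) / 2 - 1 = (m - 4) / 2 := by ring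
  rw [e1, e2]
  have := Real.Gamma_pos_of_pos (half_pos h1)
  have := Real.Gamma_pos_of_pos (half_pos h2)
  have : 0 < (m * Real.pi) ^ ((n : ℝ) / 2) := by have := Real.pi_pos; positivity
  field_simp

theorem c1_pos (hm : 2 < m) : 0 < c1 n m := by
  have hn : (0 : ℝ) ≤ n := n.cast_nonneg
  have h1 : 0 < m - 2 := by linarith
  have h2 : 0 < m + n - 2 := by linarith
  have := Real.Gamma_pos_of_pos (half_pos h1)
  have := Real.Gamma_pos_of_pos (half_pos h2)
  have := Real.pi_pos
  rw [c1_eq hm]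
  positivity

theorem c2_pos (hm : 4 < m) : 0 < c2 n m := by
  have hn : (0 : ℝ) ≤ n := n.cast_nonneg
  have h1 : 0 < m - 4 := by linarith
  have h2 : 0 < m + n - 4 := by linarith
  have h3 : 0 < m + n - 2 := by linarith
  have := Real.Gamma_pos_of_pos (half_pos h1)
  have := Real.Gamma_pos_of_pos (half_pos h2)
  have := Real.pi_pos
  rw [c2_eq hm]
  positivity

theorem c0_div_c2 (hm : 4 < m) : c0 n m / c2 n m = m ^ 2 / ((m - 2) * (m - 4)) := by
  have h : c0 n m / c2 n m = c0 n m / c1 n m * (c1 n m / c2 n m) :=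
    (div_mul_div_cancel₀ (c1_pos (by linarith)).ne').symm
  rw [h, c0_div_c1 (by linarith), c1_div_c2 hm, div_mul_div_comm, sq]

theorem c1_eq_integral (hm : 2 < m) (hn : n ≠ 0) :
    c1 n m = (m + n - 2) * Real.Gamma ((n : ℝ) / 2) / ((2 * Real.pi) ^ ((n : ℝ) / 2) * m) *
      (∫ t in Set.Ioi (0 : ℝ),
        t ^ ((n : ℝ) / 2 - 1) * (1 + 2 * t / m) ^ (-(m + n - 2) / 2))⁻¹ := by
  have hn0 : (0 : ℝ) ≤ n := n.cast_nonneg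
  have h2 : 0 < m + n - 2 := by linarith
  rw [c1, normConst_congr (fun u hu => G1_eq (by linarith) (by linarith) hu), normConst, if_neg hn]
  simp_rw [mul_left_comm _ (m / (m + n - 2)), neg_div]
  rw [integral_const_mul, mul_inv, inv_div, ← mul_assoc]
  congr 1
  field_simp

theorem c2_eq_integral (hm : 4 < m) (hn : n ≠ 0) :
    c2 n m = (m + n - 2) * (m + n - 4) * Real.Gamma ((n : ℝ) / 2) /
        ((2 * Real.pi) ^ ((n : ℝ) / 2) * m ^ 2) *
      (∫ t in Set.Ioi (0 : ℝ),
        t ^ ((n : ℝ) / 2 - 1) * (1 + 2 * t / m) ^ (-(m + n - 4) / 2))⁻¹ := by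
  have hn0 : (0 : ℝ) ≤ n := n.cast_nonneg
  have h2 : 0 < m + n - 2 := by linarith
  have h4 : 0 < m + n - 4 := by linarith
  rw [c2, normConst_congr (fun u hu => G2_eq (by linarith) (by linarith) hu), normConst, if_neg hn]
  simp_rw [mul_left_comm _ (m / (m + n - 2) * (m / (m + n - 4))), neg_div]
  rw [integral_const_mul, mul_inv, mul_inv, inv_div, inv_div, ← mul_assoc]
  congr 1
  field_simp

theorem c1_eq_beta (hm : 2 < m) (hn : n ≠ 0) :
    c1 n m = (m + n - 2) * Real.Gamma ((n : ℝ) / 2) /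
      ((m * Real.pi) ^ ((n : ℝ) / 2) * m * beta ((n : ℝ) / 2) ((m - 2) / 2)) := by
  have hn0 : (0 : ℝ) < n := by positivity
  have h2 : 0 < m + n - 2 := by linarith
  have hm2 : 0 < m - 2 := by linarith
  rw [c1_eq hm, beta]
  have e : (n : ℝ) / 2 + (m - 2) / 2 = (m + n - 2) / 2 := by ring
  rw [e]
  have := Real.Gamma_pos_of_pos (half_pos hn0)
  have := Real.Gamma_pos_of_pos (half_pos hm2)
  have := Real.Gamma_pos_of_pos (half_pos h2)
  have : 0 < (m * Real.pi) ^ ((n : ℝ) / 2) := by have := Real.pi_pos; positivity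
  field_simp

theorem c2_eq_beta (hm : 4 < m) (hn : n ≠ 0) :
    c2 n m = (m + n - 2) * (m + n - 4) * Real.Gamma ((n : ℝ) / 2) /
      ((m * Real.pi) ^ ((n : ℝ) / 2) * m ^ 2 * beta ((n : ℝ) / 2) ((m - 4) / 2)) := by
  have hn0 : (0 : ℝ) < n := by positivity
  have h2 : 0 < m + n - 2 := by linarith
  have h4 : 0 < m + n - 4 := by linarith
  have hm2 : 0 < m - 4 := by linarith
  rw [c2_eq hm, beta]
  have e : (n : ℝ) / 2 + (m - 4) / 2 = (m + n - 4) / 2 := by ring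
  rw [e]
  have := Real.Gamma_pos_of_pos (half_pos hn0)
  have := Real.Gamma_pos_of_pos (half_pos hm2)
  have := Real.Gamma_pos_of_pos (half_pos h4)
  have : 0 < (m * Real.pi) ^ ((n : ℝ) / 2) := by have := Real.pi_pos; positivity
  field_simp

end constants

/-! ### Shifted generators and the marginal Student densities -/

theorem one_add_div_mul_one_add_div {m a x : ℝ} (hm : 0 < m) (ha : 0 ≤ a) :
    (1 + a / m) * (1 + x / (m + a)) = 1 + (x + a) / m := by
  have : 0 < m + a := by linarith
  field_simp
  ring

/-- By `1 + (x+2a)/m = (1 + 2a/m)(1 + x/(m+2a))`, a shifted power generator is again a power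
generator, with `m` replaced by `m + 2a` and the same exponent. -/
theorem gen_add_eq {G : ℝ → ℝ} {C m p a x : ℝ} (hm : 0 < m) (ha : 0 ≤ a) (hx : 0 ≤ x)
    (hG : ∀ u, 0 ≤ u → G u = C * (1 + 2 * u / m) ^ (-p)) :
    G (1 / 2 * x + a) = C * (1 + 2 * a / m) ^ (-p) * (1 + x / (m + 2 * a)) ^ (-p) := by
  rw [hG _ (by positivity), mul_assoc, ← Real.mul_rpow (by positivity) (by positivity),
    one_add_div_mul_one_add_div hm (by positivity)]
  congr 3
  ring

theorem normConst_shiftGen {d : ℕ} {G : ℝ → ℝ} {C m p a : ℝ} (hm : 0 < m) (ha : 0 ≤ a)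
    (hp : (d : ℝ) / 2 < p) (hG : ∀ u, 0 ≤ u → G u = C * (1 + 2 * u / m) ^ (-p)) :
    normConst d (shiftGen G a) = Real.Gamma p /
      (Real.Gamma (p - d / 2) * Real.pi ^ ((d : ℝ) / 2) * (C * m ^ p)) *
        (m + 2 * a) ^ (p - d / 2) := by
  have hma : 0 < m + 2 * a := by linarith
  have hG' : ∀ u, 0 ≤ u → shiftGen G a u =
      C * (1 + 2 * a / m) ^ (-p) * (1 + 2 * u / (m + 2 * a)) ^ (-p) := by
    intro u hu
    rw [shiftGen, ← gen_add_eq hm ha (by positivity : 0 ≤ 2 * u) hG]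
    congr 1
    ring
  have e : 1 + 2 * a / m = (m + 2 * a) / m := by field_simp
  rw [normConst_const_mul_rpow hma hp hG', e, Real.rpow_neg (by positivity),
    Real.div_rpow hma.le hm.le, Real.mul_rpow hma.le Real.pi_pos.le, Real.rpow_sub hma]
  have h1 : 0 < m ^ p := by positivity
  have h2 : 0 < (m + 2 * a) ^ p := by positivity
  have h3 : 0 < (m + 2 * a) ^ ((d : ℝ) / 2) := by positivity
  have h4 : 0 < Real.pi ^ ((d : ℝ) / 2) := Real.rpow_pos_of_pos Real.pi_pos _
  have h5 := Real.Gamma_pos_of_pos (by linarith : 0 < p - d / 2)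
  by_cases hC : C = 0
  · simp [hC]
  · field_simp

section isotropic

variable {ι : Type*} [Fintype ι] [DecidableEq ι]

theorem dotProduct_smul_one_inv_mulVec {s : ℝ} (x : ι → ℝ) :
    x ⬝ᵥ ((s • (1 : Matrix ι ι ℝ))⁻¹ *ᵥ x) = x ⬝ᵥ x / s := by
  -- For `s = 0` both sides are zero, since the matrix inverse and the division take their default
  -- values.
  by_cases hs : s = 0
  · simp [hs]
  · have : (s • (1 : Matrix ι ι ℝ))⁻¹ = s⁻¹ • 1 := by
      apply Matrix.inv_eq_right_inv
      simp [smul_smul, hs]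
    rw [this, smul_mulVec, one_mulVec, dotProduct_smul, smul_eq_mul]
    ring

theorem stPDF_smul_one {s ν : ℝ} (hs : 0 < s) (hν : 0 < ν) (x : ι → ℝ) :
    stPDF 0 (s • (1 : Matrix ι ι ℝ)) ν x =
      Real.Gamma ((ν + Fintype.card ι) / 2) /
        (Real.Gamma (ν / 2) * (s * ν) ^ ((Fintype.card ι : ℝ) / 2) *
          Real.pi ^ ((Fintype.card ι : ℝ) / 2)) *
      (1 + x ⬝ᵥ x / (s * ν)) ^ (-((ν + Fintype.card ι) / 2)) := by
  rw [stPDF, sub_zero, dotProduct_smul_one_inv_mulVec, Matrix.det_smul, Matrix.det_one, mul_one,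
    Real.sqrt_eq_rpow, ← Real.rpow_natCast, ← Real.rpow_mul hs.le,
    Real.mul_rpow hν.le Real.pi_pos.le, Real.mul_rpow hs.le hν.le, mul_one_div, div_div, neg_div]
  congr 2
  ring

/-- One computation serving `W`, `V` and `U`: exponent `p` in `d` dimensions means `ν = 2p - d`
degrees of freedom, and the shift `a` becomes the scale `(m + 2a)/ν`. The constant `C` cancels
between generator and normalization, hence must be nonzero. -/
theorem stPDF_eq_normConst_mul {G : ℝ → ℝ} {C m p a ν : ℝ} (hm : 0 < m) (ha : 0 ≤ a)
    (hν : 0 < ν) (hp : ν + Fintype.card ι = 2 * p) (hC : C ≠ 0)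
    (hG : ∀ u, 0 ≤ u → G u = C * (1 + 2 * u / m) ^ (-p)) (x : ι → ℝ) :
    normConst (Fintype.card ι) (shiftGen G a) * G (1 / 2 * (x ⬝ᵥ x) + a) =
      stPDF 0 (((m + 2 * a) / ν) • (1 : Matrix ι ι ℝ)) ν x := by
  have hma : 0 < m + 2 * a := by linarith
  have hxx : 0 ≤ x ⬝ᵥ x := Finset.sum_nonneg fun i _ => mul_self_nonneg (x i)
  rw [stPDF_smul_one (by positivity) hν, normConst_shiftGen hm ha (by linarith) hG,
    gen_add_eq hm ha hxx hG, hp, div_mul_cancel₀ _ hν.ne']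
  have e : 1 + 2 * a / m = (m + 2 * a) / m := by field_simp
  have e2 : p - (Fintype.card ι : ℝ) / 2 = ν / 2 := by linarith
  have e3 : 2 * p / 2 = p := by ring
  have e4 : p = ν / 2 + (Fintype.card ι : ℝ) / 2 := by linarith
  have h6 : (m + 2 * a) ^ p = (m + 2 * a) ^ (ν / 2) * (m + 2 * a) ^ ((Fintype.card ι : ℝ) / 2) := by
    rw [← Real.rpow_add hma, ← e4]
  rw [e, e2, e3, Real.rpow_neg (x := (m + 2 * a) / m) (by positivity), Real.div_rpow hma.le hm.le,
    h6]
  have h1 : 0 < m ^ p := by positivity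
  have h2 : 0 < (m + 2 * a) ^ (ν / 2) := by positivity
  have h3 : 0 < (m + 2 * a) ^ ((Fintype.card ι : ℝ) / 2) := by positivity
  have h4 : 0 < Real.pi ^ ((Fintype.card ι : ℝ) / 2) := Real.rpow_pos_of_pos Real.pi_pos _
  have h5 := Real.Gamma_pos_of_pos (half_pos hν)
  field_simp

theorem gen_add_eq_scale {G : ℝ → ℝ} {C m p a ν : ℝ} (hm : 0 < m) (ha : 0 ≤ a) (hν : 0 < ν)
    (hG : ∀ u, 0 ≤ u → G u = C * (1 + 2 * u / m) ^ (-p)) (x : ι → ℝ) :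
    G (1 / 2 * (x ⬝ᵥ x) + a) = C * (1 + 2 * a / m) ^ (-p) *
      (1 + x ⬝ᵥ ((((m + 2 * a) / ν) • (1 : Matrix ι ι ℝ))⁻¹ *ᵥ x) / ν) ^ (-p) := by
  have hma : 0 < m + 2 * a := by linarith
  have hxx : 0 ≤ x ⬝ᵥ x := Finset.sum_nonneg fun i _ => mul_self_nonneg (x i)
  rw [gen_add_eq hm ha hxx hG, dotProduct_smul_one_inv_mulVec]
  congr 3
  field_simp

end isotropic

/-! ### The laws and constants of `W`, `V` and `U`. -/

section marginals

variable {n : ℕ} {m : ℝ}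

theorem card_drop1 (k : Fin n) : Fintype.card (Drop1 k) = n - 1 := by
  simp [Drop1]

theorem card_drop2 {i j : Fin n} (hij : i ≠ j) : Fintype.card (Drop2 i j) = n - 2 := by
  have : Fintype.card (Drop2 i j) = (Finset.univ \ {i, j} : Finset (Fin n)).card := by
    rw [Fintype.card_subtype]
    congr 1
    ext l
    simp
  rw [this, Finset.card_sdiff_of_subset (Finset.subset_univ _), Finset.card_pair hij,
    Finset.card_univ, Fintype.card_fin]

theorem fW_eq (hn : 2 ≤ n) (hm : 1 < m) (lam : Fin n → ℝ) (k : Fin n) (w : Drop1 k → ℝ) :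
    fW m lam k w = cW n m (lam k) * (m / (m + n - 2)) *
      (1 + lam k ^ 2 / m) ^ (-(m + n - 2) / 2) *
      (1 + w ⬝ᵥ ((scaleW m lam k)⁻¹ *ᵥ w) / (m - 1)) ^ (-(m + n - 2) / 2) := by
  have hn' : (2 : ℝ) ≤ n := by exact_mod_cast hn
  have h := gen_add_eq_scale (ι := Drop1 k) (by linarith : 0 < m)
    (by positivity : 0 ≤ lam k ^ 2 / 2) (by linarith : 0 < m - 1)
    (fun u hu => G1_eq (n := n) (by linarith) (by linarith) hu) w
  rw [mul_div_cancel₀ _ (two_ne_zero)] at h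
  rw [fW, scaleW, one_div_mul_eq_div, one_div_mul_eq_div, ← one_div_mul_eq_div, h, neg_div]
  ring

theorem fV_eq (hn : 2 ≤ n) (hm : 3 < m) (lam : Fin n → ℝ) (k : Fin n) (v : Drop1 k → ℝ) :
    fV m lam k v = cV n m (lam k) * (m / (m + n - 2)) * (m / (m + n - 4)) *
      (1 + lam k ^ 2 / m) ^ (-(m + n - 4) / 2) *
      (1 + v ⬝ᵥ ((scaleV m lam k)⁻¹ *ᵥ v) / (m - 3)) ^ (-(m + n - 4) / 2) := by
  have hn' : (2 : ℝ) ≤ n := by exact_mod_cast hn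
  have h := gen_add_eq_scale (ι := Drop1 k) (by linarith : 0 < m)
    (by positivity : 0 ≤ lam k ^ 2 / 2) (by linarith : 0 < m - 3)
    (fun u hu => G2_eq (n := n) (by linarith) (by linarith) hu) v
  rw [mul_div_cancel₀ _ (two_ne_zero)] at h
  rw [fV, scaleV, one_div_mul_eq_div, one_div_mul_eq_div, ← one_div_mul_eq_div, h, neg_div]
  ring

theorem fU_eq (hn : 2 ≤ n) (hm : 2 < m) (lam : Fin n → ℝ) (i j : Fin n) (u : Drop2 i j → ℝ) :
    fU m lam i j u = cU n m (lam i) (lam j) * (m / (m + n - 2)) * (m / (m + n - 4)) *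
      (1 + (lam i ^ 2 + lam j ^ 2) / m) ^ (-(m + n - 4) / 2) *
      (1 + u ⬝ᵥ ((scaleU m lam i j)⁻¹ *ᵥ u) / (m - 2)) ^ (-(m + n - 4) / 2) := by
  have hn' : (2 : ℝ) ≤ n := by exact_mod_cast hn
  have h := gen_add_eq_scale (ι := Drop2 i j) (by linarith : 0 < m)
    (by positivity : 0 ≤ lam i ^ 2 / 2 + lam j ^ 2 / 2) (by linarith : 0 < m - 2)
    (fun u hu => G2_eq (n := n) (by linarith) (by linarith) hu) u
  have e : 2 * (lam i ^ 2 / 2 + lam j ^ 2 / 2) = lam i ^ 2 + lam j ^ 2 := by ring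
  have e2 : 1 / 2 * (u ⬝ᵥ u) + 1 / 2 * lam i ^ 2 + 1 / 2 * lam j ^ 2 =
    1 / 2 * (u ⬝ᵥ u) + (lam i ^ 2 / 2 + lam j ^ 2 / 2) := by ring
  rw [e, ← add_assoc m] at h
  rw [fU, scaleU, e2, h, neg_div]
  ring

theorem fW_eq_stW (hn : 2 ≤ n) (hm : 1 < m) (lam : Fin n → ℝ) (k : Fin n) :
    fW m lam k = stW m lam k := by
  have hn' : (2 : ℝ) ≤ n := by exact_mod_cast hn
  have hc : (Fintype.card (Drop1 k) : ℝ) = n - 1 := by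
    rw [card_drop1, Nat.cast_sub (by omega), Nat.cast_one]
  funext w
  have h := stPDF_eq_normConst_mul (ι := Drop1 k) (by linarith : 0 < m)
    (by positivity : 0 ≤ lam k ^ 2 / 2) (by linarith : 0 < m - 1)
    (by rw [hc]; ring : m - 1 + (Fintype.card (Drop1 k) : ℝ) = 2 * ((m + n - 2) / 2))
    (div_ne_zero (by linarith) (by linarith))
    (fun u hu => G1_eq (n := n) (by linarith) (by linarith) hu) w
  rw [mul_div_cancel₀ _ (two_ne_zero), card_drop1] at h
  rw [fW, stW, scaleW, ← h, cW]
  congr 2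
  ring

theorem fV_eq_stV (hn : 2 ≤ n) (hm : 3 < m) (lam : Fin n → ℝ) (k : Fin n) :
    fV m lam k = stV m lam k := by
  have hn' : (2 : ℝ) ≤ n := by exact_mod_cast hn
  have hc : (Fintype.card (Drop1 k) : ℝ) = n - 1 := by
    rw [card_drop1, Nat.cast_sub (by omega), Nat.cast_one]
  funext w
  have h2 : 0 < m + n - 2 := by linarith
  have h4 : 0 < m + n - 4 := by linarith
  have h := stPDF_eq_normConst_mul (ι := Drop1 k) (by linarith : 0 < m)
    (by positivity : 0 ≤ lam k ^ 2 / 2) (by linarith : 0 < m - 3)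
    (by rw [hc]; ring : m - 3 + (Fintype.card (Drop1 k) : ℝ) = 2 * ((m + n - 4) / 2))
    (by positivity : m / (m + n - 2) * (m / (m + n - 4)) ≠ 0)
    (fun u hu => G2_eq (n := n) (by linarith) (by linarith) hu) w
  rw [mul_div_cancel₀ _ (two_ne_zero), card_drop1] at h
  rw [fV, stV, scaleV, ← h, cV]
  congr 2
  ring

theorem fU_eq_stU (hn : 2 ≤ n) (hm : 2 < m) (lam : Fin n → ℝ) {i j : Fin n} (hij : i ≠ j) :
    fU m lam i j = stU m lam i j := by
  have hn' : (2 : ℝ) ≤ n := by exact_mod_cast hn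
  have hc : (Fintype.card (Drop2 i j) : ℝ) = n - 2 := by
    rw [card_drop2 hij, Nat.cast_sub hn, Nat.cast_two]
  funext w
  have h2 : 0 < m + n - 2 := by linarith
  have h4 : 0 < m + n - 4 := by linarith
  have h := stPDF_eq_normConst_mul (ι := Drop2 i j) (by linarith : 0 < m)
    (by positivity : 0 ≤ lam i ^ 2 / 2 + lam j ^ 2 / 2) (by linarith : 0 < m - 2)
    (by rw [hc]; ring : m - 2 + (Fintype.card (Drop2 i j) : ℝ) = 2 * ((m + n - 4) / 2))
    (by positivity : m / (m + n - 2) * (m / (m + n - 4)) ≠ 0)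
    (fun u hu => G2_eq (n := n) (by linarith) (by linarith) hu) w
  have e : 2 * (lam i ^ 2 / 2 + lam j ^ 2 / 2) = lam i ^ 2 + lam j ^ 2 := by ring
  rw [e, ← add_assoc m, card_drop2 hij] at h
  rw [fU, stU, scaleU, ← h, cU]
  congr 2
  ring

theorem cW_eq (hn : 2 ≤ n) (hm : 1 < m) (a : ℝ) :
    cW n m a = Real.Gamma ((m + n - 2) / 2) * (m + n - 2) /
      (Real.Gamma ((m - 1) / 2) * Real.pi ^ (((n : ℝ) - 1) / 2) * m ^ ((m + n) / 2)) *
      (m + a ^ 2) ^ ((m - 1) / 2) := by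
  have hn' : (2 : ℝ) ≤ n := by exact_mod_cast hn
  have hc : ((n - 1 : ℕ) : ℝ) = n - 1 := by rw [Nat.cast_sub (by omega), Nat.cast_one]
  rw [cW, normConst_shiftGen (by linarith) (by positivity) (by rw [hc]; linarith)
    (fun u hu => G1_eq (n := n) (by linarith) (by linarith) hu), hc]
  have e1 : (m + n - 2) / 2 - ((n : ℝ) - 1) / 2 = (m - 1) / 2 := by ring
  have e2 : (m + n) / 2 = (m + n - 2) / 2 + 1 := by ring
  have h2 : 0 < m + n - 2 := by linarith
  rw [e1, e2, Real.rpow_add (by linarith), Real.rpow_one, mul_div_cancel₀ _ two_ne_zero]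
  field_simp

theorem cV_eq (hn : 2 ≤ n) (hm : 3 < m) (a : ℝ) :
    cV n m a = Real.Gamma ((m + n - 4) / 2) * (m + n - 2) * (m + n - 4) /
      (Real.Gamma ((m - 3) / 2) * Real.pi ^ (((n : ℝ) - 1) / 2) * m ^ ((m + n) / 2)) *
      (m + a ^ 2) ^ ((m - 3) / 2) := by
  have hn' : (2 : ℝ) ≤ n := by exact_mod_cast hn
  have hc : ((n - 1 : ℕ) : ℝ) = n - 1 := by rw [Nat.cast_sub (by omega), Nat.cast_one]
  rw [cV, normConst_shiftGen (by linarith) (by positivity) (by rw [hc]; linarith)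
    (fun u hu => G2_eq (n := n) (by linarith) (by linarith) hu), hc]
  have e1 : (m + n - 4) / 2 - ((n : ℝ) - 1) / 2 = (m - 3) / 2 := by ring
  have e2 : (m + n) / 2 = (m + n - 4) / 2 + 1 + 1 := by ring
  have h2 : 0 < m + n - 2 := by linarith
  have h4 : 0 < m + n - 4 := by linarith
  rw [e1, e2, Real.rpow_add (by linarith), Real.rpow_add (by linarith), Real.rpow_one,
    mul_div_cancel₀ _ two_ne_zero]
  field_simp

theorem cU_eq (hn : 2 ≤ n) (hm : 2 < m) (a b : ℝ) :
    cU n m a b = Real.Gamma ((m + n - 4) / 2) * (m + n - 2) * (m + n - 4) /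
      (Real.Gamma ((m - 2) / 2) * Real.pi ^ (((n : ℝ) - 2) / 2) * m ^ ((m + n) / 2)) *
      (m + a ^ 2 + b ^ 2) ^ ((m - 2) / 2) := by
  have hn' : (2 : ℝ) ≤ n := by exact_mod_cast hn
  have hc : ((n - 2 : ℕ) : ℝ) = n - 2 := by rw [Nat.cast_sub hn, Nat.cast_two]
  rw [cU, normConst_shiftGen (by linarith) (by positivity) (by rw [hc]; linarith)
    (fun u hu => G2_eq (n := n) (by linarith) (by linarith) hu), hc]
  have e1 : (m + n - 4) / 2 - ((n : ℝ) - 2) / 2 = (m - 2) / 2 := by ring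
  have e2 : (m + n) / 2 = (m + n - 4) / 2 + 1 + 1 := by ring
  have e3 : m + 2 * (a ^ 2 / 2 + b ^ 2 / 2) = m + a ^ 2 + b ^ 2 := by ring
  have h2 : 0 < m + n - 2 := by linarith
  have h4 : 0 < m + n - 4 := by linarith
  rw [e1, e2, e3, Real.rpow_add (by linarith), Real.rpow_add (by linarith), Real.rpow_one]
  field_simp

theorem c0_div_cW (hn : 2 ≤ n) (hm : 1 < m) (a : ℝ) :
    c0 n m / cW n m a = Real.Gamma ((m - 1) / 2) * m ^ (m / 2) /
      (2 * Real.Gamma (m / 2) * √Real.pi) * (m + a ^ 2) ^ (-(m - 1) / 2) := by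
  have hn' : (2 : ℝ) ≤ n := by exact_mod_cast hn
  have hm0 : 0 < m := by linarith
  have h2 : 0 < m + n - 2 := by linarith
  have hma : 0 < m + a ^ 2 := by positivity
  have e1 : (m + n) / 2 - 1 = (m + n - 2) / 2 := by ring
  have e2 : (m + n) / 2 = m / 2 + n / 2 := by ring
  have hπ := Real.pi_pos
  rw [c0_eq hm0, cW_eq hn hm, Gamma_eq_sub_one_mul (by linarith : 1 < (m + n) / 2), e1, e2,
    Real.rpow_add hm0, sub_div (n : ℝ), Real.rpow_sub hπ, Real.mul_rpow hm0.le hπ.le,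
    Real.sqrt_eq_rpow, neg_div, Real.rpow_neg hma.le]
  have := Real.Gamma_pos_of_pos (half_pos h2)
  have := Real.Gamma_pos_of_pos (half_pos hm0)
  have := Real.Gamma_pos_of_pos (half_pos (by linarith : 0 < m - 1))
  have : 0 < m ^ ((n : ℝ) / 2) := by positivity
  have : 0 < m ^ (m / 2) := by positivity
  have : 0 < Real.pi ^ ((n : ℝ) / 2) := by positivity
  have : 0 < Real.pi ^ ((1 : ℝ) / 2) := by positivity
  have : 0 < (m + a ^ 2) ^ ((m - 1) / 2) := by positivity
  field_simp

theorem c0_div_cV (hn : 2 ≤ n) (hm : 3 < m) (a : ℝ) :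
    c0 n m / cV n m a = Real.Gamma ((m - 3) / 2) * m ^ (m / 2) /
      (4 * Real.Gamma (m / 2) * √Real.pi) * (m + a ^ 2) ^ (-(m - 3) / 2) := by
  have hn' : (2 : ℝ) ≤ n := by exact_mod_cast hn
  have hm0 : 0 < m := by linarith
  have h2 : 0 < m + n - 2 := by linarith
  have h4 : 0 < m + n - 4 := by linarith
  have hma : 0 < m + a ^ 2 := by positivity
  have e1 : (m + n) / 2 - 1 = (m + n - 2) / 2 := by ring
  have e2 : (m + n) / 2 = m / 2 + n / 2 := by ring
  have e3 : (m + n - 2) / 2 - 1 = (m + n - 4) / 2 := by ring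
  have hπ := Real.pi_pos
  rw [c0_eq hm0, cV_eq hn hm, Gamma_eq_sub_one_mul (by linarith : 1 < (m + n) / 2), e1,
    Gamma_eq_sub_one_mul (by linarith : 1 < (m + n - 2) / 2), e3, e2,
    Real.rpow_add hm0, sub_div (n : ℝ), Real.rpow_sub hπ, Real.mul_rpow hm0.le hπ.le,
    Real.sqrt_eq_rpow, neg_div, Real.rpow_neg hma.le]
  have := Real.Gamma_pos_of_pos (half_pos h4)
  have := Real.Gamma_pos_of_pos (half_pos hm0)
  have := Real.Gamma_pos_of_pos (half_pos (by linarith : 0 < m - 3))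
  have : 0 < m ^ ((n : ℝ) / 2) := by positivity
  have : 0 < m ^ (m / 2) := by positivity
  have : 0 < Real.pi ^ ((n : ℝ) / 2) := by positivity
  have : 0 < Real.pi ^ ((1 : ℝ) / 2) := by positivity
  have : 0 < (m + a ^ 2) ^ ((m - 3) / 2) := by positivity
  field_simp
  norm_num

/-- Two deleted coordinates leave the quotient `Γ((m-2)/2) / Γ(m/2)`, whose arguments differ by one,
so no Gamma function survives, unlike for one deleted coordinate. -/
theorem c0_div_cU (hn : 2 ≤ n) (hm : 2 < m) (a b : ℝ) :
    c0 n m / cU n m a b = m ^ (m / 2) / (2 * (m - 2) * Real.pi) *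
      (m + a ^ 2 + b ^ 2) ^ (-(m - 2) / 2) := by
  have hn' : (2 : ℝ) ≤ n := by exact_mod_cast hn
  have hm0 : 0 < m := by linarith
  have h0 : 0 < m - 2 := by linarith
  have h2 : 0 < m + n - 2 := by linarith
  have h4 : 0 < m + n - 4 := by linarith
  have hma : 0 < m + a ^ 2 + b ^ 2 := by positivity
  have e1 : (m + n) / 2 - 1 = (m + n - 2) / 2 := by ring
  have e2 : (m + n) / 2 = m / 2 + n / 2 := by ring
  have e3 : (m + n - 2) / 2 - 1 = (m + n - 4) / 2 := by ring
  have e4 : m / 2 - 1 = (m - 2) / 2 := by ring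
  have hπ := Real.pi_pos
  rw [c0_eq hm0, cU_eq hn hm, Gamma_eq_sub_one_mul (by linarith : 1 < (m + n) / 2), e1,
    Gamma_eq_sub_one_mul (by linarith : 1 < (m + n - 2) / 2), e3, e2,
    Gamma_eq_sub_one_mul (by linarith : 1 < m / 2), e4,
    Real.rpow_add hm0, sub_div (n : ℝ), div_self (two_ne_zero (α := ℝ)), Real.rpow_sub hπ,
    Real.mul_rpow hm0.le hπ.le, Real.rpow_one, neg_div, Real.rpow_neg hma.le]
  have := Real.Gamma_pos_of_pos (half_pos h4)
  have := Real.Gamma_pos_of_pos (half_pos h0)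
  have : 0 < m ^ ((n : ℝ) / 2) := by positivity
  have : 0 < m ^ (m / 2) := by positivity
  have : 0 < Real.pi ^ ((n : ℝ) / 2) := by positivity
  have : 0 < (m + a ^ 2 + b ^ 2) ^ ((m - 2) / 2) := by positivity
  field_simp

end marginals

/-! ### Powers of `b + |z|² / m` -/

section tPow

variable {ι : Type*} [Fintype ι]

/-- The function `z ↦ (b + |z|² / m)^{-p}`. -/
def tPow (m b p : ℝ) (z : ι → ℝ) : ℝ := (b + z ⬝ᵥ z / m) ^ (-p)

theorem dotProduct_self_nonneg (z : ι → ℝ) : 0 ≤ z ⬝ᵥ z :=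
  Finset.sum_nonneg fun i _ => mul_self_nonneg (z i)

theorem sq_le_dotProduct_self (z : ι → ℝ) (i : ι) : z i ^ 2 ≤ z ⬝ᵥ z := by
  rw [sq]
  exact Finset.single_le_sum (f := fun i => z i * z i) (fun i _ => mul_self_nonneg (z i))
    (Finset.mem_univ i)

/-- The norm on the left is the supremum norm. The comparison transfers the known integrability of
powers of `1 + ‖z‖²` to `tPow`. -/
theorem norm_sq_le_dotProduct_self (z : ι → ℝ) : ‖z‖ ^ 2 ≤ z ⬝ᵥ z := by
  have h : ‖z‖ ≤ √(z ⬝ᵥ z) := by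
    refine (pi_norm_le_iff_of_nonneg (Real.sqrt_nonneg _)).2 fun i => ?_
    exact Real.abs_le_sqrt (sq_le_dotProduct_self z i)
  calc ‖z‖ ^ 2 ≤ √(z ⬝ᵥ z) ^ 2 := by gcongr
    _ = z ⬝ᵥ z := Real.sq_sqrt (dotProduct_self_nonneg z)

variable {m b : ℝ}

theorem tPow_base_pos (hm : 0 < m) (hb : 0 < b) (z : ι → ℝ) : 0 < b + z ⬝ᵥ z / m := by
  have := dotProduct_self_nonneg z
  positivity

theorem tPow_pos (hm : 0 < m) (hb : 0 < b) (p : ℝ) (z : ι → ℝ) : 0 < tPow m b p z :=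
  Real.rpow_pos_of_pos (tPow_base_pos hm hb z) _

theorem continuous_tPow (hm : 0 < m) (hb : 0 < b) (p : ℝ) :
    Continuous (tPow m b p : (ι → ℝ) → ℝ) := by
  refine Continuous.rpow_const ?_ fun z => Or.inl (tPow_base_pos hm hb z).ne'
  unfold dotProduct
  fun_prop

theorem integrable_tPow (hm : 0 < m) (hb : 0 < b) {p : ℝ} (hp : (Fintype.card ι : ℝ) < 2 * p) :
    Integrable (tPow m b p : (ι → ℝ) → ℝ) := by
  have hp0 : 0 < p := by have : (0 : ℝ) ≤ Fintype.card ι := Nat.cast_nonneg _; linarith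
  have h := integrable_rpow_neg_one_add_norm_sq (E := ι → ℝ) (μ := volume) (r := 2 * p)
    (by simpa using hp)
  have hc : 0 < min b m⁻¹ := lt_min hb (inv_pos.2 hm)
  refine (h.const_mul ((min b m⁻¹) ^ (-p))).mono'
    (continuous_tPow hm hb p).aestronglyMeasurable (Filter.Eventually.of_forall fun z => ?_)
  rw [Real.norm_of_nonneg (tPow_pos hm hb p z).le, tPow,
    show -(2 * p) / 2 = -p by ring, ← Real.mul_rpow hc.le (by positivity)]
  refine Real.rpow_le_rpow_of_nonpos (by positivity) ?_ (by linarith)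
  have h1 := norm_sq_le_dotProduct_self z
  calc min b m⁻¹ * (1 + ‖z‖ ^ 2) = min b m⁻¹ + min b m⁻¹ * ‖z‖ ^ 2 := by ring
    _ ≤ b + m⁻¹ * (z ⬝ᵥ z) := by
      gcongr
      · exact min_le_left _ _
      · exact min_le_right _ _
    _ = b + z ⬝ᵥ z / m := by ring

/-- Each coordinate factor costs half a power, because `|z_i| ≤ √m (b + |z|²/m)^(1/2)`. All moment
integrability conditions come from counting these halves. -/
theorem abs_coord_mul_tPow_le (hm : 0 < m) (hb : 0 < b) (p : ℝ) (i : ι) (z : ι → ℝ) :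
    |z i| * tPow m b p z ≤ √m * tPow m b (p - 1 / 2) z := by
  have hbase := tPow_base_pos hm hb z
  have h : |z i| ≤ √m * (b + z ⬝ᵥ z / m) ^ (1 / 2 : ℝ) := by
    rw [← Real.sqrt_eq_rpow, ← Real.sqrt_mul hm.le]
    refine Real.abs_le_sqrt ((sq_le_dotProduct_self z i).trans ?_)
    rw [mul_add, mul_div_cancel₀ _ hm.ne']
    have := mul_pos hm hb
    linarith
  have e : tPow m b (p - 1 / 2) z = (b + z ⬝ᵥ z / m) ^ (1 / 2 : ℝ) * tPow m b p z := by
    rw [tPow, tPow, ← Real.rpow_add hbase]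
    congr 1
    ring
  rw [e, ← mul_assoc]
  exact mul_le_mul_of_nonneg_right h (tPow_pos hm hb p z).le

theorem integrable_coord_mul_tPow (hm : 0 < m) (hb : 0 < b) {p : ℝ}
    (hp : (Fintype.card ι : ℝ) + 1 < 2 * p) (i : ι) :
    Integrable (fun z : ι → ℝ => z i * tPow m b p z) := by
  have h := (integrable_tPow (ι := ι) hm hb (p := p - 1 / 2) (by linarith)).const_mul (√m)
  refine h.mono' ((continuous_apply i).mul (continuous_tPow hm hb p)).aestronglyMeasurable
    (Filter.Eventually.of_forall fun z => ?_)
  rw [norm_mul, Real.norm_eq_abs, Real.norm_of_nonneg (tPow_pos hm hb p z).le]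
  exact abs_coord_mul_tPow_le hm hb p i z

theorem integrable_coord_mul_coord_mul_tPow (hm : 0 < m) (hb : 0 < b) {p : ℝ}
    (hp : (Fintype.card ι : ℝ) + 2 < 2 * p) (i j : ι) :
    Integrable (fun z : ι → ℝ => z i * z j * tPow m b p z) := by
  have h := (integrable_tPow (ι := ι) hm hb (p := p - 1 / 2 - 1 / 2) (by linarith)).const_mul
    (√m * √m)
  refine h.mono' (((continuous_apply i).mul (continuous_apply j)).mul
    (continuous_tPow hm hb p)).aestronglyMeasurable (Filter.Eventually.of_forall fun z => ?_)
  rw [norm_mul, norm_mul, Real.norm_eq_abs, Real.norm_eq_abs,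
    Real.norm_of_nonneg (tPow_pos hm hb p z).le]
  calc |z i| * |z j| * tPow m b p z = |z i| * (|z j| * tPow m b p z) := by ring
    _ ≤ |z i| * (√m * tPow m b (p - 1 / 2) z) := by
      exact mul_le_mul_of_nonneg_left (abs_coord_mul_tPow_le hm hb p j z) (abs_nonneg _)
    _ = √m * (|z i| * tPow m b (p - 1 / 2) z) := by ring
    _ ≤ √m * (√m * tPow m b (p - 1 / 2 - 1 / 2) z) := by
      exact mul_le_mul_of_nonneg_left (abs_coord_mul_tPow_le hm hb _ i z) (Real.sqrt_nonneg _)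
    _ = _ := by ring

theorem stPDF_zero_one [DecidableEq ι] {n : ℕ} (hn : Fintype.card ι = n) (hm : 0 < m)
    (z : ι → ℝ) : stPDF 0 1 m z = c0 n m * tPow m 1 ((m + n) / 2) z := by
  rw [stPDF, sub_zero, inv_one, one_mulVec, det_one, Real.sqrt_one, mul_one, c0_eq hm, hn, tPow,
    neg_div]

theorem ellPDF_zero_one [DecidableEq ι] (G : ℝ → ℝ) (z : ι → ℝ) :
    ellPDF 0 1 G z = normConst (Fintype.card ι) G * G (1 / 2 * (z ⬝ᵥ z)) := by
  rw [ellPDF, sub_zero, inv_one, one_mulVec, det_one, Real.sqrt_one, div_one]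

end tPow

/-! ### The square root of a positive definite matrix -/

section msqrt

variable {ι : Type*} [Fintype ι] [DecidableEq ι] {Sig : Matrix ι ι ℝ}

open scoped MatrixOrder in
theorem msqrt_mul_msqrt (hS : Sig.PosDef) : msqrt Sig * msqrt Sig = Sig :=
  CFC.sqrt_mul_sqrt_self Sig hS.posSemidef.nonneg

open scoped MatrixOrder in
theorem msqrt_transpose (Sig : Matrix ι ι ℝ) : (msqrt Sig)ᵀ = msqrt Sig := by
  have h := (CFC.sqrt_nonneg Sig).posSemidef.isHermitian
  rwa [IsHermitian, conjTranspose_eq_transpose_of_trivial] at h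

open scoped MatrixOrder in
theorem det_msqrt (hS : Sig.PosDef) : (msqrt Sig).det = √Sig.det := by
  rw [msqrt, hS.posSemidef.det_sqrt, RCLike.sqrt_of_nonneg hS.posSemidef.det_nonneg]
  simp

theorem isUnit_det_msqrt (hS : Sig.PosDef) : IsUnit (msqrt Sig).det := by
  rw [det_msqrt hS]
  exact (Real.sqrt_pos.2 hS.det_pos).ne'.isUnit

open scoped MatrixOrder in
theorem msqrt_one : msqrt (1 : Matrix ι ι ℝ) = 1 := CFC.sqrt_one

open scoped MatrixOrder in
-- This is uniqueness of the positive semidefinite square root.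
theorem msqrt_of_isDiag (hS : Sig.PosDef) (hd : Sig.IsDiag) :
    msqrt Sig = diagonal fun i => √(Sig i i) := by
  have hpos : ∀ i, 0 < Sig i i := fun i => hS.diag_pos
  rw [msqrt, CFC.sqrt_eq_iff _ _ hS.posSemidef.nonneg
    (PosSemidef.diagonal fun i => Real.sqrt_nonneg _).nonneg, diagonal_mul_diagonal]
  conv_rhs => rw [← hd.diagonal_diag]
  congr 1
  funext i
  exact Real.mul_self_sqrt (hpos i).le

theorem standardize_quadratic (hS : Sig.PosDef) (μ y : ι → ℝ) :
    (y - μ) ⬝ᵥ (Sig⁻¹ *ᵥ (y - μ)) = standardize μ Sig y ⬝ᵥ standardize μ Sig y := by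
  have hinv : Sig⁻¹ = (msqrt Sig)⁻¹ * (msqrt Sig)⁻¹ := by
    rw [← Matrix.mul_inv_rev, msqrt_mul_msqrt hS]
  rw [standardize, hinv, ← mulVec_mulVec, dotProduct_mulVec, ← mulVec_transpose,
    transpose_nonsing_inv, msqrt_transpose]

theorem add_msqrt_mulVec_standardize (hS : Sig.PosDef) (μ y : ι → ℝ) :
    μ + msqrt Sig *ᵥ standardize μ Sig y = y := by
  rw [standardize, mulVec_mulVec, Matrix.mul_nonsing_inv _ (isUnit_det_msqrt hS), one_mulVec,
    add_sub_cancel]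

end msqrt

/-! ### Densities of random vectors -/

theorem condCov_eq_covariance {S ι : Type*} [MeasurableSpace S] {P : Measure S} {X : S → ι → ℝ}
    {A : Set S} (i j : ι) : condCov P X A i j = cov[fun s => X s i, fun s => X s j; P[|A]] := rfl

section density

variable {S ι : Type*} [MeasurableSpace S] [Fintype ι] {P : Measure S}

/-- The image of Lebesgue measure under the map is `|det A|⁻¹` times Lebesgue measure, which absorbs
the Jacobian factor in `hfg`. -/
theorem HasDensity.affine [DecidableEq ι] {Y : S → ι → ℝ} {f g : (ι → ℝ) → ℝ}
    (h : HasDensity P Y f) {A : Matrix ι ι ℝ} (hA : A.det ≠ 0) (μ : ι → ℝ) (hg : Measurable g)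
    (hfg : ∀ y, f y = |A.det| * g (A *ᵥ (y - μ))) :
    HasDensity P (fun s => A *ᵥ (Y s - μ)) g := by
  obtain ⟨hY, hmap⟩ := h
  have hsub : Measurable fun y : ι → ℝ => y - μ := by fun_prop
  have hlin : Measurable (toLin' A) := (toLin' A).continuous_of_finiteDimensional.measurable
  have hφ : Measurable fun y : ι → ℝ => A *ᵥ (y - μ) := hlin.comp hsub
  have hvol : (volume : Measure (ι → ℝ)).map (fun y => A *ᵥ (y - μ)) =
      ENNReal.ofReal |A.det⁻¹| • volume := by
    have e : (fun y : ι → ℝ => A *ᵥ (y - μ)) = toLin' A ∘ fun y => y - μ := by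
      funext y; simp
    rw [e, ← Measure.map_map hlin hsub, (measurePreserving_sub_right volume μ).map_eq]
    exact Real.map_matrix_volume_pi_eq_smul_volume_pi hA
  refine ⟨hφ.comp hY, ?_⟩
  have e2 : P.map (fun s => A *ᵥ (Y s - μ)) = (P.map Y).map fun y => A *ᵥ (y - μ) :=
    (Measure.map_map hφ hY).symm
  rw [e2, hmap]
  ext s hs
  rw [Measure.map_apply hφ hs, withDensity_apply _ (hφ hs), withDensity_apply _ hs]
  have hpos : 0 < |A.det| := abs_pos.2 hA
  have e3 : ∀ y, ENNReal.ofReal (f y) =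
      ENNReal.ofReal |A.det| * ENNReal.ofReal (g (A *ᵥ (y - μ))) := fun y => by
    rw [hfg, ENNReal.ofReal_mul hpos.le]
  simp_rw [e3]
  have hgφ : Measurable fun y => g (A *ᵥ (y - μ)) := hg.comp hφ
  rw [lintegral_const_mul _ hgφ.ennreal_ofReal,
    ← setLIntegral_map (g := fun y => A *ᵥ (y - μ)) (f := fun z => ENNReal.ofReal (g z)) hs
      hg.ennreal_ofReal hφ, hvol, Measure.restrict_smul,
    lintegral_smul_measure, smul_eq_mul, ← mul_assoc, ← ENNReal.ofReal_mul hpos.le, ← abs_mul,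
    mul_inv_cancel₀ hA, abs_one, ENNReal.ofReal_one, one_mul]

theorem measurableSet_orthant (t : ι → ℝ) : MeasurableSet (orthant t) := by
  have : orthant t = Set.univ.pi fun i => Set.Ioi (t i) := by
    ext z; simp [orthant]
  rw [this]
  exact MeasurableSet.univ_pi fun i => measurableSet_Ioi

theorem HasDensity.integrable_comp_iff {Z : S → ι → ℝ} {f : (ι → ℝ) → ℝ} (h : HasDensity P Z f)
    (hf : Measurable f) (hf0 : ∀ z, 0 ≤ f z) {φ : (ι → ℝ) → ℝ} (hφ : Measurable φ) :
    Integrable (fun s => φ (Z s)) P ↔ Integrable fun z => φ z * f z := by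
  have := integrable_map_measure (μ := P) (f := Z) (g := φ) hφ.aestronglyMeasurable
    h.1.aemeasurable
  rw [Function.comp_def] at this
  rw [← this, h.2, integrable_withDensity_iff hf.ennreal_ofReal
    (Filter.Eventually.of_forall fun _ => ENNReal.ofReal_lt_top)]
  simp_rw [ENNReal.toReal_ofReal (hf0 _)]

theorem HasDensity.setIntegral_comp {Z : S → ι → ℝ} {f : (ι → ℝ) → ℝ} (h : HasDensity P Z f)
    (hf : Measurable f) (hf0 : ∀ z, 0 ≤ f z) {φ : (ι → ℝ) → ℝ} (hφ : Measurable φ)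
    {A : Set (ι → ℝ)} (hA : MeasurableSet A) :
    ∫ s in Z ⁻¹' A, φ (Z s) ∂P = ∫ z in A, φ z * f z := by
  rw [← setIntegral_map (f := φ) hA hφ.aestronglyMeasurable h.1.aemeasurable, h.2,
    setIntegral_withDensity_eq_setIntegral_toReal_smul hf.ennreal_ofReal
      (Filter.Eventually.of_forall fun _ => ENNReal.ofReal_lt_top) _ hA]
  simp_rw [ENNReal.toReal_ofReal (hf0 _), smul_eq_mul, mul_comm]

theorem HasDensity.real_preimage_orthant [IsProbabilityMeasure P] {Z : S → ι → ℝ}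
    {f : (ι → ℝ) → ℝ} (h : HasDensity P Z f) (hf : Measurable f) (hf0 : ∀ z, 0 ≤ f z)
    (t : ι → ℝ) : P.real {s | ∀ i, t i < Z s i} = tailFn f t := by
  have := h.setIntegral_comp hf hf0 (φ := fun _ => 1) measurable_const (measurableSet_orthant t)
  simpa [tailFn, orthant, Set.preimage] using this

/-- If the tail has probability zero the identity still holds: the conditional measure is then zero,
and so is `1 / tailFn f t`. -/
theorem HasDensity.integral_cond [IsProbabilityMeasure P] {Z : S → ι → ℝ}
    {f : (ι → ℝ) → ℝ} (h : HasDensity P Z f) (hf : Measurable f) (hf0 : ∀ z, 0 ≤ f z)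
    (t : ι → ℝ) {φ : (ι → ℝ) → ℝ} (hφ : Measurable φ) :
    ∫ s, φ (Z s) ∂(P[|{s | ∀ i, t i < Z s i}]) = 1 / tailFn f t * ∫ z in orthant t, φ z * f z := by
  rw [ProbabilityTheory.cond, integral_smul_measure, ENNReal.toReal_inv, smul_eq_mul,
    ← h.real_preimage_orthant hf hf0 t, one_div, Measure.real]
  congr 1
  exact h.setIntegral_comp hf hf0 hφ (measurableSet_orthant t)

theorem memLp_two_cond {X : S → ℝ} [IsFiniteMeasure P] (hX : MemLp X 2 P) (A : Set S) :
    MemLp X 2 (P[|A]) := by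
  by_cases hA : P A = 0
  · rw [cond_eq_zero_of_meas_eq_zero hA]
    simp
  · exact (hX.restrict A).smul_measure (ENNReal.inv_ne_top.2 hA)

theorem condMean_affine {Y Z : S → ι → ℝ} {A : Set S} [IsProbabilityMeasure P]
    (hA : P A ≠ 0) (μ : ι → ℝ) (M : Matrix ι ι ℝ) (hYZ : ∀ s, Y s = μ + M *ᵥ Z s)
    (hZ : ∀ i, MemLp (fun s => Z s i) 2 P) :
    condMean P Y A = μ + M *ᵥ condMean P Z A := by
  have := cond_isProbabilityMeasure hA
  have hint : ∀ i, Integrable (fun s => Z s i) (P[|A]) :=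
    fun i => (memLp_two_cond (hZ i) A).integrable one_le_two
  funext i
  simp only [condMean, hYZ, Pi.add_apply, mulVec, dotProduct]
  rw [integral_add (integrable_const _) (integrable_finsetSum _ fun j _ => (hint j).const_mul _),
    integral_finsetSum _ fun j _ => (hint j).const_mul _]
  simp [integral_const_mul]


theorem condCov_affine {Y Z : S → ι → ℝ} {A : Set S} [IsProbabilityMeasure P]
    (hA : P A ≠ 0) (μ : ι → ℝ) (M : Matrix ι ι ℝ) (hM : Mᵀ = M)
    (hYZ : ∀ s, Y s = μ + M *ᵥ Z s) (hZ : ∀ i, MemLp (fun s => Z s i) 2 P) :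
    condCov P Y A = M * condCov P Z A * M := by
  have := cond_isProbabilityMeasure hA
  have hint : ∀ i, MemLp (fun s => Z s i) 2 (P[|A]) := fun i => memLp_two_cond (hZ i) A
  have hsum : ∀ i, Integrable (fun s => ∑ k, M i k * Z s k) (P[|A]) := fun i =>
    integrable_finsetSum _ fun j _ => ((hint j).integrable one_le_two).const_mul _
  ext i j
  rw [condCov_eq_covariance]
  simp only [hYZ, Pi.add_apply, mulVec, dotProduct]
  rw [covariance_const_add_left (hsum i), covariance_const_add_right (hsum j),
    covariance_fun_sum_fun_sum (fun k => (hint k).const_mul _) (fun k => (hint k).const_mul _)]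
  simp_rw [covariance_const_mul_left, covariance_const_mul_right, mul_apply, Finset.sum_mul]
  rw [Finset.sum_comm]
  refine Finset.sum_congr rfl fun l _ => Finset.sum_congr rfl fun k _ => ?_
  have : M j l = M l j := by conv_lhs => rw [← hM, transpose_apply]
  rw [condCov_eq_covariance, this]
  ring

end density

/-! ### Standardization -/

theorem gsstPDF_eq_gsePDF {n : ℕ} {m : ℝ} (hm : 0 < m) (μ γ : Fin n → ℝ)
    (Sig : Matrix (Fin n) (Fin n) ℝ) (H : ℝ → ℝ) :
    gsstPDF μ Sig γ m H = gsePDF μ Sig (stGen n m) (fun z => H (γ ⬝ᵥ z)) := by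
  funext y
  have h := c0_eq (n := n) hm
  rw [c0] at h
  rw [gsstPDF, gsePDF, stPDF, ellPDF, Fintype.card_fin, h, div_div, stGen]
  congr 4
  ring

section standardization

variable {S : Type*} [MeasurableSpace S] {P : Measure S} {n : ℕ} {m : ℝ}
  {μ γ : Fin n → ℝ} {Sig : Matrix (Fin n) (Fin n) ℝ} {H : ℝ → ℝ}

theorem gsstPDF_zero_one (hm : 0 < m) (z : Fin n → ℝ) :
    gsstPDF 0 1 γ m H z = 2 * (c0 n m * tPow m 1 ((m + n) / 2) z) * H (γ ⬝ᵥ z) := by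
  rw [gsstPDF, stPDF_zero_one (Fintype.card_fin n) hm, msqrt_one, inv_one, one_mulVec, sub_zero]

theorem gsstPDF_eq_mul_standardize (hS : Sig.PosDef) (y : Fin n → ℝ) :
    gsstPDF μ Sig γ m H y =
      |(msqrt Sig)⁻¹.det| * gsstPDF 0 1 γ m H ((msqrt Sig)⁻¹ *ᵥ (y - μ)) := by
  have hdet : 0 < √Sig.det := Real.sqrt_pos.2 hS.det_pos
  rw [gsstPDF, gsstPDF, stPDF, stPDF, standardize_quadratic hS, msqrt_one, inv_one, one_mulVec,
    sub_zero, det_one, Real.sqrt_one, mul_one, ← standardize, det_nonsing_inv,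
    det_msqrt hS, Ring.inverse_eq_inv', abs_of_pos (inv_pos.2 hdet), ← div_div]
  ring

theorem continuous_dotProduct_const {ι : Type*} [Fintype ι] (γ : ι → ℝ) :
    Continuous fun z : ι → ℝ => γ ⬝ᵥ z := by
  unfold dotProduct
  fun_prop

theorem measurable_gsstPDF (hm : 0 < m) (hH : Measurable H) :
    Measurable (gsstPDF (0 : Fin n → ℝ) 1 γ m H) := by
  have h : Measurable fun z : Fin n → ℝ =>
      2 * (c0 n m * tPow m 1 ((m + n) / 2) z) * H (γ ⬝ᵥ z) :=
    (((continuous_tPow hm one_pos _).measurable.const_mul _).const_mul _).mul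
      (hH.comp (continuous_dotProduct_const γ).measurable)
  simpa only [← gsstPDF_zero_one hm] using h

theorem c0_pos (hm : 0 < m) : 0 < c0 n m := by
  rw [c0_eq hm]
  have := Real.Gamma_pos_of_pos (half_pos hm)
  have := Real.Gamma_pos_of_pos (half_pos (by positivity : 0 < m + n))
  have := Real.pi_pos
  positivity

theorem gsstPDF_nonneg (hm : 0 < m) (hH : ∀ x, 0 ≤ H x) (z : Fin n → ℝ) :
    0 ≤ gsstPDF (0 : Fin n → ℝ) 1 γ m H z := by
  rw [gsstPDF_zero_one hm]
  have := c0_pos (n := n) hm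
  have := tPow_pos hm one_pos ((m + n) / 2) z
  have := hH (γ ⬝ᵥ z)
  positivity

theorem hasDensity_standardize (hS : Sig.PosDef) (hm : 0 < m) (hH : Measurable H)
    {Y : S → Fin n → ℝ} (h : HasDensity P Y (gsstPDF μ Sig γ m H)) :
    HasDensity P (fun s => standardize μ Sig (Y s)) (gsstPDF 0 1 γ m H) :=
  h.affine (by
    rw [det_nonsing_inv, Ring.inverse_eq_inv']
    exact inv_ne_zero (isUnit_det_msqrt hS).ne_zero) μ (measurable_gsstPDF hm hH)
    fun y => gsstPDF_eq_mul_standardize hS y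

/-- Two coordinate factors cost one power of the weight, and `m + n - 2 > n` is exactly `m > 2`. The
bound `B` is left free so that the lemma applies to any bounded nonnegative `H`, such as a
distribution function whose total mass has not been computed. -/
theorem memLp_two_of_hasDensity {Z : S → Fin n → ℝ} {B : ℝ} (hm : 2 < m) (hH : Measurable H)
    (hH0 : ∀ x, 0 ≤ H x) (hHB : ∀ x, H x ≤ B)
    (h : HasDensity P Z (gsstPDF 0 1 γ m H)) (i : Fin n) : MemLp (fun s => Z s i) 2 P := by
  have hm0 : 0 < m := by linarith
  have hmeas : Measurable fun s => Z s i := (measurable_pi_apply i).comp h.1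
  rw [memLp_two_iff_integrable_sq hmeas.aestronglyMeasurable]
  rw [h.integrable_comp_iff (measurable_gsstPDF hm0 hH) (gsstPDF_nonneg hm0 hH0)
    (φ := fun z => z i ^ 2) (by fun_prop)]
  have hint := integrable_coord_mul_coord_mul_tPow (ι := Fin n) hm0 one_pos (p := (m + n) / 2)
    (by rw [Fintype.card_fin]; linarith) i i
  refine (hint.const_mul (2 * c0 n m * B)).mono' ?_ (Filter.Eventually.of_forall fun z => ?_)
  · exact (Measurable.mul (by fun_prop) (measurable_gsstPDF hm0 hH)).aestronglyMeasurable
  · have hc := c0_pos (n := n) hm0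
    have ht := tPow_pos hm0 one_pos ((m + n) / 2) z
    rw [Real.norm_of_nonneg (mul_nonneg (sq_nonneg _) (gsstPDF_nonneg hm0 hH0 z)),
      gsstPDF_zero_one hm0]
    calc z i ^ 2 * (2 * (c0 n m * tPow m 1 ((m + n) / 2) z) * H (γ ⬝ᵥ z))
        = (z i ^ 2 * (2 * (c0 n m * tPow m 1 ((m + n) / 2) z))) * H (γ ⬝ᵥ z) := by ring
      _ ≤ (z i ^ 2 * (2 * (c0 n m * tPow m 1 ((m + n) / 2) z))) * B :=
        mul_le_mul_of_nonneg_left (hHB _) (by positivity)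
      _ = _ := by ring

theorem memLp_two_affine {Y Z : S → Fin n → ℝ} [IsFiniteMeasure P]
    (M : Matrix (Fin n) (Fin n) ℝ) (hYZ : ∀ s, Y s = μ + M *ᵥ Z s)
    (hZ : ∀ i, MemLp (fun s => Z s i) 2 P) (i : Fin n) : MemLp (fun s => Y s i) 2 P := by
  simp only [hYZ, Pi.add_apply, mulVec, dotProduct]
  exact (memLp_const (μ i)).add (memLp_finsetSum _ fun j _ => (hZ j).const_mul (M i j))

/-- A diagonal root acts on each coordinate as multiplication by a positive number, so componentwise
inequalities are preserved in both directions. -/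
theorem setOf_lt_eq_of_isDiag (hS : Sig.PosDef) (hd : Sig.IsDiag) (y : Fin n → ℝ)
    {S : Type*} (Y : S → Fin n → ℝ) :
    {s | ∀ i, y i < Y s i} =
      {s | ∀ i, standardize μ Sig y i < standardize μ Sig (Y s) i} := by
  have hpos : ∀ i, 0 < √(Sig i i) := fun i => Real.sqrt_pos.2 hS.diag_pos
  have key : ∀ (x : Fin n → ℝ) i, x i = μ i + √(Sig i i) * standardize μ Sig x i := by
    intro x i
    have h := congrFun (add_msqrt_mulVec_standardize hS μ x) i
    rw [msqrt_of_isDiag hS hd, Pi.add_apply, mulVec_diagonal] at h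
    exact h.symm
  ext s
  refine forall_congr' fun i => ?_
  rw [key y i, key (Y s) i, add_lt_add_iff_left, mul_lt_mul_iff_right₀ (hpos i)]

theorem tail_moments_affine [IsProbabilityMeasure P] (hS : Sig.PosDef) (hm : 2 < m)
    (hH : IsSkewing H) {Y : S → Fin n → ℝ} (h : HasDensity P Y (gsstPDF μ Sig γ m H))
    {y lam : Fin n → ℝ} (hlam : lam = standardize μ Sig y)
    (hpos : 0 < tailFn (gsstPDF 0 1 γ m H) lam) :
    condMean P Y {s | ∀ i, lam i < standardize μ Sig (Y s) i} =
        μ + msqrt Sig *ᵥ MTCE P (fun s => standardize μ Sig (Y s)) lam ∧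
      condCov P Y {s | ∀ i, lam i < standardize μ Sig (Y s) i} =
        msqrt Sig * MTCov P (fun s => standardize μ Sig (Y s)) lam * msqrt Sig ∧
      (Sig.IsDiag →
        MTCE P Y y = μ + msqrt Sig *ᵥ MTCE P (fun s => standardize μ Sig (Y s)) lam ∧
        MTCov P Y y =
          msqrt Sig * MTCov P (fun s => standardize μ Sig (Y s)) lam * msqrt Sig) := by
  have hm0 : 0 < m := by linarith
  have hZ := hasDensity_standardize hS hm0 hH.1 h
  have hmem := memLp_two_of_hasDensity hm hH.1 (fun x => (hH.2.2 x).1) (fun x => (hH.2.2 x).2) hZ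
  have hA : P {s | ∀ i, lam i < standardize μ Sig (Y s) i} ≠ 0 := by
    intro h0
    rw [← hZ.real_preimage_orthant (measurable_gsstPDF hm0 hH.1)
      (gsstPDF_nonneg hm0 fun x => (hH.2.2 x).1) lam, Measure.real, h0] at hpos
    simp at hpos
  have hYZ : ∀ s, Y s = μ + msqrt Sig *ᵥ standardize μ Sig (Y s) := fun s =>
    (add_msqrt_mulVec_standardize hS μ (Y s)).symm
  have h1 := condMean_affine hA μ (msqrt Sig) hYZ hmem
  have h2 := condCov_affine hA μ (msqrt Sig) (msqrt_transpose Sig) hYZ hmem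
  refine ⟨h1, h2, fun hd => ?_⟩
  have hset := setOf_lt_eq_of_isDiag (μ := μ) hS hd y Y
  rw [← hlam] at hset
  rw [MTCE, MTCov, hset]
  exact ⟨h1, h2⟩

theorem condCov_apply_eq_sub [IsProbabilityMeasure P] {Z : S → Fin n → ℝ} {A : Set S}
    (hA : P A ≠ 0) (hZ : ∀ i, MemLp (fun s => Z s i) 2 P) (i j : Fin n) :
    condCov P Z A i j = ∫ s, Z s i * Z s j ∂(P[|A]) - condMean P Z A i * condMean P Z A j := by
  have := cond_isProbabilityMeasure hA
  rw [condCov_eq_covariance, covariance_eq_sub (memLp_two_cond (hZ i) A) (memLp_two_cond (hZ j) A)]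
  rfl

end standardization

/-! ### Integration by parts on orthants -/

section splitting

variable {ι : Type*} [DecidableEq ι]

/-- The vector with coordinate `t` in the place `k` and `w_l` elsewhere. -/
def ins (k : ι) (w : {l : ι // l ≠ k} → ℝ) (t : ℝ) : ι → ℝ :=
  fun l => if h : l ≠ k then w ⟨l, h⟩ else t

/-- Deletion of the coordinate `k`. -/
def del (k : ι) (z : ι → ℝ) : {l : ι // l ≠ k} → ℝ := fun l => z l

@[simp] theorem ins_self (k : ι) (w : {l : ι // l ≠ k} → ℝ) (t : ℝ) : ins k w t k = t := by
  simp [ins]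

theorem ins_of_ne {k l : ι} (h : l ≠ k) (w : {l : ι // l ≠ k} → ℝ) (t : ℝ) :
    ins k w t l = w ⟨l, h⟩ := by
  simp [ins, h]

theorem del_ins (k : ι) (w : {l : ι // l ≠ k} → ℝ) (t : ℝ) : del k (ins k w t) = w := by
  funext l
  exact ins_of_ne l.2 w t

theorem continuous_ins (k : ι) (w : {l : ι // l ≠ k} → ℝ) : Continuous (ins k w) := by
  refine continuous_pi fun l => ?_
  by_cases h : l = k
  · subst h; simpa using continuous_id'
  · simpa [ins_of_ne h] using continuous_const

/-- The splitting of a vector into the coordinates other than `k` and the coordinate `k`. -/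
def splitAt (k : ι) : (ι → ℝ) ≃ᵐ ({l : ι // l ≠ k} → ℝ) × ℝ :=
  -- The complement of the coordinates other than `k` has one element, so functions on it are real
  -- numbers.
  haveI : Unique {l : ι // ¬ l ≠ k} := ⟨⟨⟨k, by simp⟩⟩, fun l => Subtype.ext (not_not.1 l.2)⟩
  (MeasurableEquiv.piEquivPiSubtypeProd (fun _ : ι => ℝ) (· ≠ k)).trans
    ((MeasurableEquiv.refl _).prodCongr (MeasurableEquiv.funUnique {l : ι // ¬ l ≠ k} ℝ))

theorem splitAt_apply (k : ι) (z : ι → ℝ) : splitAt k z = (del k z, z k) := rfl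

theorem splitAt_ins (k : ι) (w : {l : ι // l ≠ k} → ℝ) (t : ℝ) :
    splitAt k (ins k w t) = (w, t) := by
  rw [splitAt_apply, ins_self]
  congr 1
  funext l
  exact ins_of_ne l.2 w t

theorem splitAt_symm_apply (k : ι) (p : ({l : ι // l ≠ k} → ℝ) × ℝ) :
    (splitAt k).symm p = ins k p.1 p.2 := by
  rw [MeasurableEquiv.symm_apply_eq, splitAt_ins]

theorem splitAt_preimage (k : ι) (lam : ι → ℝ) :
    splitAt k ⁻¹' (orthant (del k lam) ×ˢ Set.Ioi (lam k)) = orthant lam := by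
  ext z
  simp only [Set.mem_preimage, splitAt_apply, Set.mem_prod, orthant, Set.mem_ofPred_eq, Set.mem_Ioi,
    del]
  constructor
  · rintro ⟨h1, h2⟩ i
    by_cases hi : i = k
    · rw [hi]; exact h2
    · exact h1 ⟨i, hi⟩
  · exact fun h => ⟨fun l => h l, h k⟩

variable [Fintype ι]

theorem dotProduct_ins (γ : ι → ℝ) (k : ι) (w : {l : ι // l ≠ k} → ℝ) (t : ℝ) :
    γ ⬝ᵥ ins k w t = del k γ ⬝ᵥ w + γ k * t := by
  rw [dotProduct, dotProduct, ← Fintype.sum_subtype_add_sum_subtype (· ≠ k)]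
  congr 1
  · refine Finset.sum_congr rfl fun l _ => ?_
    rw [ins_of_ne l.2]
    rfl
  · have : ∀ l : {l : ι // ¬ l ≠ k}, γ l * ins k w t l = γ k * t := by
      rintro ⟨l, hl⟩
      obtain rfl : l = k := not_not.1 hl
      simp
    rw [Finset.sum_congr rfl fun l _ => this l]
    simp [Finset.card_univ]

theorem ins_dotProduct_ins (k : ι) (w : {l : ι // l ≠ k} → ℝ) (t : ℝ) :
    ins k w t ⬝ᵥ ins k w t = w ⬝ᵥ w + t ^ 2 := by
  rw [dotProduct_ins, ins_self, sq]
  congr 2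
  funext l
  exact ins_of_ne l.2 w t

theorem measurePreserving_splitAt (k : ι) :
    MeasurePreserving (splitAt k) volume (volume.prod volume) := by
  let _ : Unique {l : ι // ¬ l ≠ k} := ⟨⟨⟨k, by simp⟩⟩, fun l => Subtype.ext (not_not.1 l.2)⟩
  have h1 : MeasurePreserving _ volume (volume.prod volume) :=
    volume_preserving_piEquivPiSubtypeProd (fun _ : ι => ℝ) (· ≠ k)
  -- The product splitting carries the finiteness instance of a subtype, while the one-point
  -- statement is stated for another instance; the conversion identifies the two volumes.
  have h2 : MeasurePreserving (MeasurableEquiv.funUnique {l : ι // ¬ l ≠ k} ℝ)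
      (@volume _ (@MeasureSpace.pi _ (Subtype.fintype _) _ _)) volume := by
    convert! volume_preserving_funUnique {l : ι // ¬ l ≠ k} ℝ
  exact ((MeasurePreserving.id volume).prod h2).comp h1

theorem integrableOn_orthant_iff (k : ι) (lam : ι → ℝ) (F : (ι → ℝ) → ℝ) :
    IntegrableOn F (orthant lam) ↔
      Integrable (fun p : ({l : ι // l ≠ k} → ℝ) × ℝ => F (ins k p.1 p.2))
        ((volume.restrict (orthant (del k lam))).prod (volume.restrict (Set.Ioi (lam k)))) := by
  rw [Measure.prod_restrict, ← splitAt_preimage k lam]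
  have h := (measurePreserving_splitAt k).integrableOn_comp_preimage
    (splitAt k).measurableEmbedding (f := F ∘ (splitAt k).symm)
    (s := orthant (del k lam) ×ˢ Set.Ioi (lam k))
  have e1 : (F ∘ (splitAt k).symm) ∘ splitAt k = F := by
    funext z; simp
  have e2 : F ∘ (splitAt k).symm = fun p => F (ins k p.1 p.2) := by
    funext p; rw [Function.comp_apply, splitAt_symm_apply]
  rw [e1, e2] at h
  exact h

theorem setIntegral_orthant_eq (k : ι) (lam : ι → ℝ) {F : (ι → ℝ) → ℝ}
    (hF : IntegrableOn F (orthant lam)) :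
    ∫ z in orthant lam, F z =
      ∫ w in orthant (del k lam), ∫ t in Set.Ioi (lam k), F (ins k w t) := by
  have h := (measurePreserving_splitAt k).setIntegral_preimage_emb
    (splitAt k).measurableEmbedding (F ∘ (splitAt k).symm)
    (orthant (del k lam) ×ˢ Set.Ioi (lam k))
  have e2 : F ∘ (splitAt k).symm = fun p => F (ins k p.1 p.2) := by
    funext p; rw [Function.comp_apply, splitAt_symm_apply]
  have e3 : ∀ z, (F ∘ (splitAt k).symm) (splitAt k z) = F z := fun z => by simp
  simp_rw [e3] at h
  rw [splitAt_preimage, e2, ← Measure.prod_restrict] at h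
  rw [h, integral_prod _ ((integrableOn_orthant_iff k lam F).1 hF)]

/-- An integrable derivative forces a limit at infinity, and a single sequence identifies it. Thus
no pointwise bound valid along the whole ray is needed. -/
theorem tendsto_zero_of_subseq {f f' : ℝ → ℝ} {a : ℝ} (hf : ∀ x, HasDerivAt f (f' x) x)
    (hint : IntegrableOn f' (Set.Ioi a)) {u : ℕ → ℝ} (hu : Filter.Tendsto u Filter.atTop Filter.atTop)
    (hlim : Filter.Tendsto (fun n => f (u n)) Filter.atTop (nhds 0)) :
    Filter.Tendsto f Filter.atTop (nhds 0) := by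
  have h := tendsto_limUnder_of_hasDerivAt_of_integrableOn_Ioi (fun x _ => hf x) hint
  rwa [tendsto_nhds_unique (h.comp hu) hlim] at h

/-- Integration of a partial derivative over an orthant. -/
theorem setIntegral_orthant_deriv (k : ι) (lam : ι → ℝ) {F F' : (ι → ℝ) → ℝ}
    (hder : ∀ w t, HasDerivAt (fun t => F (ins k w t)) (F' (ins k w t)) t)
    (hint : IntegrableOn F' (orthant lam))
    (hlim : ∀ w, ∃ u : ℕ → ℝ, Filter.Tendsto u Filter.atTop Filter.atTop ∧
      Filter.Tendsto (fun n => F (ins k w (u n))) Filter.atTop (nhds 0)) :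
    ∫ z in orthant lam, F' z = -∫ w in orthant (del k lam), F (ins k w (lam k)) := by
  rw [setIntegral_orthant_eq k lam hint, ← integral_neg]
  refine integral_congr_ae ?_
  -- By Fubini almost every line parallel to the `k`-th axis carries an integrable derivative, so
  -- the one-dimensional fundamental theorem applies there.
  filter_upwards [((integrableOn_orthant_iff k lam F').1 hint).prod_right_ae] with w hw
  obtain ⟨u, hu, hu0⟩ := hlim w
  have := integral_Ioi_of_hasDerivAt_of_tendsto' (fun t _ => hder w t) hw
    (tendsto_zero_of_subseq (hder w) hw hu hu0)
  rw [this, zero_sub]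

/-- A nonnegative function `φ` on a half-line is integrable when `ψ - φ` has a nonnegative
antiderivative and `ψ` is integrable. -/
theorem integrableOn_Ioi_of_hasDerivAt_sub {u φ ψ : ℝ → ℝ} {a : ℝ}
    (hu : ∀ x, HasDerivAt u (ψ x - φ x) x) (hu0 : ∀ x, 0 ≤ u x)
    (hφ0 : ∀ x, a < x → 0 ≤ φ x) (hφc : Continuous φ) (hψc : Continuous ψ)
    (hψ : IntegrableOn ψ (Set.Ioi a)) :
    IntegrableOn φ (Set.Ioi a) ∧
      ∫ x in Set.Ioi a, ‖φ x‖ ≤ u a + ∫ x in Set.Ioi a, ‖ψ x‖ := by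
  -- The fundamental theorem gives `∫ φ = ∫ ψ + u a - u b` on `[a,b]`; dropping `u b ≥ 0` makes the
  -- bound uniform in `b`.
  have hbound : ∀ b, a ≤ b → ∫ x in a..b, ‖φ x‖ ≤ u a + ∫ x in Set.Ioi a, ‖ψ x‖ := by
    intro b hab
    have h1 : ∫ x in a..b, ‖φ x‖ = ∫ x in a..b, φ x :=
      intervalIntegral.integral_congr_ae (Filter.Eventually.of_forall fun x hx => by
        rw [Set.uIoc_of_le hab] at hx
        exact Real.norm_of_nonneg (hφ0 x hx.1))
    have h2 := intervalIntegral.integral_eq_sub_of_hasDerivAt (a := a) (b := b)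
      (fun x _ => hu x) ((hψc.sub hφc).intervalIntegrable a b)
    rw [intervalIntegral.integral_sub (hψc.intervalIntegrable a b) (hφc.intervalIntegrable a b)]
      at h2
    have h3 : ∫ x in a..b, ψ x ≤ ∫ x in Set.Ioi a, ‖ψ x‖ := by
      calc ∫ x in a..b, ψ x ≤ ∫ x in a..b, ‖ψ x‖ :=
            intervalIntegral.integral_mono_on hab (hψc.intervalIntegrable a b)
              (hψc.norm.intervalIntegrable a b) fun x _ => le_abs_self _
        _ = ∫ x in Set.Ioc a b, ‖ψ x‖ := intervalIntegral.integral_of_le hab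
        _ ≤ ∫ x in Set.Ioi a, ‖ψ x‖ :=
            setIntegral_mono_set hψ.norm (Filter.Eventually.of_forall fun x => norm_nonneg _)
              (Filter.Eventually.of_forall fun x hx => hx.1)
    have := hu0 b
    linarith
  have hI : IntegrableOn φ (Set.Ioi a) :=
    integrableOn_Ioi_of_intervalIntegral_norm_bounded (u a + ∫ x in Set.Ioi a, ‖ψ x‖) a
      (b := id) (l := Filter.atTop) (fun b => (hφc.integrableOn_Icc).mono_set Set.Ioc_subset_Icc_self)
      Filter.tendsto_id (by
        filter_upwards [Filter.eventually_ge_atTop a] with b hb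
        exact hbound b hb)
  refine ⟨hI, ?_⟩
  have ht := intervalIntegral_tendsto_integral_Ioi a hI.norm Filter.tendsto_id
  refine le_of_tendsto ht ?_
  filter_upwards [Filter.eventually_ge_atTop a] with b hb
  exact hbound b hb

/-- The one-dimensional estimate bounds the `L¹` norm of each slice of `φ` by the boundary value of
`u` plus the slice norm of `ψ`. Both are integrable over the face, so Tonelli yields integrability
on the orthant. -/
theorem integrableOn_orthant_of_hasDerivAt_sub (k : ι) (lam : ι → ℝ) {u φ ψ : (ι → ℝ) → ℝ}
    (hu : ∀ w t, HasDerivAt (fun t => u (ins k w t)) (ψ (ins k w t) - φ (ins k w t)) t)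
    (hu0 : ∀ z, 0 ≤ u z) (hφ0 : ∀ z, lam k < z k → 0 ≤ φ z) (hφc : Continuous φ)
    (hψc : Continuous ψ) (hψ : IntegrableOn ψ (orthant lam))
    (hbd : IntegrableOn (fun w => u (ins k w (lam k))) (orthant (del k lam))) :
    IntegrableOn φ (orthant lam) := by
  have hψ' := (integrableOn_orthant_iff k lam ψ).1 hψ
  have hae : ∀ᵐ w ∂volume.restrict (orthant (del k lam)),
      IntegrableOn (fun t => φ (ins k w t)) (Set.Ioi (lam k)) ∧
      ∫ t in Set.Ioi (lam k), ‖φ (ins k w t)‖ ≤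
        u (ins k w (lam k)) + ∫ t in Set.Ioi (lam k), ‖ψ (ins k w t)‖ := by
    filter_upwards [hψ'.prod_right_ae] with w hw
    exact integrableOn_Ioi_of_hasDerivAt_sub (hu w) (fun t => hu0 _)
      (fun t ht => hφ0 _ (by simpa using ht)) (hφc.comp (continuous_ins k w))
      (hψc.comp (continuous_ins k w)) hw
  have hmeas : Measurable fun p : ({l : ι // l ≠ k} → ℝ) × ℝ => φ (ins k p.1 p.2) := by
    have : (fun p : ({l : ι // l ≠ k} → ℝ) × ℝ => φ (ins k p.1 p.2)) =
        φ ∘ (splitAt k).symm := by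
      funext p; rw [Function.comp_apply, splitAt_symm_apply]
    rw [this]
    exact hφc.measurable.comp (splitAt k).symm.measurable
  rw [integrableOn_orthant_iff k, integrable_prod_iff hmeas.aestronglyMeasurable]
  refine ⟨hae.mono fun w hw => hw.1, ?_⟩
  refine (hbd.add hψ'.norm.integral_prod_left).mono'
    hmeas.norm.aestronglyMeasurable.integral_prod_right' ?_
  filter_upwards [hae] with w hw
  rw [Real.norm_of_nonneg (integral_nonneg fun _ => norm_nonneg _)]
  exact hw.2

end splitting

/-! ### Partial integration against powers of `b + |z|² / m` -/

/-- On every non-vertical ray `K` stays bounded along a sequence tending to infinity. -/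
def SeqBounded (K : ℝ → ℝ) : Prop :=
  ∀ a c : ℝ, ∃ (B : ℝ) (u : ℕ → ℝ), Filter.Tendsto u Filter.atTop Filter.atTop ∧
    ∀ n, |K (c + a * u n)| ≤ B

theorem SeqBounded.of_bounded {K : ℝ → ℝ} {B : ℝ} (h : ∀ x, |K x| ≤ B) : SeqBounded K :=
  fun _ _ => ⟨B, fun n => n, tendsto_natCast_atTop_atTop, fun _ => h _⟩

/-- Along a ray with slope `a ≠ 0`, the mean value theorem on `[n, n+1]` gives a point where the
derivative of the bounded function is at most `2B`. This controls boundary terms containing `H'`,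
which may itself be unbounded. -/
theorem SeqBounded.deriv {K K' : ℝ → ℝ} {B : ℝ} (h : ∀ x, |K x| ≤ B)
    (hK : ∀ x, HasDerivAt K (K' x) x) : SeqBounded K' := by
  intro a c
  by_cases ha : a = 0
  · exact ⟨|K' c|, fun n => n, tendsto_natCast_atTop_atTop, fun n => by simp [ha]⟩
  have hder : ∀ t, HasDerivAt (fun t => K (c + a * t)) (K' (c + a * t) * a) t := by
    intro t
    have h1 : HasDerivAt (fun t => c + a * t) a t := by
      simpa using ((hasDerivAt_id t).const_mul a).const_add c
    exact (hK _).comp t h1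
  have hex : ∀ n : ℕ, ∃ t ∈ Set.Ioo (n : ℝ) (n + 1), |K' (c + a * t)| ≤ 2 * B / |a| := by
    intro n
    obtain ⟨t, ht, h2⟩ := exists_hasDerivAt_eq_slope (fun t => K (c + a * t))
      (fun t => K' (c + a * t) * a) (by linarith : (n : ℝ) < n + 1)
      (fun t _ => (hder t).continuousAt.continuousWithinAt) (fun t _ => hder t)
    refine ⟨t, ht, ?_⟩
    rw [add_sub_cancel_left, div_one] at h2
    rw [le_div_iff₀ (abs_pos.2 ha), ← abs_mul, h2]
    refine (abs_sub _ _).trans ?_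
    linarith [h (c + a * (n + 1)), h (c + a * n)]
  choose u hu hu2 using hex
  exact ⟨2 * B / |a|, u, Filter.tendsto_atTop_mono (fun n => (hu n).1.le)
    tendsto_natCast_atTop_atTop, hu2⟩

theorem integrable_mul_comp_dotProduct {ι : Type*} [Fintype ι] {K : ℝ → ℝ} (hK : Continuous K) {B : ℝ}
    (hB : ∀ x, |K x| ≤ B) (γ : ι → ℝ) (c : ℝ) {f : (ι → ℝ) → ℝ} (hf : Integrable f) :
    Integrable fun z => f z * K (c + γ ⬝ᵥ z) :=
  hf.mul_bdd (c := B)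
    (hK.comp (continuous_const.add (continuous_dotProduct_const γ))).aestronglyMeasurable
    (Filter.Eventually.of_forall fun _ => hB _)

section parts

variable {ι : Type*} [Fintype ι] [DecidableEq ι] {m b : ℝ}

/-- Freezing a coordinate moves its square into `b`. This is why `b` is a parameter: the restriction
to a face stays in the same family. -/
theorem tPow_ins (p : ℝ) (k : ι) (w : {l : ι // l ≠ k} → ℝ) (t : ℝ) :
    tPow m b p (ins k w t) = tPow m (b + t ^ 2 / m) p w := by
  rw [tPow, tPow, ins_dotProduct_ins]
  congr 1
  ring

theorem hasDerivAt_tPow_ins (hm : 0 < m) (hb : 0 < b) (p : ℝ) (k : ι)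
    (w : {l : ι // l ≠ k} → ℝ) (t : ℝ) :
    HasDerivAt (fun t => tPow m b p (ins k w t))
      (-(2 * p / m) * (t * tPow m b (p + 1) (ins k w t))) t := by
  simp only [tPow, ins_dotProduct_ins]
  have h1 : HasDerivAt (fun t : ℝ => b + (w ⬝ᵥ w + t ^ 2) / m) (2 * t / m) t := by
    simpa using ((((hasDerivAt_id t).pow 2).const_add (w ⬝ᵥ w)).div_const m).const_add b
  have hpos : 0 < b + (w ⬝ᵥ w + t ^ 2) / m := by
    have := dotProduct_self_nonneg w
    positivity
  refine (h1.rpow_const (p := -p) (Or.inl hpos.ne')).congr_deriv ?_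
  rw [show -p - 1 = -(p + 1) by ring]
  ring

theorem tendsto_tPow_ins (hm : 0 < m) {p : ℝ} (hp : 0 < p) (k : ι)
    (w : {l : ι // l ≠ k} → ℝ) :
    Filter.Tendsto (fun t => tPow m b p (ins k w t)) Filter.atTop (nhds 0) := by
  simp only [tPow, ins_dotProduct_ins]
  refine (tendsto_rpow_neg_atTop hp).comp ?_
  refine Filter.tendsto_atTop_add_const_left _ _ (Filter.Tendsto.atTop_div_const hm ?_)
  exact Filter.tendsto_atTop_add_const_left _ _ (Filter.tendsto_pow_atTop two_ne_zero)

theorem tendsto_mul_tPow_ins (hm : 0 < m) (hb : 0 < b) {p : ℝ} (hp : 1 / 2 < p) (k : ι)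
    (w : {l : ι // l ≠ k} → ℝ) :
    Filter.Tendsto (fun t => t * tPow m b p (ins k w t)) Filter.atTop (nhds 0) := by
  have h := (tendsto_tPow_ins (b := b) hm (by linarith : 0 < p - 1 / 2) k w).const_mul (√m)
  rw [mul_zero] at h
  refine squeeze_zero_norm (fun t => ?_) h
  rw [norm_mul, Real.norm_eq_abs, Real.norm_of_nonneg (tPow_pos hm hb p _).le]
  simpa using abs_coord_mul_tPow_le hm hb p k (ins k w t)

theorem hasDerivAt_comp_dotProduct_ins {K K' : ℝ → ℝ} (hK : ∀ x, HasDerivAt K (K' x) x)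
    (γ : ι → ℝ) (c : ℝ) (k : ι) (w : {l : ι // l ≠ k} → ℝ) (t : ℝ) :
    HasDerivAt (fun t => K (c + γ ⬝ᵥ ins k w t)) (γ k * K' (c + γ ⬝ᵥ ins k w t)) t := by
  have h1 : HasDerivAt (fun t => c + γ ⬝ᵥ ins k w t) (γ k) t := by
    simp only [dotProduct_ins]
    simpa using (((hasDerivAt_id t).const_mul (γ k)).const_add (del k γ ⬝ᵥ w)).const_add c
  exact ((hK _).comp t h1).congr_deriv (mul_comm _ _)

theorem SeqBounded.exists_tendsto {K : ℝ → ℝ} (hK : SeqBounded K) (γ : ι → ℝ) (c : ℝ) (k : ι)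
    (w : {l : ι // l ≠ k} → ℝ) {f : ℝ → ℝ} (hf : Filter.Tendsto f Filter.atTop (nhds 0)) :
    ∃ u : ℕ → ℝ, Filter.Tendsto u Filter.atTop Filter.atTop ∧
      Filter.Tendsto (fun n => f (u n) * K (c + γ ⬝ᵥ ins k w (u n))) Filter.atTop (nhds 0) := by
  obtain ⟨B, u, hu, hB⟩ := hK (γ k) (c + del k γ ⬝ᵥ w)
  refine ⟨u, hu, ?_⟩
  have h := ((hf.comp hu).norm).mul_const B
  rw [norm_zero, zero_mul] at h
  refine squeeze_zero_norm (fun n => ?_) h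
  rw [norm_mul, dotProduct_ins, ← add_assoc]
  exact mul_le_mul_of_nonneg_left (hB n) (norm_nonneg _)

/-- Integration by parts in the coordinate `k` against a factor `q` that does not depend on it. -/
theorem setIntegral_orthant_coord_mul_tPow (hm : 0 < m) (hb : 0 < b) {p : ℝ} (hp : 0 < p)
    {K K' : ℝ → ℝ} (hK : ∀ x, HasDerivAt K (K' x) x) (hKb : SeqBounded K) (γ : ι → ℝ) (c : ℝ)
    (k : ι) (lam : ι → ℝ) (q : ({l : ι // l ≠ k} → ℝ) → ℝ)
    (h1 : IntegrableOn (fun z => q (del k z) * z k * tPow m b (p + 1) z * K (c + γ ⬝ᵥ z))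
      (orthant lam))
    (h2 : γ k ≠ 0 → IntegrableOn (fun z => q (del k z) * tPow m b p z * K' (c + γ ⬝ᵥ z))
      (orthant lam)) :
    2 * p / m * ∫ z in orthant lam, q (del k z) * z k * tPow m b (p + 1) z * K (c + γ ⬝ᵥ z) =
      (∫ w in orthant (del k lam), q w * tPow m b p (ins k w (lam k)) *
        K (c + γ ⬝ᵥ ins k w (lam k))) +
      γ k * ∫ z in orthant lam, q (del k z) * tPow m b p z * K' (c + γ ⬝ᵥ z) := by
  have h1' := h1.const_mul (2 * p / m)
  -- When `γ k = 0` the integrand is zero, so nothing has to be known about `K'`.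
  have h2' : IntegrableOn (fun z => γ k * (q (del k z) * tPow m b p z * K' (c + γ ⬝ᵥ z)))
      (orthant lam) := by
    by_cases hγ : γ k = 0
    · simp [hγ]
    · exact (h2 hγ).const_mul (γ k)
  have hder : ∀ w t, HasDerivAt
      (fun t => q (del k (ins k w t)) * tPow m b p (ins k w t) * K (c + γ ⬝ᵥ ins k w t))
      (γ k * (q (del k (ins k w t)) * tPow m b p (ins k w t) * K' (c + γ ⬝ᵥ ins k w t)) -
        2 * p / m * (q (del k (ins k w t)) * ins k w t k * tPow m b (p + 1) (ins k w t) *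
          K (c + γ ⬝ᵥ ins k w t))) t := by
    intro w t
    simp only [del_ins, ins_self]
    refine (((hasDerivAt_tPow_ins hm hb p k w t).const_mul (q w)).mul
      (hasDerivAt_comp_dotProduct_ins hK γ c k w t)).congr_deriv ?_
    ring
  have h := setIntegral_orthant_deriv (F := fun z => q (del k z) * tPow m b p z * K (c + γ ⬝ᵥ z))
    (F' := fun z => γ k * (q (del k z) * tPow m b p z * K' (c + γ ⬝ᵥ z)) -
      2 * p / m * (q (del k z) * z k * tPow m b (p + 1) z * K (c + γ ⬝ᵥ z)))
    k lam hder (h2'.sub h1') (fun w => by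
      simp only [del_ins]
      refine hKb.exists_tendsto γ c k w (f := fun t => q w * tPow m b p (ins k w t)) ?_
      simpa using (tendsto_tPow_ins (b := b) hm hp k w).const_mul (q w))
  rw [integral_sub h2' h1', integral_const_mul, integral_const_mul] at h
  simp only [del_ins] at h
  linarith

/-- Integration by parts in the coordinate `k` against the same coordinate. -/
theorem setIntegral_orthant_coord_sq_mul_tPow (hm : 0 < m) (hb : 0 < b) {p : ℝ} (hp : 1 / 2 < p)
    {K K' : ℝ → ℝ} (hK : ∀ x, HasDerivAt K (K' x) x) (hKb : SeqBounded K) (γ : ι → ℝ) (c : ℝ)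
    (k : ι) (lam : ι → ℝ)
    (h0 : IntegrableOn (fun z => tPow m b p z * K (c + γ ⬝ᵥ z)) (orthant lam))
    (h1 : IntegrableOn (fun z => z k * z k * tPow m b (p + 1) z * K (c + γ ⬝ᵥ z)) (orthant lam))
    (h2 : γ k ≠ 0 → IntegrableOn (fun z => z k * tPow m b p z * K' (c + γ ⬝ᵥ z))
      (orthant lam)) :
    2 * p / m * ∫ z in orthant lam, z k * z k * tPow m b (p + 1) z * K (c + γ ⬝ᵥ z) =
      lam k * (∫ w in orthant (del k lam), tPow m b p (ins k w (lam k)) *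
        K (c + γ ⬝ᵥ ins k w (lam k))) +
      (∫ z in orthant lam, tPow m b p z * K (c + γ ⬝ᵥ z)) +
      γ k * ∫ z in orthant lam, z k * tPow m b p z * K' (c + γ ⬝ᵥ z) := by
  have h1' := h1.const_mul (2 * p / m)
  have h2' : IntegrableOn (fun z => γ k * (z k * tPow m b p z * K' (c + γ ⬝ᵥ z)))
      (orthant lam) := by
    by_cases hγ : γ k = 0
    · simp [hγ]
    · exact (h2 hγ).const_mul (γ k)
  have hder : ∀ w t, HasDerivAt
      (fun t => ins k w t k * tPow m b p (ins k w t) * K (c + γ ⬝ᵥ ins k w t))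
      (tPow m b p (ins k w t) * K (c + γ ⬝ᵥ ins k w t) +
        γ k * (ins k w t k * tPow m b p (ins k w t) * K' (c + γ ⬝ᵥ ins k w t)) -
        2 * p / m * (ins k w t k * ins k w t k * tPow m b (p + 1) (ins k w t) *
          K (c + γ ⬝ᵥ ins k w t))) t := by
    intro w t
    simp only [ins_self]
    refine (((hasDerivAt_id t).mul (hasDerivAt_tPow_ins hm hb p k w t)).mul
      (hasDerivAt_comp_dotProduct_ins hK γ c k w t)).congr_deriv ?_
    simp only [id, Pi.mul_apply]
    ring
  have h := setIntegral_orthant_deriv (F := fun z => z k * tPow m b p z * K (c + γ ⬝ᵥ z))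
    (F' := fun z => tPow m b p z * K (c + γ ⬝ᵥ z) +
      γ k * (z k * tPow m b p z * K' (c + γ ⬝ᵥ z)) -
      2 * p / m * (z k * z k * tPow m b (p + 1) z * K (c + γ ⬝ᵥ z)))
    k lam hder ((h0.add h2').sub h1') (fun w => by
      simp only [ins_self]
      exact hKb.exists_tendsto γ c k w (tendsto_mul_tPow_ins hm hb hp k w))
  have h02 : IntegrableOn (fun z => tPow m b p z * K (c + γ ⬝ᵥ z) +
      γ k * (z k * tPow m b p z * K' (c + γ ⬝ᵥ z))) (orthant lam) := h0.add h2'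
  rw [integral_sub h02 h1', integral_add h0 h2', integral_const_mul,
    integral_const_mul] at h
  simp only [ins_self, mul_assoc] at h
  rw [integral_const_mul] at h
  simp only [mul_assoc]
  linarith

/-- Absolute integrability of `z_k (b + |z|² / m)^{-p-1} K(c + γᵀz)` on an orthant. -/
theorem integrableOn_coord_mul_tPow_mul (hm : 0 < m) (hb : 0 < b) {p : ℝ} (hp : 0 < p)
    {K K' : ℝ → ℝ} (hK : ∀ x, HasDerivAt K (K' x) x) (hK' : Continuous K') (γ : ι → ℝ) (c : ℝ)
    (k : ι) (lam : ι → ℝ) (h0 : IntegrableOn (tPow m b (p + 1)) (orthant lam))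
    (h1 : IntegrableOn (fun z => tPow m b (p + 1) z * K (c + γ ⬝ᵥ z)) (orthant lam))
    (h2 : IntegrableOn (fun z => tPow m b p z * K' (c + γ ⬝ᵥ z)) (orthant lam))
    (h3 : IntegrableOn (fun w => tPow m b p (ins k w (lam k))) (orthant (del k lam)))
    (h4 : IntegrableOn (fun w => tPow m b p (ins k w (lam k)) * K (c + γ ⬝ᵥ ins k w (lam k)))
      (orthant (del k lam))) :
    IntegrableOn (fun z => z k * tPow m b (p + 1) z * K (c + γ ⬝ᵥ z)) (orthant lam) := by
  -- `N` is a positive differentiable majorant of `|K|` whose derivative `K K' / N` is at most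
  -- `|K'|` in absolute value. It replaces `|K|`, which may fail to be differentiable at zeros of
  -- `K`.
  set N : ℝ → ℝ := fun x => √(1 + K x ^ 2) with hN
  have hpos : ∀ x, 0 < 1 + K x ^ 2 := fun x => by positivity
  have hN0 : ∀ x, 0 < N x := fun x => Real.sqrt_pos.2 (hpos x)
  have hKN : ∀ x, |K x| ≤ N x := fun x => Real.abs_le_sqrt (by linarith)
  have hN1 : ∀ x, N x ≤ 1 + |K x| := fun x => by
    refine Real.sqrt_le_iff.2 ⟨by positivity, ?_⟩
    nlinarith [abs_nonneg (K x), sq_abs (K x)]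
  have hKc : Continuous K := continuous_iff_continuousAt.2 fun x => (hK x).continuousAt
  have hNc : Continuous N := by rw [hN]; fun_prop
  have hdot : Continuous fun z : ι → ℝ => c + γ ⬝ᵥ z :=
    continuous_const.add (continuous_dotProduct_const γ)
  have hNd : ∀ x, HasDerivAt N (K x * K' x / N x) x := fun x => by
    have := (((hK x).pow 2).const_add 1).sqrt (hpos x).ne'
    refine this.congr_deriv ?_
    simp only [hN, Nat.cast_ofNat, Nat.add_one_sub_one, pow_one, Pi.pow_apply]
    rw [mul_assoc, mul_div_mul_left _ _ two_ne_zero]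
  have hRc := fun p : ℝ => continuous_tPow (ι := ι) hm hb p
  have hRp := fun (p : ℝ) (z : ι → ℝ) => tPow_pos hm hb p z
  have h5 : IntegrableOn (fun z => tPow m b (p + 1) z * N (c + γ ⬝ᵥ z)) (orthant lam) := by
    refine (h0.add h1.norm).mono' ((hRc _).mul (hNc.comp hdot)).aestronglyMeasurable
      (Filter.Eventually.of_forall fun z => ?_)
    have := mul_le_mul_of_nonneg_left (hN1 (c + γ ⬝ᵥ z)) (hRp (p + 1) z).le
    simp only [Pi.add_apply, norm_mul, Real.norm_of_nonneg (hRp _ z).le, Real.norm_eq_abs,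
      abs_of_pos (hN0 _), abs_of_pos (hRp _ _)]
    linarith
  have h6 : IntegrableOn (fun z => tPow m b p z * (K (c + γ ⬝ᵥ z) * K' (c + γ ⬝ᵥ z) /
      N (c + γ ⬝ᵥ z))) (orthant lam) := by
    refine h2.norm.mono' ((hRc _).mul (((hKc.comp hdot).mul (hK'.comp hdot)).div
      (hNc.comp hdot) fun z => (hN0 _).ne')).aestronglyMeasurable
      (Filter.Eventually.of_forall fun z => ?_)
    rw [norm_mul, norm_mul]
    refine mul_le_mul_of_nonneg_left ?_ (norm_nonneg _)
    rw [norm_div, norm_mul, Real.norm_of_nonneg (hN0 _).le, div_le_iff₀ (hN0 _), mul_comm]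
    exact mul_le_mul_of_nonneg_left (hKN _) (norm_nonneg _)
  have h7 : IntegrableOn (fun w => tPow m b p (ins k w (lam k)) * N (c + γ ⬝ᵥ ins k w (lam k)))
      (orthant (del k lam)) := by
    have hins : Continuous fun w : {l : ι // l ≠ k} → ℝ => ins k w (lam k) := by
      refine continuous_pi fun l => ?_
      by_cases h : l = k
      · subst h; simpa using continuous_const
      · simpa [ins_of_ne h] using continuous_apply _
    refine (h3.add h4.norm).mono'
      (((hRc _).mul (hNc.comp hdot)).comp hins).aestronglyMeasurable
      (Filter.Eventually.of_forall fun w => ?_)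
    have := mul_le_mul_of_nonneg_left (hN1 (c + γ ⬝ᵥ ins k w (lam k)))
      (hRp p (ins k w (lam k))).le
    simp only [Pi.add_apply, norm_mul, Real.norm_of_nonneg (hRp _ _).le, Real.norm_eq_abs,
      abs_of_pos (hN0 _)]
    linarith
  -- The derivative of `tPow m b p * N` contains `-(2p/m) z_k`, whose sign is not fixed if `lam k <
  -- 0`. Adding `|lam k|` to `z_k` makes `φ` nonnegative above `lam k`; the compensating term in `ψ`
  -- is integrable by `h5`.
  have hφ := integrableOn_orthant_of_hasDerivAt_sub k lam
    (u := fun z => tPow m b p z * N (c + γ ⬝ᵥ z))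
    (φ := fun z => 2 * p / m * ((z k + |lam k|) * (tPow m b (p + 1) z * N (c + γ ⬝ᵥ z))))
    (ψ := fun z => 2 * p / m * |lam k| * (tPow m b (p + 1) z * N (c + γ ⬝ᵥ z)) +
      γ k * (tPow m b p z * (K (c + γ ⬝ᵥ z) * K' (c + γ ⬝ᵥ z) / N (c + γ ⬝ᵥ z))))
    (fun w t => by
      refine ((hasDerivAt_tPow_ins hm hb p k w t).mul
        (hasDerivAt_comp_dotProduct_ins hNd γ c k w t)).congr_deriv ?_
      simp only [ins_self]
      ring)
    (fun z => (mul_pos (hRp _ z) (hN0 _)).le)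
    (fun z hz => by
      have h : 0 ≤ z k + |lam k| := by linarith [neg_abs_le (lam k)]
      have := hRp (p + 1) z
      have := hN0 (c + γ ⬝ᵥ z)
      positivity)
    (continuous_const.mul (((continuous_apply k).add continuous_const).mul
      ((hRc _).mul (hNc.comp hdot))))
    ((continuous_const.mul ((hRc _).mul (hNc.comp hdot))).add (continuous_const.mul
      ((hRc _).mul (((hKc.comp hdot).mul (hK'.comp hdot)).div (hNc.comp hdot)
        fun z => (hN0 _).ne'))))
    ((h5.const_mul _).add (h6.const_mul _)) h7
  refine ((hφ.const_mul (m / (2 * p))).add (h5.const_mul |lam k|)).mono'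
    (((continuous_apply k).mul (hRc _)).mul (hKc.comp hdot)).aestronglyMeasurable ?_
  refine (ae_restrict_iff' (measurableSet_orthant lam)).2 (Filter.Eventually.of_forall
    fun z hz => ?_)
  have hz' : lam k < z k := hz k
  -- On the orthant `z k + |lam k|` is nonnegative, so `|z k|` is recovered at the cost of another
  -- multiple of the integrable `h5`.
  have h8 : |z k| ≤ (z k + |lam k|) + |lam k| := by
    rcases abs_cases (z k) with h | h <;> rcases abs_cases (lam k) with h' | h' <;> linarith
  have h9 : m / (2 * p) * (2 * p / m * ((z k + |lam k|) * (tPow m b (p + 1) z * N (c + γ ⬝ᵥ z)))) =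
      (z k + |lam k|) * (tPow m b (p + 1) z * N (c + γ ⬝ᵥ z)) := by
    field_simp
  simp only [Pi.add_apply]
  rw [norm_mul, norm_mul, Real.norm_of_nonneg (hRp _ z).le, Real.norm_eq_abs, Real.norm_eq_abs,
    h9, ← add_mul, mul_assoc]
  exact mul_le_mul h8 (mul_le_mul_of_nonneg_left (hKN _) (hRp _ z).le)
    (mul_nonneg (hRp _ z).le (abs_nonneg _)) ((abs_nonneg _).trans h8)

end parts

/-! ### First and second tail moments -/

section reindex

theorem setIntegral_orthant_reindex {α β : Type*} [Fintype α] [Fintype β] (e : α ≃ β)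
    (t : β → ℝ) (f : (β → ℝ) → ℝ) :
    ∫ y in orthant t, f y = ∫ x in orthant fun a => t (e a), f fun b => x (e.symm b) := by
  have hmp := volume_measurePreserving_piCongrLeft (fun _ : β => ℝ) e
  have happ : ∀ x : α → ℝ, MeasurableEquiv.piCongrLeft (fun _ : β => ℝ) e x =
      fun b => x (e.symm b) := by
    intro x
    funext b
    obtain ⟨a, rfl⟩ := e.surjective b
    rw [MeasurableEquiv.piCongrLeft_apply_apply, e.symm_apply_apply]
  have h := hmp.setIntegral_preimage_emb (MeasurableEquiv.measurableEmbedding _) f (orthant t)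
  have hpre : MeasurableEquiv.piCongrLeft (fun _ : β => ℝ) e ⁻¹' orthant t =
      orthant fun a => t (e a) := by
    ext x
    rw [Set.mem_preimage, happ]
    exact ⟨fun h a => by simpa using h (e a), fun h b => by simpa using h (e.symm b)⟩
  rw [hpre] at h
  simp_rw [happ] at h
  exact h.symm

variable {n : ℕ}

/-- Deleting `i` and then `j` is deleting both. -/
def dropDrop {i j : Fin n} (hij : j ≠ i) :
    {l : {l : Fin n // l ≠ i} // l ≠ ⟨j, hij⟩} ≃ Drop2 i j where
  toFun l := ⟨l.1.1, l.1.2, fun h => l.2 (Subtype.ext h)⟩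
  invFun l := ⟨⟨l.1, l.2.1⟩, fun h => l.2.2 (congrArg Subtype.val h)⟩
  left_inv _ := rfl
  right_inv _ := rfl

theorem insert1_eq_ins (k : Fin n) (lam : Fin n → ℝ) (w : Drop1 k → ℝ) :
    insert1 k lam w = ins k w (lam k) := by
  funext l
  by_cases h : l = k
  · subst h; simp [insert1]
  · simp [insert1, ins_of_ne h, h]

theorem insert2_dropDrop {i j : Fin n} (hij : j ≠ i) (lam : Fin n → ℝ)
    (x : {l : {l : Fin n // l ≠ i} // l ≠ ⟨j, hij⟩} → ℝ) :
    insert2 i j lam (fun b => x ((dropDrop hij).symm b)) =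
      ins i (ins ⟨j, hij⟩ x (lam j)) (lam i) := by
  funext l
  by_cases hi : l = i
  · subst hi; simp [insert2]
  · rw [ins_of_ne hi]
    by_cases hj : l = j
    · subst hj; simp [insert2]
    · rw [ins_of_ne fun h => hj (congrArg Subtype.val h)]
      simp [insert2, hi, hj, dropDrop]

end reindex

section moments

variable {n : ℕ}

/-- The integral of `(1 + |z|² / m)^{-p} K(γᵀz)` over the orthant above `lam`. -/
def tailInt (m p : ℝ) (γ lam : Fin n → ℝ) (K : ℝ → ℝ) : ℝ :=
  ∫ z in orthant lam, tPow m 1 p z * K (γ ⬝ᵥ z)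

/-- The integral of `(1 + |z|² / m)^{-p} K(γᵀz)` over the face `z_k = lam_k` of the orthant. -/
def faceInt (m p : ℝ) (γ lam : Fin n → ℝ) (k : Fin n) (K : ℝ → ℝ) : ℝ :=
  ∫ w in orthant (drop1 k lam), tPow m 1 p (insert1 k lam w) * K (γ ⬝ᵥ insert1 k lam w)

/-- The integral of `(1 + |z|² / m)^{-p} K(γᵀz)` over the edge `z_i = lam_i`, `z_j = lam_j`. -/
def edgeInt (m p : ℝ) (γ lam : Fin n → ℝ) (i j : Fin n) (K : ℝ → ℝ) : ℝ :=
  ∫ u in orthant (drop2 i j lam), tPow m 1 p (insert2 i j lam u) * K (γ ⬝ᵥ insert2 i j lam u)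

/-- A bounded `C²` function together with its first two derivatives. -/
structure BddTwiceDiff (H H' H'' : ℝ → ℝ) (B : ℝ) : Prop where
  bdd : ∀ x, |H x| ≤ B
  deriv : ∀ x, HasDerivAt H (H' x) x
  deriv' : ∀ x, HasDerivAt H' (H'' x) x
  cont : Continuous H''

/-- Integrability of the derivative terms over the orthant above `lam` and over its faces. -/
structure TailIntegrable (m ρ : ℝ) (γ lam : Fin n → ℝ) (H' H'' : ℝ → ℝ) : Prop where
  first : IntegrableOn (fun z => tPow m 1 (ρ - 1) z * H' (γ ⬝ᵥ z)) (orthant lam)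
  face : ∀ k, IntegrableOn (fun w => tPow m 1 (ρ - 2) (insert1 k lam w) *
    H' (γ ⬝ᵥ insert1 k lam w)) (orthant (drop1 k lam))
  second : IntegrableOn (fun z => tPow m 1 (ρ - 2) z * H'' (γ ⬝ᵥ z)) (orthant lam)
  coord : ∀ k, IntegrableOn (fun z => z k * tPow m 1 (ρ - 1) z * H' (γ ⬝ᵥ z)) (orthant lam)

variable {m ρ B : ℝ} {γ lam : Fin n → ℝ} {H H' H'' : ℝ → ℝ}

theorem BddTwiceDiff.continuous (hH : BddTwiceDiff H H' H'' B) : Continuous H :=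
  continuous_iff_continuousAt.2 fun x => (hH.deriv x).continuousAt

theorem BddTwiceDiff.continuous' (hH : BddTwiceDiff H H' H'' B) : Continuous H' :=
  continuous_iff_continuousAt.2 fun x => (hH.deriv' x).continuousAt

/-- Integration by parts with `p = ρ - 1` and trivial factor `q`. The boundary term at infinity
vanishes since `H` is bounded. -/
theorem tailInt_coord (hm : 2 < m) (hρ : 2 * ρ = m + n) (hH : BddTwiceDiff H H' H'' B)
    (hI : TailIntegrable m ρ γ lam H' H'') (k : Fin n) :
    2 * (ρ - 1) / m * ∫ z in orthant lam, z k * tPow m 1 ρ z * H (γ ⬝ᵥ z) =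
      faceInt m (ρ - 1) γ lam k H + γ k * tailInt m (ρ - 1) γ lam H' := by
  have hn : (0 : ℝ) ≤ n := n.cast_nonneg
  have hm0 : 0 < m := by linarith
  have hint := integrable_mul_comp_dotProduct hH.continuous hH.bdd γ 0
    (integrable_coord_mul_tPow (ι := Fin n) hm0 one_pos (p := ρ)
      (by rw [Fintype.card_fin]; linarith) k)
  have h := setIntegral_orthant_coord_mul_tPow hm0 one_pos (p := ρ - 1) (by linarith) hH.deriv
    (SeqBounded.of_bounded hH.bdd) γ 0 k lam (fun _ => 1)
    (by simpa only [one_mul, sub_add_cancel] using hint.integrableOn)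
    (fun _ => by simpa only [one_mul, zero_add] using hI.first)
  simp only [one_mul, zero_add, sub_add_cancel] at h
  rw [h, faceInt, tailInt]
  simp only [insert1_eq_ins]
  rfl

/-- The same integration by parts one power lower, with `H'` in the role of `H`. Boundedness along a
sequence replaces boundedness of `H'`. -/
theorem tailInt_coord_deriv (hm : 2 < m) (hρ : 2 * ρ = m + n) (hn : 2 ≤ n)
    (hH : BddTwiceDiff H H' H'' B) (hI : TailIntegrable m ρ γ lam H' H'') (k : Fin n) :
    2 * (ρ - 2) / m * ∫ z in orthant lam, z k * tPow m 1 (ρ - 1) z * H' (γ ⬝ᵥ z) =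
      faceInt m (ρ - 2) γ lam k H' + γ k * tailInt m (ρ - 2) γ lam H'' := by
  have hn : (2 : ℝ) ≤ n := by exact_mod_cast hn
  have e : ρ - 2 + 1 = ρ - 1 := by ring
  have h := setIntegral_orthant_coord_mul_tPow (by linarith : 0 < m) one_pos (p := ρ - 2)
    (by linarith) hH.deriv' (SeqBounded.deriv hH.bdd hH.deriv) γ 0 k lam (fun _ => 1)
    (by simpa only [one_mul, zero_add, e] using hI.coord k)
    (fun _ => by simpa only [one_mul, zero_add] using hI.second)
  simp only [one_mul, zero_add, e] at h
  rw [h, faceInt, tailInt]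
  simp only [insert1_eq_ins]
  rfl

/-- On the face `z_i = lam_i` the weight has `b = 1 + lam_i²/m` and the argument of `H` has the
offset `γ_i lam_i`. The general integration by parts, applied in dimension `n - 1`, therefore
produces the edge. -/
theorem faceInt_coord (hm : 2 < m) (hρ : 2 * ρ = m + n) (hn : 2 ≤ n)
    (hH : BddTwiceDiff H H' H'' B) (hI : TailIntegrable m ρ γ lam H' H'') {i j : Fin n}
    (hij : j ≠ i) :
    2 * (ρ - 2) / m * ∫ w in orthant (del i lam), w ⟨j, hij⟩ *
        tPow m 1 (ρ - 1) (ins i w (lam i)) * H (γ ⬝ᵥ ins i w (lam i)) =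
      edgeInt m (ρ - 2) γ lam i j H + γ j * faceInt m (ρ - 2) γ lam i H' := by
  have hn' : (2 : ℝ) ≤ n := by exact_mod_cast hn
  have hm0 : 0 < m := by linarith
  have e : ρ - 2 + 1 = ρ - 1 := by ring
  have hb : 0 < 1 + lam i ^ 2 / m := by positivity
  have hc : (Fintype.card {l : Fin n // l ≠ i} : ℝ) = n - 1 := by
    rw [card_drop1, Nat.cast_sub (by omega), Nat.cast_one]
  have e2 : ∀ w : {l : Fin n // l ≠ i} → ℝ,
      γ ⬝ᵥ ins i w (lam i) = γ i * lam i + del i γ ⬝ᵥ w := fun w => by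
    rw [dotProduct_ins, add_comm]
  have hint := integrable_mul_comp_dotProduct hH.continuous hH.bdd (del i γ) (γ i * lam i)
    (integrable_coord_mul_tPow (ι := {l : Fin n // l ≠ i}) hm0 hb (p := ρ - 1)
      (by rw [hc]; linarith) ⟨j, hij⟩)
  have hface := hI.face i
  simp only [insert1_eq_ins, tPow_ins, e2] at hface
  have h := setIntegral_orthant_coord_mul_tPow hm0 hb (p := ρ - 2)
    (by linarith) hH.deriv (SeqBounded.of_bounded hH.bdd) (del i γ) (γ i * lam i) ⟨j, hij⟩
    (del i lam) (fun _ => 1)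
    (by simpa only [one_mul, e] using hint.integrableOn)
    (fun _ => by simp only [one_mul]; exact hface)
  simp only [one_mul, e] at h
  have hedge : edgeInt m (ρ - 2) γ lam i j H =
      ∫ x in orthant (del (⟨j, hij⟩ : {l : Fin n // l ≠ i}) (del i lam)),
        tPow m (1 + lam i ^ 2 / m) (ρ - 2) (ins (⟨j, hij⟩ : {l : Fin n // l ≠ i}) x (lam j)) *
          H (γ i * lam i + del i γ ⬝ᵥ ins (⟨j, hij⟩ : {l : Fin n // l ≠ i}) x (lam j)) := by
    rw [edgeInt, setIntegral_orthant_reindex (dropDrop hij)]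
    simp only [insert2_dropDrop, tPow_ins (ρ - 2) i, e2]
    rfl
  rw [hedge, faceInt]
  simp only [insert1_eq_ins, tPow_ins _ i, e2]
  exact h

/-- Integrating by parts in `z_i` leaves `z_j` as a passive factor. The face term is then resolved
by `faceInt_coord` and the interior term by `tailInt_coord_deriv`, both in the direction `j`. -/
theorem tailInt_coord_mul_coord (hm : 2 < m) (hρ : 2 * ρ = m + n) (hn : 2 ≤ n)
    (hH : BddTwiceDiff H H' H'' B) (hI : TailIntegrable m ρ γ lam H' H'') {i j : Fin n}
    (hij : i ≠ j) :
    2 * (ρ - 1) / m * (2 * (ρ - 2) / m) *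
        ∫ z in orthant lam, z i * z j * tPow m 1 ρ z * H (γ ⬝ᵥ z) =
      edgeInt m (ρ - 2) γ lam i j H + γ j * faceInt m (ρ - 2) γ lam i H' +
        γ i * faceInt m (ρ - 2) γ lam j H' + γ i * γ j * tailInt m (ρ - 2) γ lam H'' := by
  have hn' : (2 : ℝ) ≤ n := by exact_mod_cast hn
  have hm0 : 0 < m := by linarith
  have hint := integrable_mul_comp_dotProduct hH.continuous hH.bdd γ 0
    (integrable_coord_mul_coord_mul_tPow (ι := Fin n) hm0 one_pos (p := ρ)
      (by rw [Fintype.card_fin]; linarith) j i)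
  have h := setIntegral_orthant_coord_mul_tPow hm0 one_pos (p := ρ - 1) (by linarith) hH.deriv
    (SeqBounded.of_bounded hH.bdd) γ 0 i lam (fun w => w ⟨j, hij.symm⟩)
    (by simpa only [del, sub_add_cancel] using hint.integrableOn)
    (fun _ => by simpa only [del, zero_add] using hI.coord j)
  simp only [zero_add, sub_add_cancel] at h
  have h1 := tailInt_coord_deriv hm hρ hn hH hI j
  have h2 := faceInt_coord hm hρ hn hH hI hij.symm
  simp only [del] at h
  have hcomm : ∀ z : Fin n → ℝ, z i * z j = z j * z i := fun z => mul_comm _ _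
  simp only [hcomm]
  rw [mul_comm (2 * (ρ - 1) / m), mul_assoc, h, mul_add, mul_left_comm _ (γ i), h1]
  change 2 * (ρ - 2) / m * (∫ w in orthant (del i lam), w ⟨j, hij.symm⟩ *
    tPow m 1 (ρ - 1) (ins i w (lam i)) * H (γ ⬝ᵥ ins i w (lam i))) + _ = _
  rw [h2]
  ring

/-- Differentiation now also hits the remaining factor `z_i`. This yields the additional integral of
`H` with power `ρ - 1`, the source of the `Z*` term, while the face carries the constant factor `lam
i`. -/
theorem tailInt_coord_sq (hm : 2 < m) (hρ : 2 * ρ = m + n) (hn : 2 ≤ n)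
    (hH : BddTwiceDiff H H' H'' B) (hI : TailIntegrable m ρ γ lam H' H'') (i : Fin n) :
    2 * (ρ - 1) / m * (2 * (ρ - 2) / m) *
        ∫ z in orthant lam, z i * z i * tPow m 1 ρ z * H (γ ⬝ᵥ z) =
      2 * (ρ - 2) / m * (lam i * faceInt m (ρ - 1) γ lam i H + tailInt m (ρ - 1) γ lam H) +
        γ i * faceInt m (ρ - 2) γ lam i H' + γ i ^ 2 * tailInt m (ρ - 2) γ lam H'' := by
  have hn' : (2 : ℝ) ≤ n := by exact_mod_cast hn
  have hm0 : 0 < m := by linarith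
  have hint := integrable_mul_comp_dotProduct hH.continuous hH.bdd γ 0
    (integrable_coord_mul_coord_mul_tPow (ι := Fin n) hm0 one_pos (p := ρ)
      (by rw [Fintype.card_fin]; linarith) i i)
  have hint0 := integrable_mul_comp_dotProduct hH.continuous hH.bdd γ 0
    (integrable_tPow (ι := Fin n) hm0 one_pos (p := ρ - 1)
      (by rw [Fintype.card_fin]; linarith))
  have h := setIntegral_orthant_coord_sq_mul_tPow hm0 one_pos (p := ρ - 1) (by linarith) hH.deriv
    (SeqBounded.of_bounded hH.bdd) γ 0 i lam hint0.integrableOn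
    (by simpa only [sub_add_cancel] using hint.integrableOn)
    (fun _ => by simpa only [zero_add] using hI.coord i)
  simp only [zero_add, sub_add_cancel] at h
  have h1 := tailInt_coord_deriv hm hρ hn hH hI i
  have hf : faceInt m (ρ - 1) γ lam i H = ∫ w in orthant (del i lam),
      tPow m 1 (ρ - 1) (ins i w (lam i)) * H (γ ⬝ᵥ ins i w (lam i)) := by
    rw [faceInt]
    simp only [insert1_eq_ins]
    rfl
  rw [mul_comm (2 * (ρ - 1) / m), mul_assoc, h, hf, tailInt]
  rw [mul_add, mul_left_comm _ (γ i), h1]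
  ring

/-- Only the field `coord` has to be produced, by the majorant argument for `H'`. The pure weight on
a face is integrable because `m + n - 4 > n - 1`, which is where `m > 3` enters. -/
theorem tailIntegrable_of_integrableOn (hm : 3 < m) (hρ : 2 * ρ = m + n) (hn : 2 ≤ n)
    (hH : BddTwiceDiff H H' H'' B)
    (h1 : IntegrableOn (fun z => tPow m 1 (ρ - 1) z * H' (γ ⬝ᵥ z)) (orthant lam))
    (h2 : ∀ k, IntegrableOn (fun w => tPow m 1 (ρ - 2) (insert1 k lam w) *
      H' (γ ⬝ᵥ insert1 k lam w)) (orthant (drop1 k lam)))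
    (h3 : IntegrableOn (fun z => tPow m 1 (ρ - 2) z * H'' (γ ⬝ᵥ z)) (orthant lam)) :
    TailIntegrable m ρ γ lam H' H'' := by
  refine ⟨h1, h2, h3, fun k => ?_⟩
  have hn' : (2 : ℝ) ≤ n := by exact_mod_cast hn
  have hm0 : 0 < m := by linarith
  have hb : 0 < 1 + lam k ^ 2 / m := by positivity
  have e : ρ - 2 + 1 = ρ - 1 := by ring
  have hc : (Fintype.card {l : Fin n // l ≠ k} : ℝ) = n - 1 := by
    rw [card_drop1, Nat.cast_sub (by omega), Nat.cast_one]
  have h4 := h2 k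
  simp only [insert1_eq_ins] at h4
  have h := integrableOn_coord_mul_tPow_mul hm0 one_pos (p := ρ - 2) (by linarith) hH.deriv'
    hH.cont γ 0 k lam (integrable_tPow hm0 one_pos
      (by rw [Fintype.card_fin, e]; linarith)).integrableOn
    (by simpa only [zero_add, e] using h1) (by simpa only [zero_add] using h3)
    (by
      simp only [tPow_ins]
      exact (integrable_tPow hm0 hb (by rw [hc]; linarith)).integrableOn)
    (by simp only [zero_add]; exact h4)
  simpa only [zero_add, e] using h

end moments

/-! ### Tail moments in terms of the Student densities -/

section translate

variable {n : ℕ} {m : ℝ} {γ lam : Fin n → ℝ}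

theorem G1_half_eq (hm : 0 < m) (h : 2 < m + n) {ι : Type*} [Fintype ι] (z : ι → ℝ) :
    G1 n m (1 / 2 * (z ⬝ᵥ z)) = m / (m + n - 2) * tPow m 1 ((m + n) / 2 - 1) z := by
  have hz := dotProduct_self_nonneg z
  rw [G1_eq hm h (by positivity), tPow, show (m + n - 2) / 2 = (m + n) / 2 - 1 by ring]
  congr 3
  ring

theorem G2_half_eq (hm : 0 < m) (h : 4 < m + n) {ι : Type*} [Fintype ι] (z : ι → ℝ) :
    G2 n m (1 / 2 * (z ⬝ᵥ z)) =
      m / (m + n - 2) * (m / (m + n - 4)) * tPow m 1 ((m + n) / 2 - 2) z := by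
  have hz := dotProduct_self_nonneg z
  rw [G2_eq hm h (by positivity), tPow, show (m + n - 4) / 2 = (m + n) / 2 - 2 by ring]
  congr 3
  ring

theorem insert1_dotProduct_insert1 (k : Fin n) (w : Drop1 k → ℝ) :
    insert1 k lam w ⬝ᵥ insert1 k lam w = w ⬝ᵥ w + lam k ^ 2 := by
  rw [insert1_eq_ins, ins_dotProduct_ins]

theorem insert2_dotProduct_insert2 {i j : Fin n} (hij : i ≠ j) (u : Drop2 i j → ℝ) :
    insert2 i j lam u ⬝ᵥ insert2 i j lam u = u ⬝ᵥ u + lam i ^ 2 + lam j ^ 2 := by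
  have h := insert2_dropDrop hij.symm lam fun a => u (dropDrop hij.symm a)
  simp only [Equiv.apply_symm_apply] at h
  rw [h, ins_dotProduct_ins, ins_dotProduct_ins]
  have : (fun a => u (dropDrop hij.symm a)) ⬝ᵥ (fun a => u (dropDrop hij.symm a)) = u ⬝ᵥ u :=
    Equiv.sum_comp (dropDrop hij.symm) fun b => u b * u b
  rw [this]
  ring

theorem cW_pos (hn : 2 ≤ n) (hm : 1 < m) (a : ℝ) : 0 < cW n m a := by
  have hn' : (2 : ℝ) ≤ n := by exact_mod_cast hn
  have hm0 : 0 < m := by linarith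
  have h2 : 0 < m + n - 2 := by linarith
  have := Real.Gamma_pos_of_pos (half_pos h2)
  have := Real.Gamma_pos_of_pos (half_pos (by linarith : 0 < m - 1))
  have := Real.pi_pos
  rw [cW_eq hn hm]
  positivity

theorem cV_pos (hn : 2 ≤ n) (hm : 3 < m) (a : ℝ) : 0 < cV n m a := by
  have hn' : (2 : ℝ) ≤ n := by exact_mod_cast hn
  have hm0 : 0 < m := by linarith
  have h2 : 0 < m + n - 2 := by linarith
  have h4 : 0 < m + n - 4 := by linarith
  have := Real.Gamma_pos_of_pos (half_pos h4)
  have := Real.Gamma_pos_of_pos (half_pos (by linarith : 0 < m - 3))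
  have := Real.pi_pos
  rw [cV_eq hn hm]
  positivity

theorem cU_pos (hn : 2 ≤ n) (hm : 2 < m) (a b : ℝ) : 0 < cU n m a b := by
  have hn' : (2 : ℝ) ≤ n := by exact_mod_cast hn
  have hm0 : 0 < m := by linarith
  have h2 : 0 < m + n - 2 := by linarith
  have h4 : 0 < m + n - 4 := by linarith
  have := Real.Gamma_pos_of_pos (half_pos h4)
  have := Real.Gamma_pos_of_pos (half_pos (by linarith : 0 < m - 2))
  have := Real.pi_pos
  rw [cU_eq hn hm]
  positivity

theorem stW_eq_tPow (hn : 2 ≤ n) (hm : 1 < m) (k : Fin n) (w : Drop1 k → ℝ) :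
    stW m lam k w = cW n m (lam k) * (m / (m + n - 2) *
      tPow m 1 ((m + n) / 2 - 1) (insert1 k lam w)) := by
  have hn' : (2 : ℝ) ≤ n := by exact_mod_cast hn
  rw [← fW_eq_stW hn hm, fW, ← G1_half_eq (by linarith) (by linarith),
    insert1_dotProduct_insert1, mul_add]

theorem stV_eq_tPow (hn : 2 ≤ n) (hm : 3 < m) (k : Fin n) (v : Drop1 k → ℝ) :
    stV m lam k v = cV n m (lam k) * (m / (m + n - 2) * (m / (m + n - 4)) *
      tPow m 1 ((m + n) / 2 - 2) (insert1 k lam v)) := by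
  have hn' : (2 : ℝ) ≤ n := by exact_mod_cast hn
  rw [← fV_eq_stV hn hm, fV, ← G2_half_eq (by linarith) (by linarith),
    insert1_dotProduct_insert1, mul_add]

theorem stU_eq_tPow (hn : 2 ≤ n) (hm : 2 < m) {i j : Fin n} (hij : i ≠ j) (u : Drop2 i j → ℝ) :
    stU m lam i j u = cU n m (lam i) (lam j) * (m / (m + n - 2) * (m / (m + n - 4)) *
      tPow m 1 ((m + n) / 2 - 2) (insert2 i j lam u)) := by
  have hn' : (2 : ℝ) ≤ n := by exact_mod_cast hn
  rw [← fU_eq_stU hn hm lam hij, fU, ← G2_half_eq (by linarith) (by linarith),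
    insert2_dotProduct_insert2 hij, mul_add, mul_add]

theorem ellPDF_G1_eq_tPow (hn : 2 ≤ n) (hm : 0 < m) (z : Fin n → ℝ) :
    ellPDF 0 1 (G1 n m) z =
      c1 n m * (m / (m + n - 2) * tPow m 1 ((m + n) / 2 - 1) z) := by
  have hn' : (2 : ℝ) ≤ n := by exact_mod_cast hn
  rw [ellPDF_zero_one, Fintype.card_fin, G1_half_eq hm (by linarith), c1]

theorem ellPDF_G2_eq_tPow (hn : 2 ≤ n) (hm : 2 < m) (z : Fin n → ℝ) :
    ellPDF 0 1 (G2 n m) z = c2 n m * (m / (m + n - 2) * (m / (m + n - 4)) *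
      tPow m 1 ((m + n) / 2 - 2) z) := by
  have hn' : (2 : ℝ) ≤ n := by exact_mod_cast hn
  rw [ellPDF_zero_one, Fintype.card_fin, G2_half_eq (by linarith) (by linarith), c2]

/-- The law of `W` is the first cumulative profile restricted to a face and normalized by `cW`, so
`cW` cancels. The integrands agree pointwise, which allows arbitrary `K`. -/
theorem tailExp_stW (hn : 2 ≤ n) (hm : 1 < m) (k : Fin n) (K : ℝ → ℝ) :
    c0 n m / cW n m (lam k) *
        tailExp (stW m lam k) (drop1 k lam) (fun w => K (γ ⬝ᵥ insert1 k lam w)) =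
      c0 n m * (m / (m + n - 2)) * faceInt m ((m + n) / 2 - 1) γ lam k K := by
  have hc := (cW_pos hn hm (lam k)).ne'
  rw [tailExp, faceInt, ← integral_const_mul, ← integral_const_mul]
  congr 1
  funext w
  rw [stW_eq_tPow hn hm]
  field_simp

theorem tailExp_stV (hn : 2 ≤ n) (hm : 3 < m) (k : Fin n) (K : ℝ → ℝ) :
    c0 n m / cV n m (lam k) *
        tailExp (stV m lam k) (drop1 k lam) (fun v => K (γ ⬝ᵥ insert1 k lam v)) =
      c0 n m * (m / (m + n - 2) * (m / (m + n - 4))) *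
        faceInt m ((m + n) / 2 - 2) γ lam k K := by
  have hc := (cV_pos hn hm (lam k)).ne'
  rw [tailExp, faceInt, ← integral_const_mul, ← integral_const_mul]
  congr 1
  funext w
  rw [stV_eq_tPow hn hm]
  field_simp

theorem tailExp_stU (hn : 2 ≤ n) (hm : 2 < m) {i j : Fin n} (hij : i ≠ j) (K : ℝ → ℝ) :
    c0 n m / cU n m (lam i) (lam j) *
        tailExp (stU m lam i j) (drop2 i j lam) (fun u => K (γ ⬝ᵥ insert2 i j lam u)) =
      c0 n m * (m / (m + n - 2) * (m / (m + n - 4))) *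
        edgeInt m ((m + n) / 2 - 2) γ lam i j K := by
  have hc := (cU_pos hn hm (lam i) (lam j)).ne'
  rw [tailExp, edgeInt, ← integral_const_mul, ← integral_const_mul]
  congr 1
  funext w
  rw [stU_eq_tPow hn hm hij]
  field_simp

theorem tailExp_ellPDF_G2 (hn : 2 ≤ n) (hm : 4 < m) (K : ℝ → ℝ) :
    m ^ 2 / ((m - 2) * (m - 4)) *
        tailExp (ellPDF 0 1 (G2 n m)) lam (fun x => K (γ ⬝ᵥ x)) =
      c0 n m * (m / (m + n - 2) * (m / (m + n - 4))) *
        tailInt m ((m + n) / 2 - 2) γ lam K := by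
  have hc := (c2_pos (n := n) hm).ne'
  rw [← c0_div_c2 (n := n) hm, tailExp, tailInt, ← integral_const_mul, ← integral_const_mul]
  congr 1
  funext w
  rw [ellPDF_G2_eq_tPow hn (by linarith)]
  field_simp

theorem tailFn_gsePDF_G1 (hn : 2 ≤ n) (hm : 2 < m) (K : ℝ → ℝ) :
    m / (m - 2) * tailFn (gsePDF 0 1 (G1 n m) (fun z => K (γ ⬝ᵥ z))) lam =
      2 * c0 n m * (m / (m + n - 2)) * tailInt m ((m + n) / 2 - 1) γ lam K := by
  have hc := (c1_pos (n := n) hm).ne'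
  rw [← c0_div_c1 (n := n) hm, tailFn, tailInt, ← integral_const_mul, ← integral_const_mul]
  congr 1
  funext w
  rw [gsePDF, ellPDF_G1_eq_tPow hn (by linarith), msqrt_one, inv_one, one_mulVec, sub_zero]
  field_simp

theorem one_add_mul_tPow (hm : 0 < m) (p : ℝ) (z : Fin n → ℝ) :
    (1 + z ⬝ᵥ z / m) * tPow m 1 p z = tPow m 1 (p - 1) z := by
  have hpos := tPow_base_pos hm one_pos z
  rw [tPow, tPow, show -(p - 1) = 1 + -p by ring, Real.rpow_add hpos, Real.rpow_one]

/-- The factor `1 + |z|²/m` lowers the power from `ρ` to `ρ - 1`, so the expectation under the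
Student law already has the form left by one integration by parts. -/
theorem tailExp_stPDF (hm : 0 < m) (K : ℝ → ℝ) :
    tailExp (stPDF 0 1 m) lam (fun z => (1 + z ⬝ᵥ z / m) * K (γ ⬝ᵥ z)) =
      c0 n m * tailInt m ((m + n) / 2 - 1) γ lam K := by
  rw [tailExp, tailInt, ← integral_const_mul]
  congr 1
  funext z
  rw [stPDF_zero_one (Fintype.card_fin n) hm, ← one_add_mul_tPow hm]
  ring

end translate

/-! ### Conditional tail mean and covariance in terms of interior, face and edge integrals. -/

section tailMoments

variable {S : Type*} [MeasurableSpace S] {P : Measure S} [IsProbabilityMeasure P] {n : ℕ} {m B : ℝ}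
  {γ lam : Fin n → ℝ} {H H' H'' : ℝ → ℝ} {Z : S → Fin n → ℝ}

theorem setIntegral_mul_gsstPDF (hm : 0 < m) (φ : (Fin n → ℝ) → ℝ) :
    ∫ z in orthant lam, φ z * gsstPDF 0 1 γ m H z =
      2 * c0 n m * ∫ z in orthant lam, φ z * tPow m 1 ((m + n) / 2) z * H (γ ⬝ᵥ z) := by
  rw [← integral_const_mul]
  congr 1
  funext z
  rw [gsstPDF_zero_one hm]
  ring

theorem MTCE_eq (hm : 2 < m) (hH : BddTwiceDiff H H' H'' B) (hH0 : ∀ x, 0 ≤ H x)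
    (hI : TailIntegrable m ((m + n) / 2) γ lam H' H'')
    (h : HasDensity P Z (gsstPDF 0 1 γ m H)) (k : Fin n) (hn : 2 ≤ n) :
    MTCE P Z lam k = 1 / tailFn (gsstPDF 0 1 γ m H) lam * (2 * c0 n m * (m / (m + n - 2)) *
      (faceInt m ((m + n) / 2 - 1) γ lam k H + γ k * tailInt m ((m + n) / 2 - 1) γ lam H')) := by
  have hn' : (2 : ℝ) ≤ n := by exact_mod_cast hn
  have hm0 : 0 < m := by linarith
  have h2 : 0 < m + n - 2 := by linarith
  have key := tailInt_coord hm (by ring) hH hI k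
  rw [MTCE, condMean, h.integral_cond (measurable_gsstPDF hm0 hH.continuous.measurable)
    (gsstPDF_nonneg hm0 hH0) lam (φ := fun z => z k) (by fun_prop), setIntegral_mul_gsstPDF hm0,
    ← key]
  field_simp

theorem MTCov_eq_sub (hm : 2 < m) (hH : BddTwiceDiff H H' H'' B) (hH0 : ∀ x, 0 ≤ H x)
    (h : HasDensity P Z (gsstPDF 0 1 γ m H)) (hpos : 0 < tailFn (gsstPDF 0 1 γ m H) lam)
    (i j : Fin n) :
    MTCov P Z lam i j = 1 / tailFn (gsstPDF 0 1 γ m H) lam * (2 * c0 n m *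
      ∫ z in orthant lam, z i * z j * tPow m 1 ((m + n) / 2) z * H (γ ⬝ᵥ z)) -
        MTCE P Z lam i * MTCE P Z lam j := by
  have hm0 : 0 < m := by linarith
  have hmeas := measurable_gsstPDF (n := n) (γ := γ) hm0 hH.continuous.measurable
  have hA : P {s | ∀ i, lam i < Z s i} ≠ 0 := by
    intro h0
    rw [← h.real_preimage_orthant hmeas (gsstPDF_nonneg hm0 hH0) lam, Measure.real, h0] at hpos
    simp at hpos
  have hmem := memLp_two_of_hasDensity hm hH.continuous.measurable hH0
    (fun x => (le_abs_self _).trans (hH.bdd x)) h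
  rw [MTCov, condCov_apply_eq_sub hA hmem, h.integral_cond hmeas (gsstPDF_nonneg hm0 hH0) lam
    (φ := fun z => z i * z j) (by fun_prop), setIntegral_mul_gsstPDF hm0]
  rfl

theorem MTCov_eq_of_ne (hm : 2 < m) (hn : 2 ≤ n) (hH : BddTwiceDiff H H' H'' B)
    (hH0 : ∀ x, 0 ≤ H x) (hI : TailIntegrable m ((m + n) / 2) γ lam H' H'')
    (h : HasDensity P Z (gsstPDF 0 1 γ m H)) (hpos : 0 < tailFn (gsstPDF 0 1 γ m H) lam)
    {i j : Fin n} (hij : i ≠ j) :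
    MTCov P Z lam i j = 2 / tailFn (gsstPDF 0 1 γ m H) lam *
      (c0 n m * (m / (m + n - 2) * (m / (m + n - 4))) *
        (edgeInt m ((m + n) / 2 - 2) γ lam i j H +
        γ j * faceInt m ((m + n) / 2 - 2) γ lam i H' +
        γ i * faceInt m ((m + n) / 2 - 2) γ lam j H' +
        γ i * γ j * tailInt m ((m + n) / 2 - 2) γ lam H'')) -
        MTCE P Z lam i * MTCE P Z lam j := by
  have hn' : (2 : ℝ) ≤ n := by exact_mod_cast hn
  have hm0 : 0 < m := by linarith
  have h2 : 0 < m + n - 2 := by linarith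
  have h4 : 0 < m + n - 4 := by linarith
  have key := tailInt_coord_mul_coord hm (by ring) hn hH hI hij
  rw [MTCov_eq_sub hm hH hH0 h hpos, ← key]
  have e1 : 2 * ((m + n) / 2 - 1) / m = (m + n - 2) / m := by ring
  have e2 : 2 * ((m + n) / 2 - 2) / m = (m + n - 4) / m := by ring
  rw [e1, e2]
  field_simp

theorem MTCov_eq_self (hm : 2 < m) (hn : 2 ≤ n) (hH : BddTwiceDiff H H' H'' B)
    (hH0 : ∀ x, 0 ≤ H x) (hI : TailIntegrable m ((m + n) / 2) γ lam H' H'')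
    (h : HasDensity P Z (gsstPDF 0 1 γ m H)) (hpos : 0 < tailFn (gsstPDF 0 1 γ m H) lam)
    (i : Fin n) :
    MTCov P Z lam i i = 2 / tailFn (gsstPDF 0 1 γ m H) lam *
      (c0 n m * (m / (m + n - 2)) * (lam i * faceInt m ((m + n) / 2 - 1) γ lam i H) +
        c0 n m * (m / (m + n - 2) * (m / (m + n - 4))) *
        (γ i * faceInt m ((m + n) / 2 - 2) γ lam i H' +
        γ i ^ 2 * tailInt m ((m + n) / 2 - 2) γ lam H'')) +
      2 * c0 n m * (m / (m + n - 2)) * tailInt m ((m + n) / 2 - 1) γ lam H /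
        tailFn (gsstPDF 0 1 γ m H) lam - MTCE P Z lam i ^ 2 := by
  have hn' : (2 : ℝ) ≤ n := by exact_mod_cast hn
  have hm0 : 0 < m := by linarith
  have h2 : 0 < m + n - 2 := by linarith
  have h4 : 0 < m + n - 4 := by linarith
  have key := tailInt_coord_sq hm (by ring) hn hH hI i
  have e1 : 2 * ((m + n) / 2 - 1) / m = (m + n - 2) / m := by ring
  have e2 : 2 * ((m + n) / 2 - 2) / m = (m + n - 4) / m := by ring
  rw [e1, e2] at key
  rw [MTCov_eq_sub hm hH hH0 h hpos, ← sq (MTCE P Z lam i)]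
  congr 1
  have key' : ∫ z in orthant lam, z i * z i * tPow m 1 ((m + n) / 2) z * H (γ ⬝ᵥ z) =
      m / (m + n - 2) * (m / (m + n - 4)) * ((m + n - 4) / m *
        (lam i * faceInt m ((m + n) / 2 - 1) γ lam i H + tailInt m ((m + n) / 2 - 1) γ lam H) +
        γ i * faceInt m ((m + n) / 2 - 2) γ lam i H' +
        γ i ^ 2 * tailInt m ((m + n) / 2 - 2) γ lam H'') := by
    rw [← key]
    field_simp
  rw [key']
  field_simp
  ring

end tailMoments

/-! ### The one-dimensional Student distribution function -/

section student

variable {m : ℝ}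

theorem tPDF_base_pos (hm : 0 < m) (x : ℝ) : 0 < 1 + x ^ 2 / m := by positivity

theorem tPDF_pos (hm : 0 < m) (x : ℝ) : 0 < tPDF m x := by
  have := Real.Gamma_pos_of_pos (half_pos hm)
  have := Real.Gamma_pos_of_pos (half_pos (by linarith : 0 < m + 1))
  have := Real.pi_pos
  have := tPDF_base_pos hm x
  unfold tPDF
  positivity

theorem hasDerivAt_tPDF (hm : 0 < m) (x : ℝ) :
    HasDerivAt (tPDF m) (-(m + 1) / m * ((1 + x ^ 2 / m)⁻¹ * x * tPDF m x)) x := by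
  have h1 : HasDerivAt (fun x : ℝ => 1 + x ^ 2 / m) (2 * x / m) x := by
    simpa using (((hasDerivAt_id x).pow 2).div_const m).const_add 1
  have hpos := tPDF_base_pos hm x
  refine ((h1.rpow_const (p := -(m + 1) / 2) (Or.inl hpos.ne')).const_mul
    (Real.Gamma ((m + 1) / 2) / (Real.Gamma (m / 2) * √(m * Real.pi)))).congr_deriv ?_
  rw [tPDF, Real.rpow_sub hpos, Real.rpow_one]
  ring

theorem continuous_tPDF (hm : 0 < m) : Continuous (tPDF m) :=
  continuous_iff_continuousAt.2 fun x => (hasDerivAt_tPDF hm x).continuousAt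

theorem tPDF_le (hm : 0 < m) (x : ℝ) : tPDF m x ≤ tPDF m 0 := by
  have := Real.Gamma_pos_of_pos (half_pos hm)
  have := Real.Gamma_pos_of_pos (half_pos (by linarith : 0 < m + 1))
  have hx : 0 ≤ x ^ 2 / m := by positivity
  unfold tPDF
  refine mul_le_mul_of_nonneg_left ?_ (by positivity)
  refine Real.rpow_le_rpow_of_nonpos (by simp) ?_ (by linarith)
  simpa using hx

/-- Rescaling by `√m` reduces the density to a multiple of `(1 + x²)^(-(m+1)/2)`. -/
theorem integrable_tPDF (hm : 0 < m) : Integrable (tPDF m) := by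
  have h := integrable_rpow_neg_one_add_norm_sq (E := ℝ) (μ := volume) (r := m + 1)
    (by simpa using hm)
  have h2 := (h.comp_div (Real.sqrt_pos.2 hm).ne').const_mul
    (Real.Gamma ((m + 1) / 2) / (Real.Gamma (m / 2) * √(m * Real.pi)))
  refine h2.congr (Filter.Eventually.of_forall fun x => ?_)
  simp only [tPDF, norm_div, Real.norm_eq_abs, div_pow, sq_abs, Real.sq_sqrt hm.le]

theorem hasDerivAt_tCDF (hm : 0 < m) (x : ℝ) : HasDerivAt (tCDF m) (tPDF m x) x := by
  have hint := integrable_tPDF hm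
  have e : tCDF m = fun x => tCDF m 0 + ∫ s in (0 : ℝ)..x, tPDF m s := by
    funext y
    rw [tCDF, tCDF, ← intervalIntegral.integral_Iic_sub_Iic hint.integrableOn hint.integrableOn]
    ring
  rw [e]
  exact (intervalIntegral.integral_hasDerivAt_right hint.intervalIntegrable
    (continuous_tPDF hm).aestronglyMeasurable.stronglyMeasurableAtFilter
    (continuous_tPDF hm).continuousAt).const_add _

theorem tCDF_pos (hm : 0 < m) (x : ℝ) : 0 < tCDF m x := by
  rw [tCDF, setIntegral_pos_iff_support_of_nonneg_ae
    (Filter.Eventually.of_forall fun s => (tPDF_pos hm s).le) (integrable_tPDF hm).integrableOn]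
  have : Function.support (tPDF m) = Set.univ := by
    ext s
    simpa using (tPDF_pos hm s).ne'
  rw [this, Set.univ_inter]
  simp

theorem tCDF_le (hm : 0 < m) (x : ℝ) : tCDF m x ≤ ∫ s, tPDF m s :=
  setIntegral_le_integral (integrable_tPDF hm)
    (Filter.Eventually.of_forall fun s => (tPDF_pos hm s).le)

theorem abs_deriv_tPDF_le (hm : 0 < m) (x : ℝ) :
    |-(m + 1) / m * ((1 + x ^ 2 / m)⁻¹ * x * tPDF m x)| ≤ (m + 1) / m * (m + 1) * tPDF m 0 := by
  have hpos := tPDF_base_pos hm x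
  have h1 : |(1 + x ^ 2 / m)⁻¹ * x| ≤ m + 1 := by
    rw [abs_mul, abs_of_pos (inv_pos.2 hpos), inv_mul_le_iff₀ hpos]
    have h2 : (1 + x ^ 2 / m) * (m + 1) = m + 1 + x ^ 2 + x ^ 2 / m := by field_simp; ring
    have h3 : 0 ≤ x ^ 2 / m := by positivity
    rw [h2]
    -- The elementary bound `|x| ≤ (1 + x²)/2` suffices; no sharp constant is needed.
    nlinarith [sq_abs x, sq_nonneg (|x| - 1)]
  have h4 : |-(m + 1) / m| = (m + 1) / m := by
    rw [neg_div, abs_neg, abs_of_pos (by positivity)]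
  rw [abs_mul, abs_mul _ (tPDF m x), h4, abs_of_pos (tPDF_pos hm x), mul_assoc]
  refine mul_le_mul_of_nonneg_left ?_ (by positivity)
  exact mul_le_mul h1 (tPDF_le hm x) (tPDF_pos hm x).le (by positivity)

/-- Using the total mass of the density as the bound avoids evaluating it. -/
theorem bddTwiceDiff_tCDF (hm : 0 < m) : BddTwiceDiff (tCDF m) (tPDF m)
    (fun x => -(m + 1) / m * ((1 + x ^ 2 / m)⁻¹ * x * tPDF m x)) (∫ s, tPDF m s) where
  bdd x := by rw [abs_of_pos (tCDF_pos hm x)]; exact tCDF_le hm x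
  deriv := hasDerivAt_tCDF hm
  deriv' := hasDerivAt_tPDF hm
  cont := by
    have h := continuous_tPDF hm
    have h2 : Continuous fun x : ℝ => (1 + x ^ 2 / m)⁻¹ :=
      Continuous.inv₀ (by fun_prop) fun x => (tPDF_base_pos hm x).ne'
    fun_prop

end student

/-! ### Verification of the integrability conditions and positivity of the tail. -/

section conditions

variable {n : ℕ} {m B : ℝ} {γ lam : Fin n → ℝ} {H H' H'' : ℝ → ℝ}

/-- Bounded derivatives satisfy all integrability conditions when `m > 4`. -/
theorem tailIntegrable_of_bounded (hm : 4 < m) (hn : 2 ≤ n) (hH : BddTwiceDiff H H' H'' B)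
    {B' B'' : ℝ} (h' : ∀ x, |H' x| ≤ B') (h'' : ∀ x, |H'' x| ≤ B'') :
    TailIntegrable m ((m + n) / 2) γ lam H' H'' := by
  have hn' : (2 : ℝ) ≤ n := by exact_mod_cast hn
  have hm0 : 0 < m := by linarith
  refine tailIntegrable_of_integrableOn (by linarith) (by ring) hn hH ?_ (fun k => ?_) ?_
  · have := integrable_mul_comp_dotProduct hH.continuous' h' γ 0
      (integrable_tPow (ι := Fin n) hm0 one_pos (p := (m + n) / 2 - 1)
        (by rw [Fintype.card_fin]; linarith))
    simpa only [zero_add] using this.integrableOn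
  · have hb : 0 < 1 + lam k ^ 2 / m := by positivity
    have hc : (Fintype.card {l : Fin n // l ≠ k} : ℝ) = n - 1 := by
      rw [card_drop1, Nat.cast_sub (by omega), Nat.cast_one]
    have := integrable_mul_comp_dotProduct hH.continuous' h' (del k γ) (γ k * lam k)
      (integrable_tPow (ι := {l : Fin n // l ≠ k}) hm0 hb (p := (m + n) / 2 - 2)
        (by rw [hc]; linarith))
    simp only [insert1_eq_ins, tPow_ins, dotProduct_ins, add_comm (del k γ ⬝ᵥ _)]
    exact this.integrableOn
  · have := integrable_mul_comp_dotProduct hH.cont h'' γ 0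
      (integrable_tPow (ι := Fin n) hm0 one_pos (p := (m + n) / 2 - 2)
        (by rw [Fintype.card_fin]; linarith))
    simpa only [zero_add] using this.integrableOn

/-- For a constant skewing function all derivative terms vanish. This is what lets the symmetric
case run under `m > 2` alone. -/
theorem tailIntegrable_zero {ρ : ℝ} :
    TailIntegrable m ρ γ lam (fun _ => 0) (fun _ => 0) := by
  constructor <;> simp

theorem bddTwiceDiff_const (c : ℝ) :
    BddTwiceDiff (fun _ => c) (fun _ => 0) (fun _ => 0) |c| where
  bdd _ := le_rfl
  deriv x := hasDerivAt_const x c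
  deriv' x := hasDerivAt_const x 0
  cont := continuous_const

theorem IsSkewing.bddTwiceDiff (hH : IsSkewing H) (hC : ContDiff ℝ 2 H) :
    BddTwiceDiff H (deriv H) (deriv (deriv H)) 1 where
  bdd x := abs_le.2 ⟨by linarith [(hH.2.2 x).1], (hH.2.2 x).2⟩
  deriv x := (hC.differentiable (by norm_num) x).hasDerivAt
  deriv' x := ((((contDiff_succ_iff_deriv (n := 1)).1 hC).2.2).differentiable
    (by norm_num) x).hasDerivAt
  cont := (((contDiff_succ_iff_deriv (n := 1)).1 hC).2.2).continuous_deriv (by norm_num)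

theorem tailIntegrable_of_hasTailExp (hm : 4 < m) (hn : 2 ≤ n) (hH : BddTwiceDiff H H' H'' B)
    (h1 : HasTailExp (stPDF 0 1 m) lam (fun z => (1 + z ⬝ᵥ z / m) * H' (γ ⬝ᵥ z)))
    (h2 : ∀ k, HasTailExp (stV m lam k) (drop1 k lam) (fun v => H' (γ ⬝ᵥ insert1 k lam v)))
    (h3 : HasTailExp (ellPDF 0 1 (G2 n m)) lam (fun x => H'' (γ ⬝ᵥ x))) :
    TailIntegrable m ((m + n) / 2) γ lam H' H'' := by
  have hn' : (2 : ℝ) ≤ n := by exact_mod_cast hn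
  have hm0 : 0 < m := by linarith
  have hn2 : 0 < m + n - 2 := by linarith
  have hn4 : 0 < m + n - 4 := by linarith
  have hc0 := c0_pos (n := n) hm0
  have hc2 := c2_pos (n := n) hm
  refine tailIntegrable_of_integrableOn (by linarith) (by ring) hn hH ?_ (fun k => ?_) ?_
  · refine (h1.const_mul (c0 n m)⁻¹).congr (Filter.Eventually.of_forall fun z => ?_)
    simp only [stPDF_zero_one (Fintype.card_fin n) hm0, ← one_add_mul_tPow hm0 ((m + n) / 2)]
    field_simp
  · have hcV := cV_pos hn (by linarith : 3 < m) (lam k)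
    refine ((h2 k).const_mul (cV n m (lam k) * (m / (m + n - 2) * (m / (m + n - 4))))⁻¹).congr
      (Filter.Eventually.of_forall fun z => ?_)
    simp only [stV_eq_tPow hn (by linarith : 3 < m)]
    field_simp
  · refine (h3.const_mul (c2 n m * (m / (m + n - 2) * (m / (m + n - 4))))⁻¹).congr
      (Filter.Eventually.of_forall fun z => ?_)
    simp only [ellPDF_G2_eq_tPow hn (by linarith : 2 < m)]
    field_simp

theorem isOpen_orthant (t : Fin n → ℝ) : IsOpen (orthant t) := by
  have : orthant t = Set.univ.pi fun i => Set.Ioi (t i) := by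
    ext z; simp [orthant]
  rw [this]
  exact isOpen_set_pi Set.finite_univ fun i _ => isOpen_Ioi

/-- A strictly positive integrable density has positive mass on an orthant, which is open and
nonempty. Hence the Student cases hold for every threshold. -/
theorem tailFn_gsstPDF_pos (hm : 0 < m) (hH : Continuous H) (hB : ∀ x, |H x| ≤ B)
    (hH0 : ∀ x, 0 < H x) : 0 < tailFn (gsstPDF 0 1 γ m H) lam := by
  have hc := c0_pos (n := n) hm
  have hf : ∀ z : Fin n → ℝ, 0 < gsstPDF 0 1 γ m H z := fun z => by
    have := tPow_pos hm one_pos ((m + n) / 2) z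
    have := hH0 (γ ⬝ᵥ z)
    rw [gsstPDF_zero_one hm]
    positivity
  have hint : Integrable (gsstPDF (0 : Fin n → ℝ) 1 γ m H) := by
    have h := (integrable_mul_comp_dotProduct hH hB γ 0
      (integrable_tPow (ι := Fin n) hm one_pos (p := (m + n) / 2)
        (by rw [Fintype.card_fin]; linarith))).const_mul (2 * c0 n m)
    refine h.congr (Filter.Eventually.of_forall fun z => ?_)
    simp only [gsstPDF_zero_one hm, zero_add]
    ring
  rw [tailFn, setIntegral_pos_iff_support_of_nonneg_ae
    (Filter.Eventually.of_forall fun z => (hf z).le) hint.integrableOn]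
  have : Function.support (gsstPDF (0 : Fin n → ℝ) 1 γ m H) = Set.univ := by
    ext z
    simpa using (hf z).ne'
  rw [this, Set.univ_inter]
  exact (isOpen_orthant lam).measure_pos _ ⟨fun i => lam i + 1, fun i => by simp⟩

end conditions

end SkewStudent

end

/-! ### Assembly of the six statements. -/

open SkewStudent in
theorem mainTheorem3 {S : Type*} [MeasurableSpace S] (P : Measure S) [IsProbabilityMeasure P]
    (n : ℕ) (hn : 2 ≤ n) (m : ℝ) (hm : 0 < m)
    (μ γ : Fin n → ℝ) (Sig : Matrix (Fin n) (Fin n) ℝ) (hSig : Sig.PosDef)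
    (Y Z : S → Fin n → ℝ) (hZ : Z = fun s => standardize μ Sig (Y s)) :
    -- the density in generator form, cumulative generators and normalizing constants
    ((∀ H : ℝ → ℝ, gsstPDF μ Sig γ m H = gsePDF μ Sig (stGen n m) (fun z => H (γ ⬝ᵥ z))) ∧
      c0 n m = Real.Gamma ((m + n) / 2) /
        (Real.Gamma (m / 2) * (m * Real.pi) ^ ((n : ℝ) / 2)) ∧
      (∀ t : ℝ, 0 ≤ t →
        G1 n m t = m / (m + n - 2) * (1 + 2 * t / m) ^ (-(m + n - 2) / 2)) ∧
      (4 < m + n → ∀ t : ℝ, 0 ≤ t →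
        G2 n m t = m / (m + n - 2) * (m / (m + n - 4)) *
          (1 + 2 * t / m) ^ (-(m + n - 4) / 2)) ∧
      (2 < m →
        c1 n m = (m + n - 2) * Real.Gamma ((n : ℝ) / 2) / ((2 * Real.pi) ^ ((n : ℝ) / 2) * m) *
          (∫ t in Set.Ioi (0 : ℝ),
            t ^ ((n : ℝ) / 2 - 1) * (1 + 2 * t / m) ^ (-(m + n - 2) / 2))⁻¹ ∧
        c1 n m = (m + n - 2) * Real.Gamma ((n : ℝ) / 2) /
          ((m * Real.pi) ^ ((n : ℝ) / 2) * m * beta ((n : ℝ) / 2) ((m - 2) / 2)) ∧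
        c0 n m / c1 n m = m / (m - 2)) ∧
      (4 < m →
        c2 n m = (m + n - 2) * (m + n - 4) * Real.Gamma ((n : ℝ) / 2) /
            ((2 * Real.pi) ^ ((n : ℝ) / 2) * m ^ 2) *
          (∫ t in Set.Ioi (0 : ℝ),
            t ^ ((n : ℝ) / 2 - 1) * (1 + 2 * t / m) ^ (-(m + n - 4) / 2))⁻¹ ∧
        c2 n m = (m + n - 2) * (m + n - 4) * Real.Gamma ((n : ℝ) / 2) /
          ((m * Real.pi) ^ ((n : ℝ) / 2) * m ^ 2 * beta ((n : ℝ) / 2) ((m - 4) / 2)) ∧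
        c0 n m / c2 n m = m ^ 2 / ((m - 2) * (m - 4)))) ∧
    -- the vectors `W_{-k}`, `V_{-k}`, `U_{-ij}`
    (∀ lam : Fin n → ℝ,
      (1 < m → ∀ k,
        (∀ w : Drop1 k → ℝ, fW m lam k w = cW n m (lam k) * (m / (m + n - 2)) *
          (1 + lam k ^ 2 / m) ^ (-(m + n - 2) / 2) *
          (1 + w ⬝ᵥ ((scaleW m lam k)⁻¹ *ᵥ w) / (m - 1)) ^ (-(m + n - 2) / 2)) ∧
        fW m lam k = stW m lam k ∧
        cW n m (lam k) = Real.Gamma ((m + n - 2) / 2) * (m + n - 2) /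
          (Real.Gamma ((m - 1) / 2) * Real.pi ^ (((n : ℝ) - 1) / 2) * m ^ ((m + n) / 2)) *
          (m + lam k ^ 2) ^ ((m - 1) / 2) ∧
        c0 n m / cW n m (lam k) = Real.Gamma ((m - 1) / 2) * m ^ (m / 2) /
          (2 * Real.Gamma (m / 2) * √Real.pi) * (m + lam k ^ 2) ^ (-(m - 1) / 2)) ∧
      (3 < m → ∀ k,
        (∀ v : Drop1 k → ℝ, fV m lam k v = cV n m (lam k) *
          (m / (m + n - 2)) * (m / (m + n - 4)) *
          (1 + lam k ^ 2 / m) ^ (-(m + n - 4) / 2) *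
          (1 + v ⬝ᵥ ((scaleV m lam k)⁻¹ *ᵥ v) / (m - 3)) ^ (-(m + n - 4) / 2)) ∧
        fV m lam k = stV m lam k ∧
        cV n m (lam k) = Real.Gamma ((m + n - 4) / 2) * (m + n - 2) * (m + n - 4) /
          (Real.Gamma ((m - 3) / 2) * Real.pi ^ (((n : ℝ) - 1) / 2) * m ^ ((m + n) / 2)) *
          (m + lam k ^ 2) ^ ((m - 3) / 2) ∧
        c0 n m / cV n m (lam k) = Real.Gamma ((m - 3) / 2) * m ^ (m / 2) /
          (4 * Real.Gamma (m / 2) * √Real.pi) * (m + lam k ^ 2) ^ (-(m - 3) / 2)) ∧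
      (2 < m → ∀ i j, i ≠ j →
        (∀ u : Drop2 i j → ℝ, fU m lam i j u = cU n m (lam i) (lam j) *
          (m / (m + n - 2)) * (m / (m + n - 4)) *
          (1 + (lam i ^ 2 + lam j ^ 2) / m) ^ (-(m + n - 4) / 2) *
          (1 + u ⬝ᵥ ((scaleU m lam i j)⁻¹ *ᵥ u) / (m - 2)) ^ (-(m + n - 4) / 2)) ∧
        fU m lam i j = stU m lam i j ∧
        cU n m (lam i) (lam j) = Real.Gamma ((m + n - 4) / 2) * (m + n - 2) * (m + n - 4) /
          (Real.Gamma ((m - 2) / 2) * Real.pi ^ (((n : ℝ) - 2) / 2) * m ^ ((m + n) / 2)) *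
          (m + lam i ^ 2 + lam j ^ 2) ^ ((m - 2) / 2) ∧
        c0 n m / cU n m (lam i) (lam j) = m ^ (m / 2) / (2 * (m - 2) * Real.pi) *
          (m + lam i ^ 2 + lam j ^ 2) ^ (-(m - 2) / 2))) ∧
    -- the standardized vector `Z`, and the passage from `Z` to `Y`
    (∀ H : ℝ → ℝ, IsSkewing H → HasDensity P Y (gsstPDF μ Sig γ m H) →
      HasDensity P Z (gsstPDF 0 1 γ m H) ∧
      (2 < m →
        (∀ i, MemLp (fun s => Y s i) 2 P ∧ MemLp (fun s => Z s i) 2 P) ∧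
        ∀ q : Fin n → ℝ, (∀ i, 0 < q i ∧ q i < 1) →
          ∀ lam : Fin n → ℝ, lam = standardize μ Sig (VaRVec P Y q) →
          0 < tailFn (gsstPDF 0 1 γ m H) lam →
          condMean P Y {s | ∀ i, lam i < Z s i} = μ + msqrt Sig *ᵥ MTCE P Z lam ∧
          condCov P Y {s | ∀ i, lam i < Z s i} = msqrt Sig * MTCov P Z lam * msqrt Sig ∧
          (Sig.IsDiag →
            MTCE P Y (VaRVec P Y q) = μ + msqrt Sig *ᵥ MTCE P Z lam ∧
            MTCov P Y (VaRVec P Y q) = msqrt Sig * MTCov P Z lam * msqrt Sig))) ∧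
    -- the entries of `Ω`, general skewing function
    (4 < m → ∀ H : ℝ → ℝ, IsSkewing H → ContDiff ℝ 2 H →
      HasDensity P Y (gsstPDF μ Sig γ m H) → ∀ lam : Fin n → ℝ,
      0 < tailFn (gsstPDF 0 1 γ m H) lam →
      HasTailExp (stPDF 0 1 m) lam (fun z => (1 + z ⬝ᵥ z / m) * deriv H (γ ⬝ᵥ z)) →
      (∀ k, HasTailExp (stV m lam k) (drop1 k lam)
        (fun v => deriv H (γ ⬝ᵥ insert1 k lam v))) →
      HasTailExp (ellPDF 0 1 (G2 n m)) lam (fun x => deriv (deriv H) (γ ⬝ᵥ x)) →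
      (∀ k, MTCE P Z lam k = 1 / tailFn (gsstPDF 0 1 γ m H) lam *
        (2 * (c0 n m / cW n m (lam k)) *
            tailExp (stW m lam k) (drop1 k lam) (fun w => H (γ ⬝ᵥ insert1 k lam w)) +
          2 * m * γ k / (m + n - 2) *
            tailExp (stPDF 0 1 m) lam (fun z => (1 + z ⬝ᵥ z / m) * deriv H (γ ⬝ᵥ z)))) ∧
      (∀ i j, i ≠ j → MTCov P Z lam i j = 2 / tailFn (gsstPDF 0 1 γ m H) lam *
        (c0 n m / cU n m (lam i) (lam j) *
            tailExp (stU m lam i j) (drop2 i j lam) (fun u => H (γ ⬝ᵥ insert2 i j lam u)) +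
          c0 n m / cV n m (lam i) * γ j *
            tailExp (stV m lam i) (drop1 i lam) (fun v => deriv H (γ ⬝ᵥ insert1 i lam v)) +
          c0 n m / cV n m (lam j) * γ i *
            tailExp (stV m lam j) (drop1 j lam) (fun v => deriv H (γ ⬝ᵥ insert1 j lam v)) +
          m ^ 2 / ((m - 2) * (m - 4)) * γ i * γ j *
            tailExp (ellPDF 0 1 (G2 n m)) lam (fun x => deriv (deriv H) (γ ⬝ᵥ x))) -
        MTCE P Z lam i * MTCE P Z lam j) ∧
      (∀ i, MTCov P Z lam i i = 2 / tailFn (gsstPDF 0 1 γ m H) lam *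
        (c0 n m / cW n m (lam i) * lam i *
            tailExp (stW m lam i) (drop1 i lam) (fun w => H (γ ⬝ᵥ insert1 i lam w)) +
          c0 n m / cV n m (lam i) * γ i *
            tailExp (stV m lam i) (drop1 i lam) (fun v => deriv H (γ ⬝ᵥ insert1 i lam v)) +
          m ^ 2 / ((m - 2) * (m - 4)) * γ i ^ 2 *
            tailExp (ellPDF 0 1 (G2 n m)) lam (fun x => deriv (deriv H) (γ ⬝ᵥ x))) +
        m / (m - 2) * (tailFn (gsePDF 0 1 (G1 n m) (fun z => H (γ ⬝ᵥ z))) lam /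
          tailFn (gsstPDF 0 1 γ m H) lam) -
        MTCE P Z lam i ^ 2)) ∧
    -- the skew Student-t distribution, `H` the Student-t distribution function
    (4 < m → HasDensity P Y (gsstPDF μ Sig γ m (tCDF m)) → ∀ lam : Fin n → ℝ,
      (∀ k, MTCE P Z lam k = 1 / tailFn (gsstPDF 0 1 γ m (tCDF m)) lam *
        (2 * (c0 n m / cW n m (lam k)) *
            tailExp (stW m lam k) (drop1 k lam) (fun w => tCDF m (γ ⬝ᵥ insert1 k lam w)) +
          2 * m * γ k / (m + n - 2) *
            tailExp (stPDF 0 1 m) lam (fun z => (1 + z ⬝ᵥ z / m) * tPDF m (γ ⬝ᵥ z)))) ∧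
      (∀ i j, i ≠ j → MTCov P Z lam i j = 2 / tailFn (gsstPDF 0 1 γ m (tCDF m)) lam *
        (c0 n m / cU n m (lam i) (lam j) *
            tailExp (stU m lam i j) (drop2 i j lam) (fun u => tCDF m (γ ⬝ᵥ insert2 i j lam u)) +
          c0 n m / cV n m (lam i) * γ j *
            tailExp (stV m lam i) (drop1 i lam) (fun v => tPDF m (γ ⬝ᵥ insert1 i lam v)) -
          (m + 1) * m / ((m - 2) * (m - 4)) * γ i * γ j *
            tailExp (ellPDF 0 1 (G2 n m)) lam (fun x =>
              (1 + (γ ⬝ᵥ x) ^ 2 / m)⁻¹ * (γ ⬝ᵥ x) * tPDF m (γ ⬝ᵥ x)) +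
          c0 n m / cV n m (lam j) * γ i *
            tailExp (stV m lam j) (drop1 j lam) (fun v => tPDF m (γ ⬝ᵥ insert1 j lam v))) -
        MTCE P Z lam i * MTCE P Z lam j) ∧
      (∀ i, MTCov P Z lam i i = 2 / tailFn (gsstPDF 0 1 γ m (tCDF m)) lam *
        (c0 n m / cW n m (lam i) * lam i *
            tailExp (stW m lam i) (drop1 i lam) (fun w => tCDF m (γ ⬝ᵥ insert1 i lam w)) +
          c0 n m / cV n m (lam i) * γ i *
            tailExp (stV m lam i) (drop1 i lam) (fun v => tPDF m (γ ⬝ᵥ insert1 i lam v)) -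
          (m + 1) * m / ((m - 2) * (m - 4)) * γ i ^ 2 *
            tailExp (ellPDF 0 1 (G2 n m)) lam (fun x =>
              (1 + (γ ⬝ᵥ x) ^ 2 / m)⁻¹ * (γ ⬝ᵥ x) * tPDF m (γ ⬝ᵥ x))) +
        m / (m - 2) * (tailFn (gsePDF 0 1 (G1 n m) (fun z => tCDF m (γ ⬝ᵥ z))) lam /
          tailFn (gsstPDF 0 1 γ m (tCDF m)) lam) -
        MTCE P Z lam i ^ 2)) ∧
    -- the symmetric Student-t distribution, `H = 1/2`
    (2 < m → HasDensity P Y (gsstPDF μ Sig γ m (fun _ => 1 / 2)) →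
      HasDensity P Z (stPDF 0 1 m) ∧
      ∀ lam : Fin n → ℝ,
      (∀ k, MTCE P Z lam k = 1 / tailFn (stPDF 0 1 m) lam *
        (c0 n m / cW n m (lam k) * tailFn (stW m lam k) (drop1 k lam))) ∧
      (∀ i j, i ≠ j → MTCov P Z lam i j = 1 / tailFn (stPDF 0 1 m) lam *
        (c0 n m / cU n m (lam i) (lam j) * tailFn (stU m lam i j) (drop2 i j lam)) -
        MTCE P Z lam i * MTCE P Z lam j) ∧
      (∀ i, MTCov P Z lam i i = 1 / tailFn (stPDF 0 1 m) lam *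
        (c0 n m / cW n m (lam i) * lam i * tailFn (stW m lam i) (drop1 i lam)) +
        m / (m - 2) * (tailFn (ellPDF 0 1 (G1 n m)) lam / tailFn (stPDF 0 1 m) lam) -
        MTCE P Z lam i ^ 2)) := by
  subst hZ
  have hn' : (2 : ℝ) ≤ n := by exact_mod_cast hn
  have hn0 : n ≠ 0 := by omega
  refine ⟨⟨gsstPDF_eq_gsePDF hm μ γ Sig, c0_eq hm, fun t ht => ?_, fun h t ht => ?_, fun h => ?_,
    fun h => ?_⟩, fun lam => ⟨fun h k => ?_, fun h k => ?_, fun h i j hij => ?_⟩,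
    fun H hH hY => ⟨hasDensity_standardize hSig hm hH.1 hY, fun h => ⟨fun i => ?_, ?_⟩⟩,
    fun h H hH hC hY lam hpos h1 h2 h3 => ?_, fun h hY lam => ?_, fun h hY => ?_⟩
  · rw [neg_div, G1_eq hm (by linarith) ht]
  · rw [neg_div, G2_eq hm h ht]
  · exact ⟨c1_eq_integral h hn0, c1_eq_beta h hn0, c0_div_c1 h⟩
  · exact ⟨c2_eq_integral h hn0, c2_eq_beta h hn0, c0_div_c2 h⟩
  · exact ⟨fW_eq hn h lam k, fW_eq_stW hn h lam k, cW_eq hn h _, c0_div_cW hn h _⟩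
  · exact ⟨fV_eq hn h lam k, fV_eq_stV hn h lam k, cV_eq hn h _, c0_div_cV hn h _⟩
  · exact ⟨fU_eq hn h lam i j, fU_eq_stU hn h lam hij, cU_eq hn h _ _, c0_div_cU hn h _ _⟩
  · have hmem := memLp_two_of_hasDensity h hH.1 (fun x => (hH.2.2 x).1) (fun x => (hH.2.2 x).2)
      (hasDensity_standardize hSig hm hH.1 hY)
    exact ⟨memLp_two_affine (msqrt Sig)
      (fun s => (add_msqrt_mulVec_standardize hSig μ (Y s)).symm) hmem i, hmem i⟩
  · intro q _ lam hlam hpos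
    exact tail_moments_affine hSig h hH hY hlam hpos
  · have hB := hH.bddTwiceDiff hC
    have hI := tailIntegrable_of_hasTailExp h hn hB h1 h2 h3
    have hD := hasDensity_standardize hSig hm hH.1 hY
    have hH0 := fun x => (hH.2.2 x).1
    have hm2 : 2 < m := by linarith
    refine ⟨fun k => ?_, fun i j hij => ?_, fun i => ?_⟩
    -- The associativity rewrites here and below only bring each quotient of constants next to its
    -- tail expectation, so that the translation lemmas match.
    · rw [MTCE_eq hm2 hB hH0 hI hD k hn, mul_assoc 2 (c0 n m / _),
        tailExp_stW hn (by linarith), tailExp_stPDF hm]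
      ring
    · rw [MTCov_eq_of_ne hm2 hn hB hH0 hI hD hpos hij, tailExp_stU hn hm2 hij,
        mul_right_comm (c0 n m / _) (γ j), tailExp_stV hn (by linarith), mul_right_comm (c0 n m / _) (γ i),
        tailExp_stV hn (by linarith), mul_assoc (m ^ 2 / _) (γ i),
        mul_right_comm (m ^ 2 / _) (γ i * γ j),
        tailExp_ellPDF_G2 hn h]
      ring
    · rw [MTCov_eq_self hm2 hn hB hH0 hI hD hpos, mul_right_comm (c0 n m / _) (lam i),
        tailExp_stW hn (by linarith), mul_right_comm (c0 n m / _) (γ i), tailExp_stV hn (by linarith),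
        mul_right_comm (m ^ 2 / _) (γ i ^ 2), tailExp_ellPDF_G2 hn h, ← mul_div_assoc (m / (m - 2)),
        tailFn_gsePDF_G1 hn hm2]
      ring
  · have hB := bddTwiceDiff_tCDF hm
    have hI := tailIntegrable_of_bounded (γ := γ) (lam := lam) h hn hB (B' := tPDF m 0)
      (fun x => by rw [abs_of_pos (tPDF_pos hm x)]; exact tPDF_le hm x) (abs_deriv_tPDF_le hm)
    have hD := hasDensity_standardize hSig hm hB.continuous.measurable hY
    have hH0 := fun x => (tCDF_pos hm x).le
    have hpos := tailFn_gsstPDF_pos (γ := γ) (lam := lam) hm hB.continuous hB.bdd (tCDF_pos hm)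
    have hm2 : 2 < m := by linarith
    -- The second derivative of the distribution function contributes `-(m+1)/m`, which turns
    -- `m²/((m-2)(m-4))` into `-(m+1)m/((m-2)(m-4))`.
    have hsecond : ∀ a : ℝ, (m + 1) * m / ((m - 2) * (m - 4)) * a *
        tailExp (ellPDF 0 1 (G2 n m)) lam (fun x =>
          (1 + (γ ⬝ᵥ x) ^ 2 / m)⁻¹ * (γ ⬝ᵥ x) * tPDF m (γ ⬝ᵥ x)) =
        -(a * (c0 n m * (m / (m + n - 2) * (m / (m + n - 4))) *
          tailInt m ((m + n) / 2 - 2) γ lam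
            (fun x => -(m + 1) / m * ((1 + x ^ 2 / m)⁻¹ * x * tPDF m x)))) := by
      intro a
      rw [← tailExp_ellPDF_G2 hn h]
      have e : tailExp (ellPDF 0 1 (G2 n m)) lam (fun x => -(m + 1) / m *
          ((1 + (γ ⬝ᵥ x) ^ 2 / m)⁻¹ * (γ ⬝ᵥ x) * tPDF m (γ ⬝ᵥ x))) = -(m + 1) / m *
          tailExp (ellPDF 0 1 (G2 n m)) lam (fun x =>
            (1 + (γ ⬝ᵥ x) ^ 2 / m)⁻¹ * (γ ⬝ᵥ x) * tPDF m (γ ⬝ᵥ x)) := by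
        rw [tailExp, tailExp, ← integral_const_mul]
        simp only [mul_assoc]
      rw [e]
      have : m - 2 ≠ 0 := by linarith
      have : m - 4 ≠ 0 := by linarith
      field_simp
    refine ⟨fun k => ?_, fun i j hij => ?_, fun i => ?_⟩
    · rw [MTCE_eq hm2 hB hH0 hI hD k hn, mul_assoc 2 (c0 n m / _),
        tailExp_stW hn (by linarith), tailExp_stPDF hm]
      ring
    · rw [MTCov_eq_of_ne hm2 hn hB hH0 hI hD hpos hij, tailExp_stU hn hm2 hij,
        mul_right_comm (c0 n m / _) (γ j), tailExp_stV hn (by linarith), mul_assoc ((m + 1) * m / _) (γ i), hsecond,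
        mul_right_comm (c0 n m / _) (γ i), tailExp_stV hn (by linarith)]
      ring
    · rw [MTCov_eq_self hm2 hn hB hH0 hI hD hpos, mul_right_comm (c0 n m / _) (lam i),
        tailExp_stW hn (by linarith), mul_right_comm (c0 n m / _) (γ i), tailExp_stV hn (by linarith),
        hsecond, ← mul_div_assoc (m / (m - 2)), tailFn_gsePDF_G1 hn hm2]
      ring
  · have hB := bddTwiceDiff_const (1 / 2)
    have hD := hasDensity_standardize hSig hm hB.continuous.measurable hY
    have hst : gsstPDF (0 : Fin n → ℝ) 1 γ m (fun _ => 1 / 2) = stPDF 0 1 m := by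
      funext z
      rw [gsstPDF]
      ring
    have hH0 : ∀ x : ℝ, (0 : ℝ) ≤ (fun _ : ℝ => 1 / 2) x := fun _ => by norm_num
    refine ⟨hst ▸ hD, fun lam => ?_⟩
    have hI := tailIntegrable_zero (m := m) (ρ := (m + n) / 2) (γ := γ) (lam := lam)
    have hpos := tailFn_gsstPDF_pos (γ := γ) (lam := lam) hm hB.continuous hB.bdd
      (fun _ => by norm_num)
    -- The constant one half comes out of every face and edge integral and cancels the factor 2 of
    -- the skewed density.
    have hface : ∀ p k, faceInt m p γ lam k (fun _ => 1 / 2) =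
        1 / 2 * faceInt m p γ lam k (fun _ => 1) := fun p k => by
      rw [faceInt, faceInt, integral_mul_const, integral_mul_const]
      ring
    have hedge : ∀ p i j, edgeInt m p γ lam i j (fun _ => 1 / 2) =
        1 / 2 * edgeInt m p γ lam i j (fun _ => 1) := fun p i j => by
      rw [edgeInt, edgeInt, integral_mul_const, integral_mul_const]
      ring
    have hface0 : ∀ p k, faceInt m p γ lam k (fun _ => 0) = 0 := fun p k => by simp [faceInt]
    have htail0 : ∀ p, tailInt m p γ lam (fun _ => 0) = 0 := fun p => by simp [tailInt]
    have hW : ∀ k, c0 n m / cW n m (lam k) * tailFn (stW m lam k) (drop1 k lam) =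
        c0 n m * (m / (m + n - 2)) * faceInt m ((m + n) / 2 - 1) γ lam k (fun _ => 1) :=
      fun k => by
        rw [← tailExp_stW hn (by linarith), tailExp, tailFn]
        simp only [one_mul]
    have hU : ∀ i j, i ≠ j → c0 n m / cU n m (lam i) (lam j) *
        tailFn (stU m lam i j) (drop2 i j lam) =
        c0 n m * (m / (m + n - 2) * (m / (m + n - 4))) *
          edgeInt m ((m + n) / 2 - 2) γ lam i j (fun _ => 1) := fun i j hij => by
      rw [← tailExp_stU hn h hij, tailExp, tailFn]
      simp only [one_mul]
    have hG : m / (m - 2) * tailFn (ellPDF 0 1 (G1 n m)) lam =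
        2 * c0 n m * (m / (m + n - 2)) *
          tailInt m ((m + n) / 2 - 1) γ lam (fun _ => 1 / 2) := by
      rw [← tailFn_gsePDF_G1 hn h, tailFn, tailFn]
      congr 2
      funext z
      rw [gsePDF]
      ring
    refine ⟨fun k => ?_, fun i j hij => ?_, fun i => ?_⟩
    · rw [MTCE_eq h hB hH0 hI hD k hn, hst, hW, hface, htail0]
      ring
    · rw [MTCov_eq_of_ne h hn hB hH0 hI hD hpos hij, hst, hU i j hij, hedge, hface0, hface0, htail0]
      ring
    · rw [MTCov_eq_self h hn hB hH0 hI hD hpos, hst, mul_right_comm (c0 n m / _) (lam i), hW,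
        ← mul_div_assoc (m / (m - 2)), hG, hface, hface0, htail0]
      ring
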